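/- **Theorem (sharp geometric inequalities for the two-dimensional exterior Dirichlet problem).** Let $\Omega\subset\mathbb R^2$ be an unbounded domain whose boundary $\partial\Omega$ is a smooth Jordan curve of length $L_{\partial\Omega}$, let $\Phi>0$, and let $U$ be a real function, smooth on $\Omega\cup\partial\Omega$ (up to the boundary), such that $\Delta U=0$ in $\Omega$, $U$ is constant on $\partial\Omega$, $-\oint_{\partial\Omega}\boldsymbol n\cdot\nabla U\,\mathrm ds=\Phi$, and $$U(\boldsymbol r)\sim-\frac{\Phi}{2\pi}\log\frac{2\pi|\boldsymbol r|}{L_{\partial\Omega}}\qquad(|\boldsymbol r|\to\infty).$$ Write $E=|\nabla U|$. Then $E\neq0$ on $\Omega\cup\partial\Omega$, and every non-empty level set $\Sigma=\{\boldsymbol r\in\Omega\cup\partial\Omega: U(\boldsymbol r)=\varphi\}$ is a smooth Jordan curve. Let $\boldsymbol n$ be the outward unit normal of a smooth Jordan curve (pointing away from the region it encloses), $\kappa$ its signed curvature (positive for circles), $\partial/\partial s$ the derivative along the curve with respect to arc length, $L_\Sigma$ the length of $\Sigma$, $\langle f\rangle_\Sigma=\frac1{L_\Sigma}\oint_\Sigma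 f\,\mathrm ds$, and $\operatorname{cov}_\Sigma(f,g)=\big\langle(f-\langle f\rangle_\Sigma)(g-\langle g\rangle_\Sigma)\big\rangle_\Sigma$. Then every such $\Sigma$ satisfies 1. $\operatorname{cov}_\Sigma\!\left(\dfrac{\kappa}{E},E\right)\ge0$; 2. $\left\langle\dfrac1E\right\rangle_\Sigma\ge\left\langle\dfrac{\kappa}{E}\right\rangle_\Sigma\langle\boldsymbol n\cdot\boldsymbol r\rangle_\Sigma$; 3. $\operatorname{cov}_\Sigma(\kappa,E)\ge0$; 4. $\operatorname{cov}_\Sigma\!\left(\dfrac{\kappa}{2\pi},\log\dfrac{EL_\Sigma}{\Phi}\right)\ge\operatorname{cov}_\Sigma\!\left(\dfrac{E}{\Phi},\log\dfrac{EL_\Sigma}{\Phi}\right)$; 5. $\left\langle\left[\boldsymbol n\times\nabla\dfrac{\kappa}{E}\right]\cdot\left[\boldsymbol n\times\nabla\dfrac1E\right]\right\rangle_\Sigma=\left\langle\dfrac{\partial}{\partial s}\!\left(\dfrac{\kappa}{E}\right)\dfrac{\partial}{\partial s}\!\left(\dfrac1E\right)\right\rangle_\Sigma\le0$, where $\boldsymbol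 n\times\nabla f$ is the tangential gradient of $f$, rotated by $90^\circ$; 6. $\left\langle\dfrac{\kappa}{E^2}\right\rangle_\Sigma\le\dfrac{2\pi}{\Phi}\left\langle\dfrac1E\right\rangle_\Sigma$. Each of the six inequalities is strict if $\partial\Omega$ is not a circle, and is an equality if $\partial\Omega$ is a circle. -/

import Mathlib

open Real Set Filter Topology Asymptotics
open scoped ContDiff ComplexConjugate

/-!
The plane `ℝ²` is identified with `ℂ`, which carries the Euclidean norm and, through
`inner ℝ`, the Euclidean inner product.  Closed curves are parametrized by `γ : ℝ → ℂ` with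
period `2π`, and a scalar function on a curve is given as a function of the parameter.
-/

noncomputable section

namespace EquipotentialCurves

/-- `γ` is a regular `C^∞` parametrization, of period `2π` and counterclockwise, of the smooth
Jordan curve `C`.  The last field says that the enclosed signed area `½ ∮ (x dy - y dx)` is
positive. -/
structure IsJordanParam (γ : ℝ → ℂ) (C : Set ℂ) : Prop where
  smooth : ContDiff ℝ ∞ γ
  periodic : Function.Periodic γ (2 * π)
  regular : ∀ t, deriv γ t ≠ 0
  injOn : InjOn γ (Ico 0 (2 * π))
  range_eq : range γ = C
  counterclockwise : 0 < ∫ t in (0 : ℝ)..(2 * π), (conj (γ t) * deriv γ t).im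

/-- The circumference `L = ∮ ds`. -/
def length (γ : ℝ → ℂ) : ℝ := ∫ t in (0 : ℝ)..(2 * π), ‖deriv γ t‖

/-- The arc length integral `∮ f ds`. -/
def arcIntegral (γ : ℝ → ℂ) (f : ℝ → ℝ) : ℝ := ∫ t in (0 : ℝ)..(2 * π), f t * ‖deriv γ t‖

/-- The average `⟨f⟩` over the curve, weighted by arc length. -/
def avg (γ : ℝ → ℂ) (f : ℝ → ℝ) : ℝ := arcIntegral γ f / length γ

/-- The geometric covariance of two functions on the curve. -/
def cov (γ : ℝ → ℂ) (f g : ℝ → ℝ) : ℝ :=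
  avg γ fun t => (f t - avg γ f) * (g t - avg γ g)

/-- The unit normal to the right of the direction of motion; it is the outward one for a
counterclockwise curve. -/
def normal (γ : ℝ → ℂ) (t : ℝ) : ℂ := -Complex.I * (deriv γ t / (‖deriv γ t‖ : ℂ))

/-- The signed curvature `(x' y'' - y' x'') / |γ'|³`. -/
def curvature (γ : ℝ → ℂ) (t : ℝ) : ℝ :=
  (conj (deriv γ t) * deriv (deriv γ) t).im / ‖deriv γ t‖ ^ 3

/-- The tangential derivative `∂f/∂s`.  In the plane it is the only component of the tangential
gradient `n × ∇f`, so that `(n × ∇f) · (n × ∇g) = (∂f/∂s) (∂g/∂s)`. -/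
def tangentialDeriv (γ : ℝ → ℂ) (f : ℝ → ℝ) (t : ℝ) : ℝ := deriv f t / ‖deriv γ t‖

/-- The gradient `∇U` on `Ω ∪ ∂Ω`: the usual gradient in the open set `Ω`, and the one-sided
gradient, from within `Ω ∪ ∂Ω`, on `∂Ω`. -/
def grad (Ω : Set ℂ) (U : ℂ → ℝ) (r : ℂ) : ℂ := gradientWithin U (closure Ω) r

/-- The field intensity `E = |∇U|` on `Ω ∪ ∂Ω`. -/
def intensity (Ω : Set ℂ) (U : ℂ → ℝ) (r : ℂ) : ℝ := ‖grad Ω U r‖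

/-- `U` solves the exterior Dirichlet problem with flux `Φ` in the unbounded domain `Ω`, whose
boundary is the smooth Jordan curve parametrized by `γ₀`.  (The complement of `Ω` is bounded, so
that the behaviour of `U` at infinity only concerns its values in `Ω`.) -/
structure IsExteriorDirichlet (Ω : Set ℂ) (γ₀ : ℝ → ℂ) (U : ℂ → ℝ) (Φ : ℝ) : Prop where
  isOpen : IsOpen Ω
  isConnected : IsConnected Ω
  unbounded : ¬ Bornology.IsBounded Ω
  boundary : IsJordanParam γ₀ (frontier Ω)
  smooth : ContDiffOn ℝ ∞ U (closure Ω)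
  harmonic : InnerProductSpace.HarmonicOnNhd U Ω
  const_boundary : ∃ c : ℝ, ∀ r ∈ frontier Ω, U r = c
  flux_pos : 0 < Φ
  flux : -arcIntegral γ₀ (fun t => inner ℝ (normal γ₀ t) (grad Ω U (γ₀ t))) = Φ
  at_infinity : U ~[Bornology.cobounded ℂ]
    fun r => -(Φ / (2 * π)) * Real.log (2 * π * ‖r‖ / length γ₀)

/-- The level set `Σ_φ` of `U` in `Ω ∪ ∂Ω`. -/
def levelSet (Ω : Set ℂ) (U : ℂ → ℝ) (φ : ℝ) : Set ℂ := {r ∈ closure Ω | U r = φ}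

/-- `C` is a circle (of positive radius). -/
def IsCircle (C : Set ℂ) : Prop := ∃ (c : ℂ) (R : ℝ), 0 < R ∧ C = Metric.sphere c R

/-- The inequality `a ≤ b`, with equality exactly when `P` holds. -/
def LeWithEqIff (P : Prop) (a b : ℝ) : Prop := a ≤ b ∧ (a = b ↔ P)

end EquipotentialCurves

end

/-! Subtracting the boundary value and rescaling turns `U` into a harmonic `u` with `u = 0` on the
frontier and `u ∼ log |z|` at infinity. Its complex gradient `G = u_x - i u_y` is holomorphic and `E
= Φ/(2π) |G|`. With `v` a conjugate of `u`, the function `W = exp (-(u + i v))` maps `Ω` conformally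
onto the punctured unit disc; `φ` is its inverse. The level `u = s` is the image of the circle of
radius `r = e^{-s}`, and in terms of the angle `α` arc length is `ds = dα / |G|`.

The function `ζ / G (φ ζ)` extends to a nonvanishing holomorphic function on the disc. Let `ℓ` be
its logarithm and `b = ζ ℓ' = 1 + G'/G²`. Then `b 0 = 0`, `log |G| = log r - Re ℓ`, and
differentiating `Re (G γ') = 0` along a level curve gives `κ = |G| (1 - Re b)` (`curvature_eq`). All
six inequalities thus become statements about circle integrals of `b` against functions of `|G|`.
Every sign comes from one Parseval identity (`hasSum_discPairing`): for `P = ∑ aₙ ζⁿ`, `Re ∫ conj P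
· ζ P' dθ = 2π ∑ n |aₙ|² r^{2n} ≥ 0`. The choice `P = exp (e ℓ / 2)` controls `∫ |G|^{-e} Re b`, `P
= ℓ` the logarithmic covariances and `P = i b` the tangential derivatives. The estimate with `n · r`
also uses the area theorem, and the covariance of `κ` and `E` also uses Cauchy–Schwarz.

The pairing grows with `r`, so strict positivity survives in the limit `r → 1`, on `∂Ω` itself. It
vanishes only if `P` is constant, which means `b = 0`, `G = 1/(z - z₀)`, and `Ω` is the exterior of
a disc. Conversely, if `∂Ω` is a circle then `κ` is constant on it and has zero covariance with `E`,
which excludes `b ≠ 0`.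

The analytic input is the conformal map and its boundary behaviour. `W` is single-valued because, by
Cauchy–Pompeiu, `G` is the Cauchy transform of a unit mass near `Ωᶜ`, whose poles may be moved
inside the connected set `Ωᶜ` (`isExactOn_sub_pole`). Injectivity is a continuity argument in the
level (`injOn`). Tangent discs and the Hopf lemma give `G ≠ 0` on `∂Ω`, so in logarithmic
coordinates the map extends to the closed half-plane (`exists_halfPlaneMap`), and uniqueness for an
ODE relates an arbitrary Jordan parametrization of a level to the angle (`exists_angle`). -/

noncomputable section

namespace EquipotentialCurves

open MeasureTheory

/-! ### Power series on circles and the positive pairing of `P` with `z P'` -/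

section

/-- The point `r e^{iθ}`. -/
def polarPt (r θ : ℝ) : ℂ := r * Complex.exp (θ * Complex.I)

@[fun_prop]
lemma continuous_polarPt : Continuous fun x : ℝ × ℝ => polarPt x.1 x.2 := by
  unfold polarPt; fun_prop

lemma norm_polarPt (r θ : ℝ) : ‖polarPt r θ‖ = |r| := by
  simp [polarPt, Complex.norm_exp_ofReal_mul_I]

lemma polarPt_pow (r θ : ℝ) (n : ℕ) :
    polarPt r θ ^ n = (r : ℂ) ^ n * Complex.exp (n * (θ * Complex.I)) := by
  simp [polarPt, mul_pow, Complex.exp_nat_mul]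

lemma integral_exp_int_mul (k : ℤ) :
    ∫ θ in (0 : ℝ)..(2 * π), Complex.exp (k * (θ * Complex.I)) = if k = 0 then 2 * π else 0 := by
  split_ifs with h
  · simp [h]
  · have hk : (k : ℂ) * Complex.I ≠ 0 := by simp [h]
    have := integral_exp_mul_complex (a := 0) (b := 2 * π) hk
    rw [show (fun θ : ℝ => Complex.exp (k * (θ * Complex.I)))
      = fun θ : ℝ => Complex.exp (k * Complex.I * θ) by ext; ring_nf, this]
    have h2 : Complex.exp (k * Complex.I * ((2 * π : ℝ) : ℂ)) = 1 := by
      rw [← Complex.exp_int_mul_two_pi_mul_I k]; push_cast; ring_nf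
    rw [h2]; simp

/-- A power series on a circle is integrated term by term against a continuous function. -/
lemma hasSum_integral_powerSeries {P : ℂ → ℂ} {a : ℕ → ℂ} {r : ℝ} (hr : 0 ≤ r)
    (hsum : Summable fun n => ‖a n‖ * r ^ n)
    (hP : ∀ θ : ℝ, HasSum (fun n => a n * polarPt r θ ^ n) (P (polarPt r θ)))
    {g : ℝ → ℂ} (hg : Continuous g) :
    HasSum (fun n => a n * ∫ θ in (0 : ℝ)..(2 * π), polarPt r θ ^ n * g θ)
      (∫ θ in (0 : ℝ)..(2 * π), P (polarPt r θ) * g θ) := by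
  have hcont : ∀ n : ℕ, Continuous fun θ : ℝ => polarPt r θ ^ n := fun n => by
    unfold polarPt; fun_prop
  obtain ⟨M, hM⟩ := (isCompact_Icc (a := (0 : ℝ)) (b := 2 * π)).exists_bound_of_continuousOn
    hg.continuousOn
  have key := intervalIntegral.hasSum_integral_of_dominated_convergence
    (μ := volume) (a := (0 : ℝ)) (b := 2 * π)
    (F := fun n θ => a n * polarPt r θ ^ n * g θ) (f := fun θ => P (polarPt r θ) * g θ)
    (fun n _ => ‖a n‖ * r ^ n * M)
    (fun n => ((continuous_const.mul (hcont n)).mul hg).aestronglyMeasurable)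
    (fun n => Eventually.of_forall fun θ hθ => by
      rw [norm_mul, norm_mul, norm_pow, norm_polarPt, abs_of_nonneg hr]
      gcongr
      rw [uIoc_of_le (by positivity)] at hθ
      exact hM θ ⟨hθ.1.le, hθ.2⟩)
    (Eventually.of_forall fun θ _ => hsum.mul_right M)
    (by simp)
    (Eventually.of_forall fun θ _ => (hP θ).mul_right _)
  refine key.congr_fun ?_
  intro n
  rw [← intervalIntegral.integral_const_mul]
  simp [mul_assoc]

/-- The Taylor coefficients at `0`. -/
def taylorCoeff (P : ℂ → ℂ) (n : ℕ) : ℂ := (n.factorial : ℂ)⁻¹ * iteratedDeriv n P 0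

lemma hasSum_taylorCoeff {P : ℂ → ℂ} (hP : DifferentiableOn ℂ P (Metric.ball 0 1)) {z : ℂ}
    (hz : ‖z‖ < 1) : HasSum (fun n => taylorCoeff P n * z ^ n) (P z) := by
  have := Complex.hasSum_taylorSeries_on_ball hP (z := z) (by simpa using hz)
  refine this.congr_fun fun n => ?_
  simp only [taylorCoeff, sub_zero, smul_eq_mul]; ring

lemma summable_taylorCoeff {P : ℂ → ℂ} (hP : DifferentiableOn ℂ P (Metric.ball 0 1)) {r : ℝ}
    (hr : 0 ≤ r) (hr1 : r < 1) : Summable fun n => ‖taylorCoeff P n‖ * r ^ n := by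
  have h := (hasSum_taylorCoeff hP (z := (r : ℂ)) (by simpa [abs_of_nonneg hr])).summable.norm
  simpa [abs_of_nonneg hr] using h

lemma hasSum_mul_deriv {P : ℂ → ℂ} (hP : DifferentiableOn ℂ P (Metric.ball 0 1)) {z : ℂ}
    (hz : ‖z‖ < 1) : HasSum (fun n : ℕ => n * taylorCoeff P n * z ^ n) (z * deriv P z) := by
  have h := (Complex.hasSum_taylorSeries_on_ball (hP.deriv Metric.isOpen_ball) (z := z)
    (by simpa using hz)).mul_left z
  rw [← hasSum_nat_add_iff' 1]
  simp only [Finset.range_one, Finset.sum_singleton, Nat.cast_zero, zero_mul, sub_zero]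
  refine h.congr_fun fun n => ?_
  simp only [taylorCoeff, sub_zero, smul_eq_mul, iteratedDeriv_succ', Nat.factorial_succ]
  have : ((n : ℂ) + 1) ≠ 0 := by exact_mod_cast n.succ_ne_zero
  push_cast
  field_simp
  ring

/-- Parseval on a circle: `Q` is expanded first, then `P` inside each term, and orthogonality of the
exponentials leaves only the diagonal. -/
lemma hasSum_integral_mul_conj {P Q : ℂ → ℂ} {a b : ℕ → ℂ} {r : ℝ} (hr : 0 ≤ r)
    (ha : Summable fun n => ‖a n‖ * r ^ n) (hb : Summable fun n => ‖b n‖ * r ^ n)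
    (hP : ∀ θ : ℝ, HasSum (fun n => a n * polarPt r θ ^ n) (P (polarPt r θ)))
    (hQ : ∀ θ : ℝ, HasSum (fun n => b n * polarPt r θ ^ n) (Q (polarPt r θ)))
    (hPc : Continuous fun θ => P (polarPt r θ)) :
    HasSum (fun n : ℕ => 2 * π * (conj (a n) * b n * (r : ℂ) ^ (2 * n)))
      (∫ θ in (0 : ℝ)..(2 * π), conj (P (polarPt r θ)) * Q (polarPt r θ)) := by
  have hcP : Continuous fun θ => conj (P (polarPt r θ)) := Complex.continuous_conj.comp hPc
  have h1 := hasSum_integral_powerSeries hr hb hQ hcP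
  have h2 : ∀ m : ℕ, (∫ θ in (0 : ℝ)..(2 * π), polarPt r θ ^ m * conj (P (polarPt r θ)))
      = 2 * π * conj (a m) * (r : ℂ) ^ (2 * m) := by
    intro m
    have hc : Continuous fun θ : ℝ => conj (polarPt r θ ^ m) := by
      unfold polarPt; fun_prop
    have h3 := hasSum_integral_powerSeries hr ha hP hc
    have h4 : ∀ n : ℕ, (∫ θ in (0 : ℝ)..(2 * π), polarPt r θ ^ n * conj (polarPt r θ ^ m))
        = if n = m then 2 * π * (r : ℂ) ^ (2 * m) else 0 := by
      intro n
      have h5 : ∀ θ : ℝ, polarPt r θ ^ n * conj (polarPt r θ ^ m) =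
          (r : ℂ) ^ (n + m) * Complex.exp (((n - m : ℤ) : ℂ) * (θ * Complex.I)) := by
        intro θ
        rw [polarPt_pow, polarPt_pow, map_mul, ← Complex.exp_conj]
        simp only [map_pow, Complex.conj_ofReal, map_mul, map_natCast, Complex.conj_I]
        rw [mul_mul_mul_comm, ← Complex.exp_add, ← pow_add]
        congr 2
        push_cast; ring
      simp only [h5]
      rw [intervalIntegral.integral_const_mul, integral_exp_int_mul]
      by_cases hnm : n = m
      · subst hnm; simp; ring_nf
      · rw [if_neg (by omega), if_neg hnm]; simp
    simp only [h4, mul_ite, mul_zero] at h3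
    have h6 := h3.unique (hasSum_ite_eq m (a m * (2 * π * (r : ℂ) ^ (2 * m))) |>.congr_fun
      (fun n => by by_cases h : n = m <;> simp [h]))
    have h7 := congrArg conj h6
    rw [← intervalIntegral.intervalIntegral_conj] at h7
    simp only [map_mul, Complex.conj_conj, map_pow, Complex.conj_ofReal, map_ofNat] at h7
    calc _ = ∫ θ in (0 : ℝ)..(2 * π), conj (P (polarPt r θ)) * polarPt r θ ^ m := by
          congr 1; ext; ring
      _ = _ := by rw [h7]; ring
  simp only [h2] at h1
  simp only [mul_comm (Q _)] at h1
  exact h1.congr_fun fun n => by ring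

/-- The pairing of a holomorphic function on the disc with its logarithmic derivative. -/
def discPairing (P : ℂ → ℂ) (r : ℝ) : ℝ :=
  ∫ θ in (0 : ℝ)..(2 * π), (conj (P (polarPt r θ)) * (polarPt r θ * deriv P (polarPt r θ))).re

lemma polarPt_mem_ball {r θ : ℝ} (hr : 0 ≤ r) (hr1 : r < 1) : polarPt r θ ∈ Metric.ball 0 1 := by
  simpa [norm_polarPt, abs_of_nonneg hr]

lemma continuous_comp_polarPt {P : ℂ → ℂ} (hP : ContinuousOn P (Metric.ball 0 1)) {r : ℝ}
    (hr : 0 ≤ r) (hr1 : r < 1) : Continuous fun θ => P (polarPt r θ) :=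
  hP.comp_continuous (by unfold polarPt; fun_prop) fun _ => polarPt_mem_ball hr hr1

/-- The source of all signs in the file. The coefficients of `z P'` are `n aₙ`, so Parseval yields
terms that are nonnegative and nondecreasing in `r`. -/
lemma hasSum_discPairing {P : ℂ → ℂ} (hP : DifferentiableOn ℂ P (Metric.ball 0 1)) {r : ℝ}
    (hr : 0 ≤ r) (hr1 : r < 1) :
    HasSum (fun n : ℕ => 2 * π * (n * ‖taylorCoeff P n‖ ^ 2 * r ^ (2 * n))) (discPairing P r) := by
  have hn : ∀ θ, ‖polarPt r θ‖ < 1 := fun θ => by rwa [norm_polarPt, abs_of_nonneg hr]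
  have hb : Summable fun n : ℕ => ‖(n : ℂ) * taylorCoeff P n‖ * r ^ n := by
    have h := (hasSum_mul_deriv hP (z := (r : ℂ))
      (by simpa [abs_of_nonneg hr])).summable.norm
    simpa [abs_of_nonneg hr] using h
  have h := hasSum_integral_mul_conj (Q := fun z => z * deriv P z) hr (summable_taylorCoeff hP hr hr1) hb
    (fun θ => hasSum_taylorCoeff hP (hn θ)) (fun θ => hasSum_mul_deriv hP (hn θ))
    (continuous_comp_polarPt hP.continuousOn hr hr1)
  have h' := Complex.hasSum_re h
  have hc : Continuous fun θ => conj (P (polarPt r θ)) * (polarPt r θ * deriv P (polarPt r θ)) := by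
    refine (Complex.continuous_conj.comp (continuous_comp_polarPt hP.continuousOn hr hr1)).mul
      (Continuous.mul (by unfold polarPt; fun_prop)
        (continuous_comp_polarPt (hP.deriv Metric.isOpen_ball).continuousOn hr hr1))
  have e : discPairing P r = (∫ θ in (0 : ℝ)..(2 * π),
      conj (P (polarPt r θ)) * (polarPt r θ * deriv P (polarPt r θ))).re := by
    have := Complex.reCLM.intervalIntegral_comp_comm (hc.intervalIntegrable (μ := volume) 0 (2 * π))
    simpa [discPairing] using this
  rw [e]
  refine h'.congr_fun fun n => ?_
  rw [show (2 * π * (conj (taylorCoeff P n) * (n * taylorCoeff P n) * (r : ℂ) ^ (2 * n)) : ℂ) =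
    ((2 * π * (n * ‖taylorCoeff P n‖ ^ 2 * r ^ (2 * n)) : ℝ) : ℂ) by
      have := Complex.conj_mul' (taylorCoeff P n)
      push_cast
      rw [← this]; ring]
  rw [Complex.ofReal_re]

lemma discPairing_mono {P : ℂ → ℂ} (hP : DifferentiableOn ℂ P (Metric.ball 0 1)) {r r' : ℝ}
    (hr : 0 ≤ r) (hrr : r ≤ r') (hr1 : r' < 1) : discPairing P r ≤ discPairing P r' :=
  hasSum_le (fun n => by gcongr) (hasSum_discPairing hP hr (hrr.trans_lt hr1))
    (hasSum_discPairing hP (hr.trans hrr) hr1)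

/-- A vanishing sum of nonnegative terms kills every Taylor coefficient of positive index, since
only `n = 0` carries the factor zero. -/
lemma discPairing_pos {P : ℂ → ℂ} (hP : DifferentiableOn ℂ P (Metric.ball 0 1)) {r : ℝ}
    (hr : 0 < r) (hr1 : r < 1) (hnc : ∃ z ∈ Metric.ball (0 : ℂ) 1, P z ≠ P 0) :
    0 < discPairing P r := by
  have h := hasSum_discPairing hP hr.le hr1
  by_contra hle
  have hnn : ∀ n : ℕ, 0 ≤ 2 * π * (n * ‖taylorCoeff P n‖ ^ 2 * r ^ (2 * n)) := fun n => by positivity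
  have h0 : discPairing P r = 0 := le_antisymm (not_lt.mp hle) (h.nonneg hnn)
  rw [h0, hasSum_zero_iff_of_nonneg hnn] at h
  obtain ⟨z, hz, hne⟩ := hnc
  apply hne
  have h1 := hasSum_taylorCoeff hP (z := z) (by simpa using hz)
  have h2 : HasSum (fun n => taylorCoeff P n * z ^ n) (taylorCoeff P 0 * z ^ 0) := by
    refine hasSum_single 0 fun n hn => ?_
    have := congrFun h n
    have h3 : taylorCoeff P n = 0 := by
      simpa [hn, hr.ne', pi_ne_zero] using this
    simp [h3]
  rw [h1.unique h2]
  simp [taylorCoeff]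

/-- A continuous function of the radius that agrees with the pairing in the open disc is
positive up to the boundary, unless the holomorphic function is constant. -/
lemma pos_of_eq_discPairing {P : ℂ → ℂ} (hP : DifferentiableOn ℂ P (Metric.ball 0 1))
    (hnc : ∃ z ∈ Metric.ball (0 : ℂ) 1, P z ≠ P 0) {X : ℝ → ℝ} (hX : ContinuousOn X (Ioc 0 1))
    {c : ℝ} (hc : 0 < c) (hXP : ∀ r ∈ Ioo (0 : ℝ) 1, X r = c * discPairing P r) {r : ℝ}
    (hr : r ∈ Ioc (0 : ℝ) 1) : 0 < X r := by
  rcases hr.2.lt_or_eq with h | rfl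
  · rw [hXP r ⟨hr.1, h⟩]
    exact mul_pos hc (discPairing_pos hP hr.1 h hnc)
  -- At `r = 1` there is no power series. By monotonicity the positive value at radius `1/2` bounds
  -- the pairing from below on `(1/2, 1)`, and this bound passes to the limit.
  · have h0 := mul_pos hc (discPairing_pos hP (r := 1 / 2) (by norm_num) (by norm_num) hnc)
    refine h0.trans_le ?_
    have ht : Tendsto X (𝓝[<] 1) (𝓝 (X 1)) := by
      refine (hX 1 ⟨by norm_num, le_rfl⟩).mono_left ?_
      rw [nhdsWithin_le_iff]
      exact mem_of_superset (Ioo_mem_nhdsLT (zero_lt_one' ℝ)) Ioo_subset_Ioc_self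
    refine ge_of_tendsto ht ?_
    filter_upwards [Ioo_mem_nhdsLT (show (1 / 2 : ℝ) < 1 by norm_num)] with x hx
    rw [hXP x ⟨by linarith [hx.1], hx.2⟩]
    exact mul_le_mul_of_nonneg_left (discPairing_mono hP (by norm_num) hx.1.le hx.2) hc.le

lemma integral_polarPt_of_differentiableOn {Q : ℂ → ℂ}
    (hQ : DifferentiableOn ℂ Q (Metric.ball 0 1)) {r : ℝ} (hr : 0 ≤ r) (hr1 : r < 1) :
    ∫ θ in (0 : ℝ)..(2 * π), Q (polarPt r θ) = 2 * π * Q 0 := by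
  have hn : ∀ θ, ‖polarPt r θ‖ < 1 := fun θ => by rwa [norm_polarPt, abs_of_nonneg hr]
  have h := hasSum_integral_powerSeries hr (summable_taylorCoeff hQ hr hr1)
    (fun θ => hasSum_taylorCoeff hQ (hn θ)) (g := fun _ => 1) continuous_const
  simp only [mul_one] at h
  have h2 : ∀ n : ℕ, n ≠ 0 → taylorCoeff Q n * ∫ θ in (0 : ℝ)..(2 * π), polarPt r θ ^ n = 0 := by
    intro n hn
    simp only [polarPt_pow]
    rw [intervalIntegral.integral_const_mul]
    have := integral_exp_int_mul n
    rw [if_neg (by exact_mod_cast hn)] at this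
    simp only [Int.cast_natCast] at this
    rw [this]; simp
  rw [h.unique (hasSum_single 0 h2)]
  simp [taylorCoeff]; ring

/-- `Re x · Re y` is half of `Re (x y) + Re (conj x · y)`. The first summand here is the real part
of the holomorphic function `z P P'`, which vanishes at `0` and so has mean zero. -/
lemma integral_re_mul_re_deriv {P : ℂ → ℂ} (hP : DifferentiableOn ℂ P (Metric.ball 0 1)) {r : ℝ}
    (hr : 0 ≤ r) (hr1 : r < 1) :
    ∫ θ in (0 : ℝ)..(2 * π), (P (polarPt r θ)).re * (polarPt r θ * deriv P (polarPt r θ)).re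
      = 1 / 2 * discPairing P r := by
  have hd := hP.deriv Metric.isOpen_ball
  have hQ : DifferentiableOn ℂ (fun z => P z * (z * deriv P z)) (Metric.ball 0 1) :=
    hP.mul (differentiableOn_id.mul hd)
  have h0 := integral_polarPt_of_differentiableOn hQ hr hr1
  simp only [zero_mul, mul_zero] at h0
  have hQc := continuous_comp_polarPt hQ.continuousOn hr hr1
  have hPc := continuous_comp_polarPt hP.continuousOn hr hr1
  have hdc := continuous_comp_polarPt hd.continuousOn hr hr1
  have hp : Continuous fun θ => polarPt r θ := by unfold polarPt; fun_prop
  have h1 : ∫ θ in (0 : ℝ)..(2 * π), (P (polarPt r θ) * (polarPt r θ * deriv P (polarPt r θ))).re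
      = 0 := by
    have := Complex.reCLM.intervalIntegral_comp_comm (hQc.intervalIntegrable (μ := volume) 0 (2 * π))
    simpa [h0] using this
  have h2 : ∀ θ, (P (polarPt r θ)).re * (polarPt r θ * deriv P (polarPt r θ)).re =
      1 / 2 * ((P (polarPt r θ) * (polarPt r θ * deriv P (polarPt r θ))).re +
        (conj (P (polarPt r θ)) * (polarPt r θ * deriv P (polarPt r θ))).re) := by
    intro θ
    rw [Complex.mul_re (P _), Complex.mul_re (conj _)]
    simp only [Complex.conj_re, Complex.conj_im]; ring
  simp only [h2]
  rw [intervalIntegral.integral_const_mul, intervalIntegral.integral_add, h1, zero_add, discPairing]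
  · exact (Complex.continuous_re.comp hQc).intervalIntegrable _ _
  · exact (Complex.continuous_re.comp ((Complex.continuous_conj.comp hPc).mul
      (hp.mul hdc))).intervalIntegrable _ _

end

/-! ### Local behaviour at critical points, and the Cauchy–Pompeiu formula -/

section

/-- Near a critical point a holomorphic function takes values in any given direction twice. -/
lemma exists_ne_map_eq_of_deriv_eq_zero {W : ℂ → ℂ} {z₀ : ℂ} (hW : AnalyticAt ℂ W z₀)
    (hnc : ¬ ∀ᶠ z in 𝓝 z₀, W z = W z₀) (hd : deriv W z₀ = 0) {v : ℂ} (hv : v ≠ 0)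
    {V : Set ℂ} (hV : V ∈ 𝓝 z₀) :
    ∀ᶠ τ : ℝ in 𝓝[>] 0, ∃ z₁ ∈ V, ∃ z₂ ∈ V, z₁ ≠ z₂ ∧ W z₁ = W z₀ + τ * v ∧
      W z₂ = W z₀ + τ * v := by
  have hf : AnalyticAt ℂ (fun z => W z - W z₀) z₀ := hW.sub analyticAt_const
  obtain ⟨n, g, hg, hg0, hfg⟩ := hf.exists_eventuallyEq_pow_smul_nonzero_iff.mpr
    (by simpa [sub_eq_zero] using hnc)
  have hn : 2 ≤ n := by
    by_contra h
    have h01 : n = 0 ∨ n = 1 := by omega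
    rcases h01 with rfl | rfl
    · have := hfg.self_of_nhds
      simp at this; exact hg0 this.symm
    · have h1 : HasDerivAt (fun z => (z - z₀) ^ 1 • g z) (g z₀) z₀ := by
        have := ((hasDerivAt_id z₀).sub_const z₀).fun_mul hg.differentiableAt.hasDerivAt
        simpa using this
      have h2 := (h1.congr_of_eventuallyEq hfg).add_const (W z₀)
      simp only [sub_add_cancel] at h2
      exact hg0 (h2.deriv.symm.trans hd)
  have hn0 : (n : ℂ) ≠ 0 := by exact_mod_cast (by omega : n ≠ 0)
  obtain ⟨c, hc⟩ := IsAlgClosed.exists_pow_nat_eq (g z₀) (by omega : 0 < n)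
  have hc0 : c ≠ 0 := by rintro rfl; rw [zero_pow (by omega)] at hc; exact hg0 hc.symm
  -- A holomorphic `n`-th root of `g` near `z₀`; the principal logarithm is safe because the
  -- quotient is close to `1`. In the coordinate `ψ = (z - z₀) ρ` the function `W - W z₀` is exactly
  -- `ψ ^ n`.
  set ρ : ℂ → ℂ := fun z => c * Complex.exp (Complex.log (g z / g z₀) / n) with hρ
  have hρa : AnalyticAt ℂ ρ z₀ := by
    refine analyticAt_const.mul (AnalyticAt.cexp (AnalyticAt.div_const (AnalyticAt.clog ?_ ?_)))
    · exact hg.div_const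
    · rw [div_self hg0]; exact Complex.one_mem_slitPlane
  have hρ0 : ρ z₀ = c := by simp [hρ, div_self hg0]
  have hρn : ∀ᶠ z in 𝓝 z₀, ρ z ^ n = g z := by
    filter_upwards [hg.continuousAt.eventually_ne hg0] with z hz
    have h1 : g z / g z₀ ≠ 0 := div_ne_zero hz hg0
    rw [hρ, mul_pow, ← Complex.exp_nat_mul, mul_div_cancel₀ _ hn0, Complex.exp_log h1, hc,
      mul_div_cancel₀ _ hg0]
  set ψ : ℂ → ℂ := fun z => (z - z₀) * ρ z with hψ
  have hψa : AnalyticAt ℂ ψ z₀ := (analyticAt_id.sub analyticAt_const).mul hρa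
  have hψd : HasDerivAt ψ c z₀ := by
    have := ((hasDerivAt_id z₀).sub_const z₀).fun_mul hρa.differentiableAt.hasDerivAt
    simpa [hρ0] using this
  have hψs : HasStrictDerivAt ψ c z₀ := by
    have := hψa.hasStrictDerivAt; rwa [hψd.deriv] at this
  have hmap := hψs.map_nhds_eq hc0
  have hψ0 : ψ z₀ = 0 := by simp [hψ]
  rw [hψ0] at hmap
  have himg : ψ '' (V ∩ {z | W z - W z₀ = (z - z₀) ^ n • g z ∧ ρ z ^ n = g z}) ∈ 𝓝 (0 : ℂ) := by
    rw [← hmap]; exact image_mem_map (inter_mem hV (hfg.and hρn))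
  obtain ⟨v', hv'⟩ := IsAlgClosed.exists_pow_nat_eq v (by omega : 0 < n)
  have hv'0 : v' ≠ 0 := by rintro rfl; rw [zero_pow (by omega)] at hv'; exact hv hv'.symm
  -- As `n ≥ 2`, the numbers `τ^{1/n} v'` and `τ^{1/n} v' ξ` are distinct `n`-th roots of `τ v`.
  -- Their preimages under `ψ` are the two points sought.
  set ξ : ℂ := Complex.exp (2 * π * Complex.I / n) with hξ
  have hprim : IsPrimitiveRoot ξ n := Complex.isPrimitiveRoot_exp n (by omega)
  have hξn : ξ ^ n = 1 := hprim.pow_eq_one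
  have hξ1 : ξ ≠ 1 := hprim.ne_one (by omega)
  have hlim : ∀ a : ℂ, Tendsto (fun τ : ℝ => ((τ ^ ((n : ℝ)⁻¹) : ℝ) : ℂ) * v' * a) (𝓝[>] 0)
      (𝓝 0) := by
    intro a
    have h1 : Tendsto (fun τ : ℝ => τ ^ ((n : ℝ)⁻¹)) (𝓝[>] 0) (𝓝 0) := by
      have := (Real.continuousAt_rpow_const 0 ((n : ℝ)⁻¹) (Or.inr (by positivity))).tendsto
      rw [Real.zero_rpow (by positivity)] at this
      exact this.mono_left nhdsWithin_le_nhds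
    have h2 := (Complex.continuous_ofReal.tendsto 0).comp h1
    simpa using (h2.mul_const v').mul_const a
  have hval : ∀ {z : ℂ} {τ : ℝ} {a : ℂ}, 0 < τ → a ^ n = 1 →
      W z - W z₀ = (z - z₀) ^ n • g z → ρ z ^ n = g z →
      ψ z = ((τ ^ ((n : ℝ)⁻¹) : ℝ) : ℂ) * v' * a → W z = W z₀ + τ * v := by
    intro z τ a hτ ha h1 h2 h3
    have h4 : W z - W z₀ = ψ z ^ n := by
      rw [h1, ← h2, smul_eq_mul, ← mul_pow]
    rw [h3, mul_pow, mul_pow, ha, hv', ← Complex.ofReal_pow,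
      Real.rpow_inv_natCast_pow hτ.le (by omega)] at h4
    linear_combination h4
  filter_upwards [(hlim 1).eventually himg, (hlim ξ).eventually himg, self_mem_nhdsWithin]
    with τ ⟨z₁, ⟨hz₁V, hz₁, hz₁'⟩, h₁⟩ ⟨z₂, ⟨hz₂V, hz₂, hz₂'⟩, h₂⟩ hτ
  refine ⟨z₁, hz₁V, z₂, hz₂V, ?_, hval hτ (one_pow n) hz₁ hz₁' h₁, hval hτ hξn hz₂ hz₂' h₂⟩
  rintro rfl
  have h5 : (((τ ^ ((n : ℝ)⁻¹) : ℝ) : ℂ)) * v' ≠ 0 :=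
    mul_ne_zero (by exact_mod_cast (Real.rpow_pos_of_pos hτ _).ne') hv'0
  exact hξ1 (mul_left_cancel₀ h5 (h₂.symm.trans h₁))

/-- The operator `∂̄ = ½ (∂ₓ + i ∂_y)`. -/
def dbar (g : ℂ → ℂ) (z : ℂ) : ℂ := 1 / 2 * (fderiv ℝ g z 1 + Complex.I * fderiv ℝ g z Complex.I)

/-- The operator `∂̄` in a rotated frame. For `v = e^{iθ}` this is its polar form, with radial and
angular derivatives separated. -/
lemma fderiv_add_I_mul_fderiv_mul_I (g : ℂ → ℂ) (z v : ℂ) :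
    fderiv ℝ g z v + Complex.I * fderiv ℝ g z (v * Complex.I) = 2 * conj v * dbar g z := by
  have h : ∀ x y : ℝ, fderiv ℝ g z (x + y * Complex.I)
      = x * fderiv ℝ g z 1 + y * fderiv ℝ g z Complex.I := by
    intro x y
    have e : (x + y * Complex.I : ℂ) = x • (1 : ℂ) + y • Complex.I := by simp
    rw [e, map_add, map_smul, map_smul]; simp
  have h1 := h v.re v.im
  have h2 := h (-v.im) v.re
  rw [Complex.re_add_im] at h1
  have e2 : (((-v.im : ℝ) : ℂ) + v.re * Complex.I) = v * Complex.I := by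
    apply Complex.ext <;> simp
  rw [e2] at h2
  have e3 : conj v = v.re - v.im * Complex.I := by
    apply Complex.ext <;> simp
  rw [h1, h2, dbar, e3]
  push_cast
  linear_combination ((v.im : ℂ) * fderiv ℝ g z Complex.I) * Complex.I_mul_I

lemma hasDerivAt_polarPt_left (r θ : ℝ) :
    HasDerivAt (fun r => polarPt r θ) (Complex.exp (θ * Complex.I)) r := by
  have := (Complex.ofRealCLM.hasDerivAt (x := r)).mul_const (Complex.exp (θ * Complex.I))
  simpa [polarPt] using this

lemma hasDerivAt_polarPt (r θ : ℝ) :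
    HasDerivAt (fun θ => polarPt r θ) (polarPt r θ * Complex.I) θ := by
  have := (((Complex.ofRealCLM.hasDerivAt (x := θ)).mul_const Complex.I).cexp).const_mul (r : ℂ)
  simpa [polarPt, mul_assoc] using this

/-- The **Cauchy–Pompeiu formula** on a disc. -/
lemma integral_exp_mul_dbar {g : ℂ → ℂ} (hg : ContDiff ℝ 1 g) (z : ℂ) {R : ℝ} (hR : 0 ≤ R) :
    ∫ r in (0 : ℝ)..R, ∫ θ in (-π)..π, Complex.exp (-(θ * Complex.I)) * dbar g (z + polarPt r θ)
      = 1 / 2 * ((∫ θ in (-π)..π, g (z + polarPt R θ)) - 2 * π * g z) := by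
  have hgd : Differentiable ℝ g := hg.differentiable (by norm_num)
  have hfc : Continuous (fderiv ℝ g) := hg.continuous_fderiv (by norm_num)
  have c1 : Continuous fun x : ℝ × ℝ => fderiv ℝ g (z + polarPt x.1 x.2)
      (Complex.exp (x.2 * Complex.I)) := by
    apply Continuous.clm_apply <;> fun_prop
  have c2 : Continuous fun x : ℝ × ℝ => fderiv ℝ g (z + polarPt x.1 x.2)
      (Complex.exp (x.2 * Complex.I) * Complex.I) := by
    apply Continuous.clm_apply <;> fun_prop
  have e1 : ∀ r θ : ℝ, Complex.exp (-(θ * Complex.I)) * dbar g (z + polarPt r θ) =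
      1 / 2 * (fderiv ℝ g (z + polarPt r θ) (Complex.exp (θ * Complex.I)) +
      Complex.I * fderiv ℝ g (z + polarPt r θ) (Complex.exp (θ * Complex.I) * Complex.I)) := by
    intro r θ
    rw [fderiv_add_I_mul_fderiv_mul_I, ← Complex.exp_conj]
    simp; ring
  -- The derivative in the direction `i e^{iθ}` is `1/r` times the `θ`-derivative of a periodic
  -- function, so it integrates to zero. Only the radial derivative remains, and after exchanging
  -- the integrals it is integrated in `r`.
  have e2 : ∀ r : ℝ, r ≠ 0 →
      ∫ θ in (-π)..π, fderiv ℝ g (z + polarPt r θ) (Complex.exp (θ * Complex.I) * Complex.I) = 0 := by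
    intro r hr
    have hd : ∀ θ : ℝ, HasDerivAt (fun θ => g (z + polarPt r θ))
        (fderiv ℝ g (z + polarPt r θ) (polarPt r θ * Complex.I)) θ := fun θ =>
      (hgd _).hasFDerivAt.comp_hasDerivAt θ ((hasDerivAt_polarPt r θ).const_add z)
    have hc : Continuous fun θ : ℝ => fderiv ℝ g (z + polarPt r θ) (polarPt r θ * Complex.I) := by
      unfold polarPt
      apply Continuous.clm_apply <;> fun_prop
    have h1 := intervalIntegral.integral_eq_sub_of_hasDerivAt (a := -π) (b := π)
      (fun θ _ => hd θ) (hc.intervalIntegrable _ _)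
    have h2 : polarPt r π = polarPt r (-π) := by
      simp [polarPt, Complex.exp_neg, Complex.exp_pi_mul_I]
    rw [h2, sub_self] at h1
    have h3 : ∀ θ : ℝ, fderiv ℝ g (z + polarPt r θ) (polarPt r θ * Complex.I) =
        (r : ℂ) * fderiv ℝ g (z + polarPt r θ) (Complex.exp (θ * Complex.I) * Complex.I) := by
      intro θ
      have : polarPt r θ * Complex.I = r • (Complex.exp (θ * Complex.I) * Complex.I) := by
        simp [polarPt, mul_assoc]
      rw [this, map_smul]; simp
    simp only [h3] at h1
    rw [intervalIntegral.integral_const_mul] at h1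
    simpa [hr] using h1
  have e3 : ∀ᵐ r : ℝ, r ∈ uIoc 0 R → ∫ θ in (-π)..π,
      Complex.exp (-(θ * Complex.I)) * dbar g (z + polarPt r θ) =
      1 / 2 * ∫ θ in (-π)..π, fderiv ℝ g (z + polarPt r θ) (Complex.exp (θ * Complex.I)) := by
    refine Eventually.of_forall fun r hr => ?_
    rw [uIoc_of_le hR] at hr
    simp only [e1]
    have c1' : Continuous fun θ : ℝ => fderiv ℝ g (z + polarPt r θ) (Complex.exp (θ * Complex.I)) :=
      c1.comp (Continuous.prodMk_right r)
    have c2' : Continuous fun θ : ℝ => Complex.I * fderiv ℝ g (z + polarPt r θ)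
        (Complex.exp (θ * Complex.I) * Complex.I) :=
      continuous_const.mul (c2.comp (Continuous.prodMk_right r))
    rw [intervalIntegral.integral_const_mul, intervalIntegral.integral_add
      (c1'.intervalIntegrable _ _) (c2'.intervalIntegrable _ _),
      intervalIntegral.integral_const_mul, e2 r hr.1.ne', mul_zero, add_zero]
  have swap := intervalIntegral_intervalIntegral_swap (a := 0) (b := R) (c := -π) (d := π)
    (F := fun r θ : ℝ => fderiv ℝ g (z + polarPt r θ) (Complex.exp (θ * Complex.I)))
    ((c1.continuousOn.integrableOn_compact (isCompact_uIcc.prod isCompact_uIcc)).mono_set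
      (prod_mono uIoc_subset_uIcc uIoc_subset_uIcc))
  rw [intervalIntegral.integral_congr_ae e3, intervalIntegral.integral_const_mul,
    swap]
  congr 1
  have e4 : ∀ θ : ℝ, ∫ r in (0 : ℝ)..R, fderiv ℝ g (z + polarPt r θ) (Complex.exp (θ * Complex.I))
      = g (z + polarPt R θ) - g z := by
    intro θ
    have hd : ∀ r : ℝ, HasDerivAt (fun r => g (z + polarPt r θ))
        (fderiv ℝ g (z + polarPt r θ) (Complex.exp (θ * Complex.I))) r := fun r =>
      (hgd _).hasFDerivAt.comp_hasDerivAt r ((hasDerivAt_polarPt_left r θ).const_add z)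
    have h1 := intervalIntegral.integral_eq_sub_of_hasDerivAt (a := 0) (b := R)
      (fun r _ => hd r) ((c1.comp (Continuous.prodMk_left θ)).intervalIntegrable _ _)
    rw [h1]; simp [polarPt]
  simp only [e4]
  have c3 : Continuous fun θ => g (z + polarPt R θ) := by
    have := hg.continuous; unfold polarPt; fun_prop
  rw [intervalIntegral.integral_sub (c3.intervalIntegrable _ _) (by simp),
    intervalIntegral.integral_const, Complex.real_smul]
  push_cast; ring

lemma continuous_dbar {g : ℂ → ℂ} (hg : ContDiff ℝ 1 g) : Continuous (dbar g) := by
  have hfc : Continuous (fderiv ℝ g) := hg.continuous_fderiv (by norm_num)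
  unfold dbar
  fun_prop

/-- The **Cauchy–Pompeiu formula** in the plane. -/
lemma integral_dbar_div {g : ℂ → ℂ} (hg : ContDiff ℝ 1 g)
    (h0 : Tendsto g (Bornology.cobounded ℂ) (𝓝 0)) {ρ : ℝ} (hρ : ∀ z, ρ < ‖z‖ → dbar g z = 0)
    (z : ℂ) : ∫ ζ, dbar g ζ / (z - ζ) = π * g z := by
  have hDc : Continuous fun p : ℝ × ℝ =>
      Complex.exp (-(p.2 * Complex.I)) * dbar g (z + polarPt p.1 p.2) := by
    have := continuous_dbar hg
    fun_prop
  -- Polar coordinates about `z` cancel the kernel against the Jacobian. The disc of radius `R`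
  -- about `z` contains the region where `dbar g` can be nonzero, and the remaining circle mean
  -- tends to zero with `g`.
  have key : ∀ R : ℝ, 0 ≤ R → ρ + ‖z‖ ≤ R →
      ∫ ζ, dbar g ζ / (z - ζ) = π * g z - 1 / 2 * ∫ θ in (-π)..π, g (z + polarPt R θ) := by
    intro R hR hRρ
    have hz : ∀ r θ : ℝ, R < r → dbar g (z + polarPt r θ) = 0 := by
      intro r θ hr
      apply hρ
      have h1 : ‖polarPt r θ‖ ≤ ‖z + polarPt r θ‖ + ‖z‖ := by
        calc ‖polarPt r θ‖ = ‖(z + polarPt r θ) - z‖ := by ring_nf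
          _ ≤ _ := norm_sub_le _ _
      rw [norm_polarPt, abs_of_nonneg (hR.trans hr.le)] at h1
      linarith
    rw [← integral_add_left_eq_self _ z, ← Complex.integral_comp_polarCoord_symm]
    have e1 : ∫ p in polarCoord.target, p.1 • (dbar g (z + Complex.polarCoord.symm p) /
        (z - (z + Complex.polarCoord.symm p))) = ∫ p in Ioi (0 : ℝ) ×ˢ Ioo (-π) π,
          -(Complex.exp (-(p.2 * Complex.I)) * dbar g (z + polarPt p.1 p.2)) := by
      rw [polarCoord_target]
      refine setIntegral_congr_fun (measurableSet_Ioi.prod measurableSet_Ioo) fun p hp => ?_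
      have hp1 : (p.1 : ℂ) ≠ 0 := by exact_mod_cast (ne_of_gt hp.1)
      have e : Complex.polarCoord.symm p = polarPt p.1 p.2 := by
        rw [Complex.polarCoord_symm_apply, polarPt, Complex.exp_mul_I]; simp
      simp only [e, Complex.real_smul, Complex.exp_neg]
      have hexp := Complex.exp_ne_zero (p.2 * Complex.I)
      simp only [polarPt]
      field_simp
      ring
    rw [e1]
    have e2 : ∫ p in Ioi (0 : ℝ) ×ˢ Ioo (-π) π,
          -(Complex.exp (-(p.2 * Complex.I)) * dbar g (z + polarPt p.1 p.2)) =
        ∫ p in Ioc (0 : ℝ) R ×ˢ Ioo (-π) π,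
          -(Complex.exp (-(p.2 * Complex.I)) * dbar g (z + polarPt p.1 p.2)) := by
      refine (setIntegral_eq_of_subset_of_forall_sdiff_eq_zero
        (measurableSet_Ioi.prod measurableSet_Ioo)
        (prod_mono Ioc_subset_Ioi_self le_rfl) fun p hp => ?_)
      have : R < p.1 := by
        by_contra h
        exact hp.2 ⟨⟨hp.1.1, not_lt.mp h⟩, hp.1.2⟩
      rw [hz _ _ this]; simp
    rw [e2, integral_neg, Measure.volume_eq_prod, setIntegral_prod]
    · have := integral_exp_mul_dbar hg z hR
      rw [intervalIntegral.integral_of_le hR] at this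
      simp only [intervalIntegral.integral_of_le (by linarith [pi_pos] : -π ≤ π),
        integral_Ioc_eq_integral_Ioo (x := -π)] at this ⊢
      rw [this]; ring
    · exact (hDc.continuousOn.integrableOn_compact (isCompact_Icc.prod isCompact_Icc)).mono_set
        (prod_mono Ioc_subset_Icc_self Ioo_subset_Icc_self)
  have hlim : Tendsto (fun R : ℝ => ∫ θ in (-π)..π, g (z + polarPt R θ)) atTop (𝓝 0) := by
    rw [Metric.tendsto_atTop]
    intro ε hε
    have h1 : ∀ᶠ w in Bornology.cobounded ℂ, ‖g w‖ < ε / (4 * π) := by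
      have := h0.norm
      rw [norm_zero] at this
      exact this.eventually (gt_mem_nhds (by positivity))
    rw [← comap_norm_atTop, eventually_comap] at h1
    obtain ⟨R₀, hR₀⟩ := (eventually_atTop.mp h1)
    refine ⟨max 0 (R₀ + ‖z‖), fun R hR => ?_⟩
    have hR0 : 0 ≤ R := (le_max_left _ _).trans hR
    have hb := intervalIntegral.norm_integral_le_of_norm_le_const (a := -π) (b := π)
      (f := fun θ => g (z + polarPt R θ)) (C := ε / (4 * π)) (fun θ _ => by
        refine (hR₀ _ ?_ _ rfl).le
        have h2 : ‖polarPt R θ‖ ≤ ‖z + polarPt R θ‖ + ‖z‖ := by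
          calc ‖polarPt R θ‖ = ‖(z + polarPt R θ) - z‖ := by ring_nf
            _ ≤ _ := norm_sub_le _ _
        rw [norm_polarPt, abs_of_nonneg hR0] at h2
        linarith [(le_max_right _ _).trans hR])
    rw [dist_zero_right]
    refine hb.trans_lt ?_
    have : |π - -π| = 2 * π := by rw [abs_of_pos (by linarith [pi_pos])]; ring
    rw [this]
    have : ε / (4 * π) * (2 * π) = ε / 2 := by field_simp; norm_num
    rw [this]; linarith
  have hl2 : Tendsto (fun R : ℝ => π * g z - 1 / 2 * ∫ θ in (-π)..π, g (z + polarPt R θ)) atTop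
      (𝓝 (π * g z - 1 / 2 * 0)) := tendsto_const_nhds.sub (hlim.const_mul _)
  have hl3 : Tendsto (fun _ : ℝ => ∫ ζ, dbar g ζ / (z - ζ)) atTop (𝓝 (π * g z - 1 / 2 * 0)) := by
    refine hl2.congr' ?_
    filter_upwards [eventually_ge_atTop 0, eventually_ge_atTop (ρ + ‖z‖)] with R h1 h2
    exact (key R h1 h2).symm
  have := tendsto_nhds_unique tendsto_const_nhds hl3
  simpa using this

end

/-! ### Harmonic functions of logarithmic growth near infinity -/

section

open Complex (IsExactOn)

/-- The real linear form `v ↦ Re (g v)`, the differential of a function with gradient `conj g`. -/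
def reMul (g : ℂ) : ℂ →L[ℝ] ℝ := Complex.reCLM ∘L (ContinuousLinearMap.mul ℝ ℂ g)

@[simp]
lemma reMul_apply (g v : ℂ) : reMul g v = (g * v).re := rfl

lemma hasFDerivAt_re {F : ℂ → ℂ} {F' z : ℂ} (h : HasDerivAt F F' z) :
    HasFDerivAt (fun z => (F z).re) (reMul F') z := by
  have h1 : HasFDerivAt F (ContinuousLinearMap.mul ℝ ℂ F') z := by
    convert! h.hasFDerivAt.restrictScalars ℝ using 1
    ext x; simp [mul_comm]
  exact Complex.reCLM.hasFDerivAt.comp z h1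

lemma hasFDerivAt_log_norm {z : ℂ} (hz : z ≠ 0) :
    HasFDerivAt (fun z : ℂ => Real.log ‖z‖) (reMul (1 / z)) z := by
  -- Multiplication by a constant moves `z` off the branch cut and changes `log |z|` only by a
  -- constant.
  obtain ⟨c, hc, hslit⟩ : ∃ c : ℂ, c ≠ 0 ∧ c * z ∈ Complex.slitPlane :=
    ⟨z⁻¹, inv_ne_zero hz, by rw [inv_mul_cancel₀ hz]; exact Complex.one_mem_slitPlane⟩
  have h1 : HasDerivAt (fun z => Complex.log (c * z)) (1 / z) z := by
    have := ((hasDerivAt_id z).const_mul c).clog (by simpa using hslit)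
    convert! this using 1
    simp only [id, mul_one]; field_simp
  have h2 := (hasFDerivAt_re h1).sub_const (Real.log ‖c‖)
  refine h2.congr_of_eventuallyEq ?_
  filter_upwards [eventually_ne_nhds hz] with w hw
  rw [Complex.log_re, norm_mul, Real.log_mul (by simpa) (by simpa)]; ring

/-- Two functions with the same differential on a connected open set differ by a constant. -/
lemma exists_sub_eq_of_hasFDerivAt {s : Set ℂ} (hs : IsOpen s) (hs' : IsPreconnected s)
    {u v : ℂ → ℝ} {L : ℂ → ℂ →L[ℝ] ℝ} (hu : ∀ z ∈ s, HasFDerivAt u (L z) z)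
    (hv : ∀ z ∈ s, HasFDerivAt v (L z) z) : ∃ c, ∀ z ∈ s, u z - v z = c := by
  refine hs.exists_is_const_of_fderiv_eq_zero (𝕜 := ℝ) (f := fun z => u z - v z) hs'
    (fun z hz => ((hu z hz).sub (hv z hz)).differentiableAt.differentiableWithinAt)
    fun z hz => ?_
  rw [((hu z hz).fun_sub (hv z hz)).fderiv, sub_self]; rfl

/-- The complex gradient of a harmonic function of logarithmic growth vanishes at infinity. -/
lemma tendsto_gradient_zero {u : ℂ → ℝ} {G : ℂ → ℂ} {R : ℝ}
    (hG : ∀ z, R < ‖z‖ → DifferentiableAt ℂ G z)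
    (hu : ∀ z, R < ‖z‖ → HasFDerivAt u (reMul (G z)) z)
    (hlog : Tendsto (fun z => u z / Real.log ‖z‖) (Bornology.cobounded ℂ) (𝓝 1)) :
    Tendsto G (Bornology.cobounded ℂ) (𝓝 0) := by
  have h1 : ∀ᶠ z in Bornology.cobounded ℂ, |u z / Real.log ‖z‖| < 2 := by
    have := hlog.abs
    exact this.eventually (gt_mem_nhds (by norm_num))
  rw [← comap_norm_atTop, eventually_comap] at h1
  obtain ⟨R₁, hR₁⟩ := eventually_atTop.mp h1
  have hub : ∀ z : ℂ, max R₁ 1 < ‖z‖ → |u z| ≤ 2 * Real.log ‖z‖ := by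
    intro z hz
    have hl : 0 < Real.log ‖z‖ := Real.log_pos ((le_max_right _ _).trans_lt hz)
    have := hR₁ ‖z‖ ((le_max_left _ _).trans hz.le) z rfl
    rw [abs_div, abs_of_pos hl, div_lt_iff₀ hl] at this
    exact this.le
  have key : ∀ z₀ : ℂ, 2 * max R (max R₁ 1) < ‖z₀‖ →
      ‖G z₀‖ ≤ 32 * (Real.log (2 * ‖z₀‖) / ‖z₀‖) := by
    intro z₀ hz₀
    have hm1 : (1 : ℝ) ≤ max R (max R₁ 1) := (le_max_right _ _).trans (le_max_right _ _)
    have hn0 : 0 < ‖z₀‖ := by linarith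
    -- On the disc of this radius `u` is, up to a constant, the real part of a primitive `F` of `G`.
    -- Borel–Carathéodory bounds `F` through its real part, and Cauchy's estimate then gives `G z₀ =
    -- O (log |z₀| / |z₀|)`.
    set r := ‖z₀‖ / 2 with hr
    have hr0 : 0 < r := by positivity
    have hball : ∀ z ∈ Metric.ball z₀ r, max R (max R₁ 1) < ‖z‖ ∧ ‖z‖ ≤ 2 * ‖z₀‖ := by
      intro z hz
      rw [mem_ball_iff_norm] at hz
      have h1 := norm_sub_norm_le z₀ z
      have h2 := norm_sub_norm_le z z₀
      rw [norm_sub_rev] at h1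
      constructor <;> linarith
    have hdiff : DifferentiableOn ℂ G (Metric.ball z₀ r) := fun z hz =>
      (hG z ((le_max_left _ _).trans_lt (hball z hz).1)).differentiableWithinAt
    obtain ⟨F, hF⟩ := hdiff.isExactOn_ball
    obtain ⟨c, hc⟩ := exists_sub_eq_of_hasFDerivAt Metric.isOpen_ball
      (convex_ball z₀ r).isPreconnected
      (fun z hz => hu z ((le_max_left _ _).trans_lt (hball z hz).1))
      (fun z hz => hasFDerivAt_re (hF z hz))
    set M := 4 * Real.log (2 * ‖z₀‖) with hM
    have hMpos : 0 < M := by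
      have : 0 < Real.log (2 * ‖z₀‖) := Real.log_pos (by linarith)
      positivity
    have hub' : ∀ z ∈ Metric.ball z₀ r, |u z| ≤ 2 * Real.log (2 * ‖z₀‖) := by
      intro z hz
      refine (hub z ((le_max_right _ _).trans_lt (hball z hz).1)).trans ?_
      have : 0 < ‖z‖ := by linarith [(hball z hz).1]
      gcongr; exact (hball z hz).2
    set f : ℂ → ℂ := fun ζ => F (z₀ + ζ) - F z₀ with hf
    have hmem : ∀ ζ ∈ Metric.ball (0 : ℂ) r, z₀ + ζ ∈ Metric.ball z₀ r := by
      intro ζ hζ; simpa using hζ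
    have hfd : ∀ ζ ∈ Metric.ball (0 : ℂ) r, HasDerivAt f (G (z₀ + ζ)) ζ := fun ζ hζ =>
      ((hF _ (hmem ζ hζ)).comp_const_add z₀ ζ).sub_const _
    have hfdiff : DifferentiableOn ℂ f (Metric.ball 0 r) := fun ζ hζ =>
      (hfd ζ hζ).differentiableAt.differentiableWithinAt
    have hmaps : MapsTo f (Metric.ball 0 r) {z | z.re ≤ M} := by
      intro ζ hζ
      have h1 := hc _ (hmem ζ hζ)
      have h2 := hc z₀ (Metric.mem_ball_self hr0)
      have h3 := abs_le.mp (hub' _ (hmem ζ hζ))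
      have h4 := abs_le.mp (hub' _ (Metric.mem_ball_self hr0))
      simp only [mem_ofPred_eq, hf, Complex.sub_re]
      linarith
    have hbound : ∀ ζ ∈ Metric.sphere (0 : ℂ) (r / 2), ‖f ζ‖ ≤ 2 * M := by
      intro ζ hζ
      rw [mem_sphere_zero_iff_norm] at hζ
      have := Complex.borelCaratheodory_zero hMpos hfdiff hmaps hr0 (z := ζ)
        (by rw [mem_ball_zero_iff]; linarith) (by simp [hf])
      refine this.trans (le_of_eq ?_)
      rw [hζ]; field_simp; ring
    have hcl : DiffContOnCl ℂ f (Metric.ball 0 (r / 2)) :=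
      (hfdiff.mono (Metric.closedBall_subset_ball (by linarith))).diffContOnCl_ball le_rfl
    have h5 := Complex.norm_deriv_le_of_forall_mem_sphere_norm_le (by positivity) hcl hbound
    rw [(hfd 0 (Metric.mem_ball_self hr0)).deriv, add_zero] at h5
    refine h5.trans (le_of_eq ?_)
    rw [hM, hr]; field_simp; ring
  have hlim : Tendsto (fun z : ℂ => 32 * (Real.log (2 * ‖z‖) / ‖z‖)) (Bornology.cobounded ℂ)
      (𝓝 0) := by
    have h2 : Tendsto (fun x : ℝ => Real.log x / x) atTop (𝓝 0) := by
      have := Real.isLittleO_log_id_atTop.tendsto_div_nhds_zero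
      simpa using this
    have h3 : Tendsto (fun z : ℂ => 2 * ‖z‖) (Bornology.cobounded ℂ) atTop :=
      tendsto_norm_cobounded_atTop.const_mul_atTop (by norm_num)
    have h4 := (h2.comp h3).const_mul 64
    rw [mul_zero] at h4
    refine h4.congr fun z => ?_
    simp only [Function.comp]
    ring_nf
  refine squeeze_zero_norm' ?_ hlim
  rw [← comap_norm_atTop, eventually_comap]
  filter_upwards [eventually_gt_atTop (2 * max R (max R₁ 1))] with x hx z hz
  exact key z (hz ▸ hx)

lemma exists_forall_norm_of_cobounded {p : ℂ → Prop} (h : ∀ᶠ z in Bornology.cobounded ℂ, p z) :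
    ∃ R : ℝ, ∀ z, R < ‖z‖ → p z := by
  rw [← comap_norm_atTop, eventually_comap] at h
  obtain ⟨R, hR⟩ := eventually_atTop.mp h
  exact ⟨R, fun z hz => hR _ hz.le z rfl⟩

/-- A function holomorphic near infinity that vanishes there is, up to an inverse, holomorphic. -/
lemma exists_analyticAt_of_tendsto_zero {G : ℂ → ℂ} {R : ℝ}
    (hG : ∀ z, R < ‖z‖ → DifferentiableAt ℂ G z)
    (h0 : Tendsto G (Bornology.cobounded ℂ) (𝓝 0)) :
    ∃ g : ℂ → ℂ, AnalyticAt ℂ g 0 ∧ ∀ z : ℂ, z ≠ 0 → G z = z⁻¹ * g z⁻¹ := by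
  -- In the coordinate `1/z` the singularity at `0` is removable because `G → 0`. The extension
  -- vanishes at `0`, so one factor `ζ` can be split off by `dslope`.
  set F : ℂ → ℂ := Function.update (fun ζ => G ζ⁻¹) 0 0 with hF
  have hFne : ∀ ζ : ℂ, ζ ≠ 0 → F ζ = G ζ⁻¹ := fun ζ h => by simp [hF, h]
  have hev : ∀ᶠ ζ : ℂ in 𝓝[≠] 0, R < ‖ζ⁻¹‖ := by
    have : Tendsto (fun ζ : ℂ => ‖ζ⁻¹‖) (𝓝[≠] 0) atTop :=
      tendsto_norm_cobounded_atTop.comp tendsto_inv₀_nhdsNE_zero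
    exact this.eventually_gt_atTop R
  have hFa : AnalyticAt ℂ F 0 := by
    refine Complex.analyticAt_of_differentiable_on_punctured_nhds_of_continuousAt ?_ ?_
    · filter_upwards [hev, self_mem_nhdsWithin] with ζ hζ hne
      have h1 : DifferentiableAt ℂ (fun ζ : ℂ => G ζ⁻¹) ζ :=
        (hG _ hζ).comp ζ (differentiableAt_inv hne)
      refine h1.congr_of_eventuallyEq ?_
      filter_upwards [eventually_ne_nhds hne] with w hw using hFne w hw
    · rw [hF, continuousAt_update_same]
      exact h0.comp tendsto_inv₀_nhdsNE_zero
  refine ⟨dslope F 0, ?_, fun z hz => ?_⟩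
  · have hd : ∀ᶠ z in 𝓝 (0 : ℂ), DifferentiableAt ℂ F z :=
      hFa.eventually_analyticAt.mono fun z h => h.differentiableAt
    exact DifferentiableOn.analyticAt
      ((Complex.differentiableOn_dslope hd).mpr fun z hz => DifferentiableAt.differentiableWithinAt hz)
        hd
  · have h2 := sub_smul_dslope F 0 z⁻¹
    have hF0 : F 0 = 0 := by simp [hF]
    rw [hF0, sub_zero, sub_zero, hFne _ (inv_ne_zero hz), inv_inv, smul_eq_mul] at h2
    exact h2.symm

/-- The expansion at infinity of the complex gradient of a harmonic function asymptotic to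
`log |z|`. -/
lemma exists_expansion_at_infinity {u : ℂ → ℝ} {G : ℂ → ℂ} {R : ℝ}
    (hG : ∀ z, R < ‖z‖ → DifferentiableAt ℂ G z)
    (hu : ∀ z, R < ‖z‖ → HasFDerivAt u (reMul (G z)) z)
    (hlog : Tendsto (fun z => u z / Real.log ‖z‖) (Bornology.cobounded ℂ) (𝓝 1)) :
    ∃ H : ℂ → ℂ, AnalyticAt ℂ H 0 ∧ ∃ R', ∀ z, R' < ‖z‖ →
      AnalyticAt ℂ H z⁻¹ ∧ HasDerivAt (fun z => H z⁻¹) (G z - 1 / z) z := by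
  obtain ⟨g, hga, hgG⟩ := exists_analyticAt_of_tendsto_zero hG (tendsto_gradient_zero hG hu hlog)
  -- `g ζ = a + ζ k ζ`
  set k := dslope g 0 with hk
  have hgd : ∀ᶠ z in 𝓝 (0 : ℂ), DifferentiableAt ℂ g z :=
    hga.eventually_analyticAt.mono fun z h => h.differentiableAt
  have hka : AnalyticAt ℂ k 0 := DifferentiableOn.analyticAt
    ((Complex.differentiableOn_dslope hgd).mpr
      fun z hz => DifferentiableAt.differentiableWithinAt hz) hgd
  obtain ⟨ε, hε, hball⟩ := Metric.eventually_nhds_iff_ball.mp hka.eventually_analyticAt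
  obtain ⟨H₀, hH₀⟩ := DifferentiableOn.isExactOn_ball (f := k) (c := 0) (r := ε)
    (fun z hz => (hball z hz).differentiableAt.differentiableWithinAt)
  set a := g 0 with ha
  have hgk : ∀ ζ : ℂ, g ζ = a + ζ * k ζ := by
    intro ζ
    have := sub_smul_dslope g 0 ζ
    rw [sub_zero, smul_eq_mul] at this
    rw [hk, this]; ring
  set R₁ := max (max R 1) (1 / ε) with hR₁
  have hR₁1 : 1 ≤ R₁ := (le_max_right _ _).trans (le_max_left _ _)
  have hinv : ∀ z : ℂ, R₁ < ‖z‖ → z⁻¹ ∈ Metric.ball (0 : ℂ) ε := by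
    intro z hz
    have h1 : 1 / ε < ‖z‖ := (le_max_right _ _).trans_lt hz
    rw [mem_ball_zero_iff, norm_inv, inv_lt_comm₀ (by linarith) hε, ← one_div]
    exact h1
  have hne : ∀ z : ℂ, R₁ < ‖z‖ → z ≠ 0 := fun z hz => norm_pos_iff.mp (by linarith)
  -- the antiderivative of `G - a / z`
  have hH : ∀ z : ℂ, R₁ < ‖z‖ → HasDerivAt (fun z => -H₀ z⁻¹) (G z - a / z) z := by
    intro z hz
    have h1 := ((hH₀ _ (hinv z hz)).comp z (hasDerivAt_inv (hne z hz))).neg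
    convert! h1 using 1
    rw [hgG z (hne z hz), hgk]
    have := hne z hz
    field_simp
    ring
  have hv : ∀ z : ℂ, R₁ < ‖z‖ → HasFDerivAt (fun z => u z - (-H₀ z⁻¹).re) (reMul (a / z)) z := by
    intro z hz
    have h1 := (hu z (((le_max_left _ _).trans (le_max_left _ _)).trans_lt hz)).fun_sub
      (hasFDerivAt_re (hH z hz))
    convert! h1 using 1
    ext; simp; ring
  have hpn : ∀ {r θ : ℝ}, R₁ < r → R₁ < ‖polarPt r θ‖ := by
    intro r θ hr
    rwa [norm_polarPt, abs_of_pos (by linarith)]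
  -- the imaginary part of `a` is a period
  have haim : a.im = 0 := by
    have hd : ∀ θ : ℝ, HasDerivAt (fun θ : ℝ => u (polarPt (R₁ + 1) θ) -
        (-H₀ (polarPt (R₁ + 1) θ)⁻¹).re) (-a.im) θ := by
      intro θ
      have hn := hpn (r := R₁ + 1) (θ := θ) (by linarith)
      have := (hv _ hn).comp_hasDerivAt θ (hasDerivAt_polarPt (R₁ + 1) θ)
      convert! this using 1
      have h0 := hne _ hn
      rw [reMul_apply, show a / polarPt (R₁ + 1) θ * (polarPt (R₁ + 1) θ * Complex.I)
        = a * Complex.I by field_simp]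
      simp
    have h1 := intervalIntegral.integral_eq_sub_of_hasDerivAt (a := 0) (b := 2 * π)
      (fun θ _ => hd θ) (by simp)
    have h2 : polarPt (R₁ + 1) (2 * π) = polarPt (R₁ + 1) 0 := by simp [polarPt]
    rw [h2, sub_self, intervalIntegral.integral_const] at h1
    simpa [pi_ne_zero] using h1
  -- the growth along a ray
  have hare : a.re = 1 := by
    have hd : ∀ x : ℝ, x ∈ Ioi R₁ → HasDerivAt (fun x : ℝ => u x - (-H₀ (x : ℂ)⁻¹).re
        - a.re * Real.log x) 0 x := by
      intro x hx
      have hx0 : 0 < x := by have : R₁ < x := hx; linarith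
      have hn : R₁ < ‖(x : ℂ)‖ := by rwa [Complex.norm_real, norm_of_nonneg hx0.le]
      have h1 := (hv _ hn).comp_hasDerivAt x (Complex.ofRealCLM.hasDerivAt (x := x))
      have h2 := h1.fun_sub ((Real.hasDerivAt_log hx0.ne').const_mul a.re)
      convert! h2 using 1
      have : (a / (x : ℂ)).re = a.re / x := Complex.div_ofReal_re a x
      simp [this]; field_simp; ring
    obtain ⟨c, hc⟩ := isOpen_Ioi.exists_is_const_of_deriv_eq_zero (𝕜 := ℝ)
      isPreconnected_Ioi (fun x hx => (hd x hx).differentiableAt.differentiableWithinAt)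
      (fun x hx => (hd x hx).deriv)
    have hHc : Tendsto (fun x : ℝ => (-H₀ (x : ℂ)⁻¹).re) atTop (𝓝 (-H₀ 0).re) := by
      have h1 : ContinuousAt (fun ζ => (-H₀ ζ).re) 0 :=
        Complex.continuous_re.continuousAt.comp (hH₀ 0 (Metric.mem_ball_self hε)).continuousAt.neg
      have h2 : Tendsto (fun x : ℝ => (x : ℂ)⁻¹) atTop (𝓝 0) := by
        have := (Complex.continuous_ofReal.tendsto 0).comp tendsto_inv_atTop_zero
        simpa [Function.comp_def] using this
      exact h1.tendsto.comp h2
    have hlim1 : Tendsto (fun x : ℝ => u x / Real.log x) atTop (𝓝 1) := by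
      have h2 : Tendsto (fun x : ℝ => (x : ℂ)) atTop (Bornology.cobounded ℂ) :=
        RCLike.tendsto_ofReal_atTop_cobounded ℂ
      refine (hlog.comp h2).congr' ?_
      filter_upwards [eventually_gt_atTop 0] with x hx
      simp [abs_of_pos hx]
    have hlim2 : Tendsto (fun x : ℝ => u x / Real.log x) atTop (𝓝 (a.re + 0)) := by
      have h3 : Tendsto (fun x : ℝ => (c + (-H₀ (x : ℂ)⁻¹).re) / Real.log x) atTop (𝓝 0) :=
        (tendsto_const_nhds.add hHc).div_atTop Real.tendsto_log_atTop
      refine (tendsto_const_nhds.add h3).congr' ?_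
      filter_upwards [eventually_gt_atTop R₁] with x hx
      have := hc x hx
      have hl : Real.log x ≠ 0 := (Real.log_pos (by linarith)).ne'
      rw [← this]; field_simp; ring
    rw [add_zero] at hlim2
    exact tendsto_nhds_unique hlim2 hlim1
  have ha1 : a = 1 := Complex.ext hare haim
  have hH₀a : ∀ ζ ∈ Metric.ball (0 : ℂ) ε, AnalyticAt ℂ (fun ζ => -H₀ ζ) ζ := fun ζ hζ =>
    (DifferentiableOn.analyticAt (s := Metric.ball 0 ε)
      (fun z hz => (hH₀ z hz).differentiableAt.differentiableWithinAt)
      (Metric.isOpen_ball.mem_nhds hζ)).neg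
  refine ⟨fun ζ => -H₀ ζ, hH₀a 0 (Metric.mem_ball_self hε), R₁, fun z hz =>
    ⟨hH₀a _ (hinv z hz), ?_⟩⟩
  rw [← ha1]; exact hH z hz

end

/-! ### Exactness of differences of poles and of Cauchy transforms -/

section

open Complex (IsExactOn)

/-- The quotient differs from `1` by less than `1` in modulus. Hence the principal logarithm gives a
single-valued primitive of a difference of two poles, although neither pole has one by itself. -/
lemma div_sub_mem_slitPlane {z ζ q : ℂ} (h : ‖ζ - q‖ < ‖z - q‖) :
    (z - ζ) / (z - q) ∈ Complex.slitPlane := by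
  have h0 : z - q ≠ 0 := norm_pos_iff.mp ((norm_nonneg _).trans_lt h)
  have e : (z - ζ) / (z - q) = 1 + (-(ζ - q) / (z - q)) := by field_simp; ring
  rw [e]
  apply Complex.mem_slitPlane_of_norm_lt_one
  rw [norm_div, norm_neg, div_lt_one (norm_pos_iff.mpr h0)]
  exact h

lemma hasDerivAt_log_div_sub {z ζ q : ℂ} (h : ‖ζ - q‖ < ‖z - q‖) :
    HasDerivAt (fun z => Complex.log ((z - ζ) / (z - q))) (1 / (z - ζ) - 1 / (z - q)) z := by
  have h0 : z - q ≠ 0 := norm_pos_iff.mp ((norm_nonneg _).trans_lt h)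
  have hs := div_sub_mem_slitPlane h
  have h1 : z - ζ ≠ 0 := by
    intro h1; rw [h1, zero_div] at hs; exact Complex.zero_notMem_slitPlane hs
  have h2 := (((hasDerivAt_id z).sub_const ζ).fun_div ((hasDerivAt_id z).sub_const q) h0).clog hs
  convert! h2 using 1
  simp only [id]
  field_simp

lemma isExactOn_add {f g : ℂ → ℂ} {s : Set ℂ} (hf : IsExactOn f s) (hg : IsExactOn g s) :
    IsExactOn (fun z => f z + g z) s := by
  obtain ⟨F, hF⟩ := hf
  obtain ⟨G, hG⟩ := hg
  exact ⟨fun z => F z + G z, fun z hz => (hF z hz).add (hG z hz)⟩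

lemma isExactOn_const_mul {f : ℂ → ℂ} {s : Set ℂ} (c : ℂ) (hf : IsExactOn f s) :
    IsExactOn (fun z => c * f z) s := by
  obtain ⟨F, hF⟩ := hf
  exact ⟨fun z => c * F z, fun z hz => (hF z hz).const_mul c⟩

lemma isExactOn_congr {f g : ℂ → ℂ} {s : Set ℂ} (hf : IsExactOn f s) (h : ∀ z ∈ s, f z = g z) :
    IsExactOn g s := by
  obtain ⟨F, hF⟩ := hf
  exact ⟨F, fun z hz => h z hz ▸ hF z hz⟩

/-- A difference of two simple poles in a connected set is exact away from that set. -/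
lemma isExactOn_pole_sub_pole {K : Set ℂ} (hK : IsPreconnected K) {ε : ℝ} (hε : 0 < ε) {p q : ℂ}
    (hp : p ∈ K) (hq : q ∈ K) :
    IsExactOn (fun z => 1 / (z - q) - 1 / (z - p)) {z | ε < Metric.infDist z K} := by
  -- Exactness of the difference is an equivalence relation on `K`. Points of `K` closer than `ε`
  -- are related through the logarithm, so connectedness relates all of them.
  refine hK.induction₂ (fun p q => IsExactOn (fun z => 1 / (z - q) - 1 / (z - p))
    {z | ε < Metric.infDist z K}) ?_ ?_ ?_ hp hq
  · intro x hx
    filter_upwards [mem_nhdsWithin_of_mem_nhds (Metric.ball_mem_nhds x hε)] with y hy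
    refine ⟨_, fun z hz => hasDerivAt_log_div_sub (?_ : ‖y - x‖ < ‖z - x‖)⟩
    rw [mem_ball_iff_norm] at hy
    refine hy.trans (lt_of_lt_of_le hz ?_)
    rw [← dist_eq_norm]
    exact Metric.infDist_le_dist_of_mem hx
  · intro x y z _ _ _ h1 h2
    exact isExactOn_congr (isExactOn_add h1 h2) fun w _ => by ring
  · intro x y _ _ h
    exact isExactOn_congr (isExactOn_const_mul (-1) h) fun w _ => by ring

/-- The Cauchy transform of a density near `q`, minus a pole at `q`, is exact away from `q`. -/
lemma isExactOn_integral_kernel {D : Set ℂ} (hD : IsOpen D) {m : ℂ → ℂ} (hm : Continuous m)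
    {q : ℂ} {B T : Set ℂ} (hB : IsCompact B) (hT : MeasurableSet T) (hTB : T ⊆ B) {ρ ε : ℝ}
    (hρε : ρ < ε) (hBq : ∀ ζ ∈ B, ‖ζ - q‖ ≤ ρ) (hDq : ∀ z ∈ D, ε < ‖z - q‖) :
    IsExactOn (fun z => ∫ ζ in T, m ζ * (1 / (z - ζ) - 1 / (z - q))) D := by
  refine ⟨fun z => ∫ ζ in T, m ζ * Complex.log ((z - ζ) / (z - q)), fun z₀ hz₀ => ?_⟩
  have hlt : ∀ z ∈ D, ∀ ζ ∈ B, ‖ζ - q‖ < ‖z - q‖ := fun z hz ζ hζ =>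
    ((hBq ζ hζ).trans_lt hρε).trans (hDq z hz)
  have hc1 : ∀ z ∈ D, ContinuousOn (fun ζ => m ζ * Complex.log ((z - ζ) / (z - q))) B := by
    intro z hz
    refine hm.continuousOn.mul (ContinuousOn.clog (by fun_prop) fun ζ hζ => ?_)
    exact div_sub_mem_slitPlane (hlt z hz ζ hζ)
  have hne : ∀ z ∈ D, ∀ ζ ∈ B, ε - ρ ≤ ‖z - ζ‖ := by
    intro z hz ζ hζ
    have h1 : ‖z - q‖ ≤ ‖z - ζ‖ + ‖ζ - q‖ := by
      calc ‖z - q‖ = ‖(z - ζ) + (ζ - q)‖ := by ring_nf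
        _ ≤ _ := norm_add_le _ _
    linarith [hBq ζ hζ, hDq z hz]
  have hc2 : ∀ z ∈ D, ContinuousOn (fun ζ => m ζ * (1 / (z - ζ) - 1 / (z - q))) B := by
    intro z hz
    refine hm.continuousOn.mul (ContinuousOn.sub (continuousOn_const.div (by fun_prop) ?_)
      continuousOn_const)
    intro ζ hζ
    exact norm_pos_iff.mp ((sub_pos.mpr hρε).trans_le (hne z hz ζ hζ))
  have hmeas : MeasurableSet B := hB.measurableSet
  refine (hasDerivAt_integral_of_dominated_loc_of_deriv_le
    (F := fun z ζ => m ζ * Complex.log ((z - ζ) / (z - q)))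
    (F' := fun z ζ => m ζ * (1 / (z - ζ) - 1 / (z - q)))
    (bound := fun ζ => ‖m ζ‖ * (1 / (ε - ρ) + 1 / (ε - ρ)))
    (hD.mem_nhds hz₀) ?_ ?_ ?_ ?_ ?_ ?_).2
  · filter_upwards [hD.mem_nhds hz₀] with z hz
    exact ((hc1 z hz).mono hTB).aestronglyMeasurable hT
  · exact ((hc1 z₀ hz₀).integrableOn_compact hB).mono_set hTB
  · exact ((hc2 z₀ hz₀).mono hTB).aestronglyMeasurable hT
  · refine (ae_restrict_iff' hT).mpr (Eventually.of_forall fun ζ hζ z hz => ?_)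
    have hq : ε - ρ ≤ ‖z - q‖ := by
      have := (norm_nonneg _).trans (hBq ζ (hTB hζ)); linarith [hDq z hz]
    have hpos : 0 < ε - ρ := by linarith
    rw [norm_mul]
    gcongr
    refine (norm_sub_le _ _).trans (add_le_add ?_ ?_)
    · rw [norm_div, norm_one]; exact one_div_le_one_div_of_le hpos (hne z hz ζ (hTB hζ))
    · rw [norm_div, norm_one]; exact one_div_le_one_div_of_le hpos hq
  · have : Continuous fun ζ => ‖m ζ‖ * (1 / (ε - ρ) + 1 / (ε - ρ)) := by fun_prop
    exact (this.continuousOn.integrableOn_compact hB).mono_set hTB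
  · refine (ae_restrict_iff' hT).mpr (Eventually.of_forall fun ζ hζ z hz => ?_)
    exact (hasDerivAt_log_div_sub (hlt z hz ζ (hTB hζ))).const_mul _

/-- The Cauchy transform of a density supported near a connected set `K` is exact, up to a pole in
`K`, away from `K`. -/
lemma isExactOn_cauchyTransform {K : Set ℂ} (hK : IsPreconnected K) {ε : ℝ} (hε : 0 < ε) {p : ℂ}
    (hp : p ∈ K) {m : ℂ → ℂ} (hm : Continuous m) {S : Set ℂ} (hS : IsCompact S)
    (hSK : ∀ ζ ∈ S, Metric.infDist ζ K < ε) :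
    IsExactOn (fun z => ∫ ζ in S, m ζ * (1 / (z - ζ) - 1 / (z - p)))
      {z | ε < Metric.infDist z K} := by
  set D := {z | ε < Metric.infDist z K} with hDdef
  have hD : IsOpen D := isOpen_lt continuous_const (Metric.continuous_infDist_pt K)
  have hne : ∀ z ∈ D, ∀ ζ : ℂ, Metric.infDist ζ K < ε → z - ζ ≠ 0 := by
    intro z hz ζ hζ h
    rw [sub_eq_zero] at h
    subst h
    exact lt_asymm hz hζ
  have hint_eq : ∀ z ∈ D, IntegrableOn (fun ζ => m ζ * (1 / (z - ζ) - 1 / (z - p))) S := by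
    intro z hz
    refine ContinuousOn.integrableOn_compact hS (hm.continuousOn.mul
      (ContinuousOn.sub (continuousOn_const.div (by fun_prop) ?_) continuousOn_const))
    exact fun ζ hζ => hne z hz ζ (hSK ζ hζ)
  -- Compactness induction. Exactness is required for all measurable `T` so that, over a union, `T`
  -- can be cut into the disjoint pieces `T ∩ V` and `T \ V`.
  have key : ∃ V, S ⊆ V ∧ MeasurableSet V ∧ ∀ T : Set ℂ, MeasurableSet T → T ⊆ S ∩ V →
      IsExactOn (fun z => ∫ ζ in T, m ζ * (1 / (z - ζ) - 1 / (z - p))) D := by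
    refine hS.induction_on (p := fun V' => ∃ V, V' ⊆ V ∧ MeasurableSet V ∧ ∀ T : Set ℂ,
      MeasurableSet T → T ⊆ S ∩ V →
      IsExactOn (fun z => ∫ ζ in T, m ζ * (1 / (z - ζ) - 1 / (z - p))) D) ?_ ?_ ?_ ?_
    · refine ⟨∅, le_rfl, MeasurableSet.empty, fun T _ hT => ?_⟩
      have : T = ∅ := by simpa using hT
      subst this
      exact ⟨fun _ => 0, fun z _ => by simpa using hasDerivAt_const z (0 : ℂ)⟩
    · rintro s t hst ⟨V, htV, h⟩
      exact ⟨V, hst.trans htV, h⟩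
    · rintro s t ⟨V, hsV, hVm, hV⟩ ⟨V', htV', hV'm, hV'⟩
      refine ⟨V ∪ V', union_subset_union hsV htV', hVm.union hV'm, fun T hT hTV => ?_⟩
      have e1 := hV (T ∩ V) (hT.inter hVm) fun x hx => ⟨(hTV hx.1).1, hx.2⟩
      have e2 := hV' (T \ V) (hT.diff hVm) fun x hx =>
        ⟨(hTV hx.1).1, (hTV hx.1).2.resolve_left hx.2⟩
      refine isExactOn_congr (isExactOn_add e1 e2) fun z hz => ?_
      exact integral_inter_add_sdiff hVm ((hint_eq z hz).mono_set fun x hx => (hTV hx).1)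
    · intro ζ₀ hζ₀
      -- Near `ζ₀` the reference pole is a close point `q` of `K`, for which the logarithm works. It
      -- is then moved to `p`, at the cost of the mass on `T` times a difference of poles.
      obtain ⟨q, hq, hqd⟩ := (Metric.infDist_lt_iff ⟨p, hp⟩).mp (hSK ζ₀ hζ₀)
      set η := (ε - dist ζ₀ q) / 2 with hη
      have hη0 : 0 < η := by rw [hη]; linarith
      refine ⟨Metric.closedBall ζ₀ η, mem_nhdsWithin_of_mem_nhds (Metric.closedBall_mem_nhds _ hη0),
        Metric.closedBall ζ₀ η, le_rfl, measurableSet_closedBall, fun T hT hTS => ?_⟩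
      have e1 := isExactOn_integral_kernel hD hm (q := q) (isCompact_closedBall ζ₀ η) hT
        (hTS.trans inter_subset_right) (ρ := ε - η) (ε := ε) (by linarith)
        (fun ζ hζ => by
          rw [← dist_eq_norm]
          have := dist_triangle ζ ζ₀ q
          have := Metric.mem_closedBall.mp hζ
          linarith)
        (fun z hz => by
          rw [← dist_eq_norm]
          exact lt_of_lt_of_le hz (Metric.infDist_le_dist_of_mem hq))
      have e2 := isExactOn_const_mul (∫ ζ in T, m ζ) (isExactOn_pole_sub_pole hK hε hp hq)
      have hmi : IntegrableOn m T :=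
        (hm.continuousOn.integrableOn_compact hS).mono_set (hTS.trans inter_subset_left)
      have hqne : Metric.infDist q K < ε := by rwa [Metric.infDist_zero_of_mem hq]
      refine isExactOn_congr (isExactOn_add e1 e2) fun z hz => ?_
      have hi1 : IntegrableOn (fun ζ => m ζ * (1 / (z - ζ) - 1 / (z - q))) T := by
        refine (ContinuousOn.integrableOn_compact hS (hm.continuousOn.mul
          (ContinuousOn.sub (continuousOn_const.div (by fun_prop) ?_) continuousOn_const))).mono_set
          (hTS.trans inter_subset_left)
        exact fun ζ hζ => hne z hz ζ (hSK ζ hζ)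
      rw [← integral_mul_const, ← integral_add hi1 (hmi.mul_const _)]
      congr 1
      ext ζ
      ring
  obtain ⟨V, hSV, -, hV⟩ := key
  exact hV S hS.measurableSet (by simpa using hSV)

end

/-! ### Primitives in the complement of a compact connected set -/

section

open Complex (IsExactOn)

lemma dbar_eq_zero {g : ℂ → ℂ} {z : ℂ} (h : DifferentiableAt ℂ g z) : dbar g z = 0 := by
  have h1 : fderiv ℝ g z = (fderiv ℂ g z).restrictScalars ℝ := h.fderiv_restrictScalars ℝ
  have h2 : fderiv ℂ g z Complex.I = Complex.I * fderiv ℂ g z 1 := by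
    rw [← smul_eq_mul, ← map_smul]; simp
  rw [dbar, h1]
  simp only [ContinuousLinearMap.coe_restrictScalars']
  rw [h2, ← mul_assoc, Complex.I_mul_I]; ring

lemma dbar_congr {f g : ℂ → ℂ} {z : ℂ} (h : f =ᶠ[𝓝 z] g) : dbar f z = dbar g z := by
  rw [dbar, dbar, h.fderiv_eq]

lemma exists_contDiff_cutoff {s t : Set ℂ} (hs : IsClosed s) (ht : IsClosed t)
    (hd : Disjoint s t) :
    ∃ χ : ℂ → ℝ, ContDiff ℝ 1 χ ∧ (∀ z ∈ s, χ z = 0) ∧ ∀ z ∈ t, χ z = 1 := by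
  obtain ⟨f, h0, h1, -⟩ := exists_contMDiffMap_zero_one_of_isClosed (n := 1)
    (modelWithCornersSelf ℝ ℂ) hs ht hd
  exact ⟨f, f.contMDiff.contDiff, h0, h1⟩

/-- A function that is holomorphic off the compact connected set `K` and asymptotic to `1 / z` at
infinity is exact, up to a simple pole in `K`, away from `K`. -/
lemma isExactOn_sub_pole {K : Set ℂ} (hKc : IsCompact K) (hK : IsPreconnected K) {p : ℂ}
    (hp : p ∈ K) {G : ℂ → ℂ} (hG : DifferentiableOn ℂ G Kᶜ)
    (h0 : Tendsto G (Bornology.cobounded ℂ) (𝓝 0))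
    (h1 : Tendsto (fun z => z * G z) (Bornology.cobounded ℂ) (𝓝 1)) {ε : ℝ} (hε : 0 < ε) :
    IsExactOn (fun z => G z - 1 / (z - p)) {z | ε < Metric.infDist z K} := by
  have hdc := Metric.continuous_infDist_pt K
  -- The product `χ G` extends smoothly across `K`, equals `G` beyond distance `ε/2`, and its `∂̄`
  -- lives within distance `ε/2` of `K`. Cauchy–Pompeiu therefore writes `G` as the Cauchy transform
  -- of a density there.
  obtain ⟨χ, hχ, hχ0, hχ1⟩ := exists_contDiff_cutoff
    (s := {z | Metric.infDist z K ≤ ε / 4}) (t := {z | ε / 2 ≤ Metric.infDist z K})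
    (isClosed_le hdc continuous_const) (isClosed_le continuous_const hdc)
    (disjoint_left.mpr fun z (h1 : Metric.infDist z K ≤ ε / 4)
      (h2 : ε / 2 ≤ Metric.infDist z K) => by linarith)
  have hoff : ∀ z, 0 < Metric.infDist z K → z ∈ Kᶜ := by
    intro z hz hzK
    rw [Metric.infDist_zero_of_mem hzK] at hz
    exact lt_irrefl _ hz
  set g : ℂ → ℂ := fun z => χ z * G z with hg
  have hgc : ContDiff ℝ 1 g := by
    rw [contDiff_iff_contDiffAt]
    intro z
    rcases lt_or_ge (Metric.infDist z K) (ε / 4) with h | h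
    · have : g =ᶠ[𝓝 z] fun _ => 0 := by
        filter_upwards [(isOpen_lt hdc continuous_const).mem_nhds h] with w hw
        simp [hg, hχ0 w (le_of_lt hw)]
      exact contDiffAt_const.congr_of_eventuallyEq this
    · have hz := hoff z (by linarith)
      have h2 : AnalyticAt ℂ G z := hG.analyticAt (hKc.isClosed.isOpen_compl.mem_nhds hz)
      have h3 : ContDiffAt ℝ 1 G z := h2.contDiffAt.restrict_scalars ℝ
      exact (Complex.ofRealCLM.contDiff.contDiffAt.comp z hχ.contDiffAt).mul h3
  have hgG : ∀ z, ε / 2 < Metric.infDist z K → g =ᶠ[𝓝 z] G := by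
    intro z hz
    filter_upwards [(isOpen_lt continuous_const hdc).mem_nhds hz] with w hw
    simp [hg, hχ1 w (le_of_lt hw)]
  obtain ⟨R, hR⟩ := hKc.isBounded.exists_norm_le
  have hRd : ∀ z : ℂ, R + ε < ‖z‖ → ε ≤ Metric.infDist z K := by
    intro z hz
    refine (Metric.le_infDist ⟨p, hp⟩).mpr fun y hy => ?_
    rw [dist_eq_norm]
    have := norm_sub_norm_le z y
    linarith [hR y hy]
  have hg0 : Tendsto g (Bornology.cobounded ℂ) (𝓝 0) := by
    refine h0.congr' ?_
    rw [EventuallyEq, ← comap_norm_atTop, eventually_comap]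
    filter_upwards [eventually_gt_atTop (R + ε)] with x hx z hz
    exact ((hgG z (by linarith [hRd z (hz ▸ hx)])).self_of_nhds).symm
  have hdb0 : ∀ z, ε / 2 < Metric.infDist z K → dbar g z = 0 := by
    intro z hz
    rw [dbar_congr (hgG z hz)]
    exact dbar_eq_zero (hG.differentiableAt (hKc.isClosed.isOpen_compl.mem_nhds
      (hoff z (by linarith))))
  have hpomp := integral_dbar_div hgc hg0 (ρ := R + ε) fun z hz => hdb0 z (by linarith [hRd z hz])
  set S := {z | Metric.infDist z K ≤ ε / 2} with hS
  have hSc : IsCompact S := by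
    refine Metric.isCompact_of_isClosed_isBounded (isClosed_le hdc continuous_const) ?_
    refine (Metric.isBounded_closedBall (x := (0 : ℂ)) (r := R + ε)).subset fun z hz => ?_
    rw [mem_closedBall_zero_iff]
    by_contra h
    have := hRd z (not_le.mp h)
    have : Metric.infDist z K ≤ ε / 2 := hz
    linarith
  set m : ℂ → ℂ := fun ζ => dbar g ζ / π with hm
  have hmc : Continuous m := (continuous_dbar hgc).div_const _
  have hm0 : ∀ ζ, ζ ∉ S → m ζ = 0 := fun ζ hζ => by
    rw [hm]; simp only; rw [hdb0 ζ (not_le.mp hζ), zero_div]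
  have hpi : (π : ℂ) ≠ 0 := by exact_mod_cast pi_ne_zero
  -- the Cauchy transform reproduces `G` away from `K`
  have hrep : ∀ z, ε < Metric.infDist z K → ∫ ζ in S, m ζ * (1 / (z - ζ)) = G z := by
    intro z hz
    rw [setIntegral_eq_integral_of_forall_compl_eq_zero (fun ζ hζ => by rw [hm0 ζ hζ, zero_mul])]
    have e : ∀ ζ, m ζ * (1 / (z - ζ)) = (π : ℂ)⁻¹ * (dbar g ζ / (z - ζ)) := fun ζ => by
      rw [hm]; ring
    simp only [e]
    rw [integral_const_mul, hpomp z, (hgG z (by linarith)).self_of_nhds, inv_mul_cancel_left₀ hpi]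
  have hmS : IntegrableOn m S := hmc.continuousOn.integrableOn_compact hSc
  -- Multiply the representation by `z` and let `z → ∞`: dominated convergence gives the mass, while
  -- `z G z → 1`. A mass of one is what allows subtracting exactly one pole `1 / (z - p)`.
  have hmass : ∫ ζ in S, m ζ = 1 := by
    have hlim : Tendsto (fun z : ℂ => ∫ ζ in S, m ζ * (z / (z - ζ))) (Bornology.cobounded ℂ)
        (𝓝 (∫ ζ in S, m ζ)) := by
      obtain ⟨ρ, hρ⟩ := hSc.isBounded.exists_norm_le
      have hfar : ∀ᶠ z : ℂ in Bornology.cobounded ℂ, max (2 * ρ) 0 < ‖z‖ :=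
        tendsto_norm_cobounded_atTop.eventually_gt_atTop _
      have : (Bornology.cobounded ℂ).IsCountablyGenerated := by
        rw [← comap_norm_atTop]; infer_instance
      refine tendsto_integral_filter_of_dominated_convergence (fun ζ => ‖m ζ‖ * 2) ?_ ?_ ?_ ?_
      · filter_upwards [hfar] with z hz
        refine ContinuousOn.aestronglyMeasurable (hmc.continuousOn.mul
          (continuousOn_const.div (by fun_prop) fun ζ hζ => ?_)) hSc.measurableSet
        intro h
        rw [sub_eq_zero] at h
        subst h
        have := hρ z hζ
        have := (le_max_left _ _).trans_lt hz
        have := (le_max_right _ _).trans_lt hz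
        linarith
      · filter_upwards [hfar] with z hz
        refine (ae_restrict_iff' hSc.measurableSet).mpr (Eventually.of_forall fun ζ hζ => ?_)
        rw [norm_mul]
        gcongr
        have h1 := hρ ζ hζ
        have h2 := (le_max_left _ _).trans_lt hz
        have h3 := (le_max_right _ _).trans_lt hz
        have h4 := norm_sub_norm_le z ζ
        rw [norm_div, div_le_iff₀ (by linarith)]
        linarith
      · exact hmS.norm.mul_const 2
      · refine Eventually.of_forall fun ζ => ?_
        have h2 : Tendsto (fun z : ℂ => z / (z - ζ)) (Bornology.cobounded ℂ) (𝓝 1) := by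
          have h3 : Tendsto (fun z : ℂ => 1 / (1 - ζ * z⁻¹)) (Bornology.cobounded ℂ)
              (𝓝 (1 / (1 - ζ * 0))) :=
            tendsto_const_nhds.div (tendsto_const_nhds.sub
              (tendsto_const_nhds.mul tendsto_inv₀_cobounded)) (by simp)
          simp only [mul_zero, sub_zero, div_one] at h3
          refine h3.congr' ?_
          filter_upwards [hfar] with z hz
          have hz0 : z ≠ 0 := norm_pos_iff.mp ((le_max_right _ _).trans_lt hz)
          rw [show 1 - ζ * z⁻¹ = (z - ζ) / z by field_simp, one_div_div]
        simpa using h2.const_mul (m ζ)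
    have hlim2 : Tendsto (fun z : ℂ => ∫ ζ in S, m ζ * (z / (z - ζ))) (Bornology.cobounded ℂ)
        (𝓝 1) := by
      refine h1.congr' ?_
      have hfar : ∀ᶠ z : ℂ in Bornology.cobounded ℂ, R + 2 * ε < ‖z‖ :=
        tendsto_norm_cobounded_atTop.eventually_gt_atTop _
      filter_upwards [hfar] with z hz
      have hz2 : ε < Metric.infDist z K := by
        refine lt_of_lt_of_le (b := (ε + (‖z‖ - R - ε)) ) (by linarith) ?_
        refine (Metric.le_infDist ⟨p, hp⟩).mpr fun y hy => ?_
        rw [dist_eq_norm]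
        have := norm_sub_norm_le z y
        linarith [hR y hy]
      rw [← hrep z hz2, ← integral_const_mul]
      congr 1; ext ζ; ring
    have : (Bornology.cobounded ℂ).NeBot := inferInstance
    exact tendsto_nhds_unique hlim hlim2
  have hex := isExactOn_cauchyTransform hK hε hp hmc hSc fun ζ (hζ : Metric.infDist ζ K ≤ ε / 2) => by linarith
  refine isExactOn_congr hex fun z hz => ?_
  have hi : IntegrableOn (fun ζ => m ζ * (1 / (z - ζ))) S := by
    refine ContinuousOn.integrableOn_compact hSc (hmc.continuousOn.mul
      (continuousOn_const.div (by fun_prop) fun ζ hζ h => ?_))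
    rw [sub_eq_zero] at h
    subst h
    have h1 : Metric.infDist z K ≤ ε / 2 := hζ
    have h2 : ε < Metric.infDist z K := hz
    linarith
  simp only [mul_sub]
  rw [integral_sub hi (hmS.mul_const _), hrep z hz, integral_mul_const, hmass, one_mul]

/-- Primitives away from a closed set `K` glue to a primitive off `K`, if `Kᶜ` is connected. -/
lemma isExactOn_compl_of_forall {K : Set ℂ} (hKc : IsClosed K) (hKne : K.Nonempty)
    (hconn : IsConnected Kᶜ) {f : ℂ → ℂ}
    (h : ∀ ε > 0, IsExactOn f {z | ε < Metric.infDist z K}) : IsExactOn f Kᶜ := by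
  obtain ⟨z₁, hz₁⟩ := hconn.nonempty
  have hdc := Metric.continuous_infDist_pt K
  set D : ℝ → Set ℂ := fun ε => {z | ε < Metric.infDist z K} with hD
  have hDo : ∀ ε, IsOpen (D ε) := fun ε => isOpen_lt continuous_const hdc
  -- The set `D ε` may be disconnected, so the normalization at `z₁` determines a primitive only on
  -- this component. The components exhaust `Kᶜ`, because a path from `z₁` is compact and keeps a
  -- positive distance from `K`.
  set C : ℝ → Set ℂ := fun ε => connectedComponentIn (D ε) z₁ with hC
  have hCo : ∀ ε, IsOpen (C ε) := fun ε => (hDo ε).connectedComponentIn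
  have hCD : ∀ ε, C ε ⊆ D ε := fun ε => connectedComponentIn_subset _ _
  have hcov : ∀ z ∈ Kᶜ, ∃ ε > 0, z ∈ C ε := by
    intro z hz
    obtain ⟨γ, hγ⟩ := (hKc.isOpen_compl.isConnected_iff_isPathConnected.mp hconn).joinedIn
      z₁ hz₁ z hz
    have hcomp : IsCompact (range γ) := isCompact_range γ.continuous
    obtain ⟨y, hy, hmin⟩ := hcomp.exists_isMinOn (range_nonempty γ) hdc.continuousOn
    have hypos : 0 < Metric.infDist y K := by
      obtain ⟨t, rfl⟩ := hy
      exact (hKc.notMem_iff_infDist_pos hKne).mp (hγ t)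
    refine ⟨Metric.infDist y K / 2, by positivity, ?_⟩
    have hsub : range γ ⊆ D (Metric.infDist y K / 2) := fun w hw => by
      have : Metric.infDist y K ≤ Metric.infDist w K := hmin hw
      change Metric.infDist y K / 2 < Metric.infDist w K
      linarith
    exact (isPreconnected_range γ.continuous).subset_connectedComponentIn
      ⟨0, γ.source⟩ hsub ⟨1, γ.target⟩
  have hC1 : ∀ ε, ∀ z ∈ C ε, z₁ ∈ C ε := fun ε z hz =>
    mem_connectedComponentIn (connectedComponentIn_nonempty_iff.mp ⟨z, hz⟩)
  choose! ε hε hzε using hcov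
  choose! F hF1 hF using fun (δ : ℝ) (hδ : 0 < δ) => (h δ hδ).with_val_at z₁ 0
  have hmono : ∀ δ δ', 0 < δ → δ ≤ δ' → ∀ z ∈ C δ', F δ z = F δ' z := by
    intro δ δ' hδ hle z hz
    have hsub : D δ' ⊆ D δ := fun w (hw : δ' < Metric.infDist w K) => lt_of_le_of_lt hle hw
    refine (hCo δ').eqOn_of_deriv_eq (𝕜 := ℂ) isPreconnected_connectedComponentIn
      (fun w hw => ?_) (fun w hw => ?_) (fun w hw => ?_) (hC1 δ' z hz) ?_ hz
    · exact (hF δ hδ w (hsub (hCD _ hw))).differentiableAt.differentiableWithinAt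
    · exact (hF δ' (hδ.trans_le hle) w (hCD _ hw)).differentiableAt.differentiableWithinAt
    · rw [(hF δ hδ w (hsub (hCD _ hw))).deriv, (hF δ' (hδ.trans_le hle) w (hCD _ hw)).deriv]
    · rw [hF1 δ hδ, hF1 δ' (hδ.trans_le hle)]
  have hagree : ∀ δ δ', 0 < δ → 0 < δ' → ∀ z ∈ C δ, z ∈ C δ' → F δ z = F δ' z := by
    intro δ δ' hδ hδ' z hz hz'
    rcases le_total δ δ' with hle | hle
    · exact hmono δ δ' hδ hle z hz'
    · exact (hmono δ' δ hδ' hle z hz).symm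
  refine ⟨fun z => F (ε z) z, fun z hz => ?_⟩
  have hd := hF (ε z) (hε z hz) z (hCD _ (hzε z hz))
  refine hd.congr_of_eventuallyEq ?_
  filter_upwards [(hCo (ε z)).mem_nhds (hzε z hz), hKc.isOpen_compl.mem_nhds hz] with w hw hwK
  exact hagree _ _ (hε w hwK) (hε z hz) w (hzε w hwK) hw

end

/-! ### The single-valued function `W` with modulus `exp (-u)`, and its injectivity -/

section

open Complex (IsExactOn)

lemma exists_polarPt_eq (z : ℂ) : polarPt ‖z‖ z.arg = z := by
  simp [polarPt]

lemma isPreconnected_polar_image {I : Set ℝ} (hI : IsPreconnected I) (hI0 : ∀ r ∈ I, 0 ≤ r) :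
    IsPreconnected {z : ℂ | ‖z‖ ∈ I} := by
  have : {z : ℂ | ‖z‖ ∈ I} = (fun x : ℝ × ℝ => polarPt x.1 x.2) '' (I ×ˢ univ) := by
    ext z
    constructor
    · intro hz
      exact ⟨(‖z‖, z.arg), ⟨hz, mem_univ _⟩, exists_polarPt_eq z⟩
    · rintro ⟨⟨r, θ⟩, ⟨hr, -⟩, rfl⟩
      change ‖polarPt r θ‖ ∈ I
      rwa [norm_polarPt, abs_of_nonneg (hI0 r hr)]
  rw [this]
  exact (hI.prod isPreconnected_univ).image _ continuous_polarPt.continuousOn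

lemma isPreconnected_norm_gt {R : ℝ} (hR : 0 ≤ R) : IsPreconnected {z : ℂ | R < ‖z‖} :=
  isPreconnected_polar_image isPreconnected_Ioi fun _ hr => hR.trans (le_of_lt hr)

lemma isPreconnected_puncturedDisc : IsPreconnected {z : ℂ | ‖z‖ ∈ Ioo (0 : ℝ) 1} :=
  isPreconnected_polar_image isPreconnected_Ioo fun _ hr => hr.1.le

/-- A potential in the exterior domain `Ω` with complex gradient `G`, asymptotic to `log |z|` at
infinity and with boundary values `0`. -/
structure IsExteriorPotential (Ω : Set ℂ) (u : ℂ → ℝ) (G : ℂ → ℂ) : Prop where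
  isOpen : IsOpen Ω
  isConnected : IsConnected Ω
  isCompact_compl : IsCompact Ωᶜ
  isPreconnected_compl : IsPreconnected Ωᶜ
  nonempty_compl : Ωᶜ.Nonempty
  differentiableOn : DifferentiableOn ℂ G Ω
  hasFDerivAt : ∀ z ∈ Ω, HasFDerivAt u (reMul (G z)) z
  log_growth : Tendsto (fun z => u z / Real.log ‖z‖) (Bornology.cobounded ℂ) (𝓝 1)
  continuousOn : ContinuousOn u (closure Ω)
  boundary : ∀ z ∈ frontier Ω, u z = 0

namespace IsExteriorPotential

variable {Ω : Set ℂ} {u : ℂ → ℝ} {G : ℂ → ℂ}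

lemma exists_radius (h : IsExteriorPotential Ω u G) : ∃ R, 0 ≤ R ∧ ∀ z, R < ‖z‖ → z ∈ Ω := by
  obtain ⟨R, hR⟩ := h.isCompact_compl.isBounded.exists_norm_le
  refine ⟨max R 0, le_max_right _ _, fun z hz => ?_⟩
  by_contra hn
  have := hR z hn
  linarith [(le_max_left R 0).trans_lt hz]

/-- The complex potential is the logarithm of a single-valued holomorphic function. -/
lemma exists_exp_potential (h : IsExteriorPotential Ω u G) :
    ∃ W : ℂ → ℂ, (∀ z ∈ Ω, HasDerivAt W (-G z * W z) z) ∧ (∀ z ∈ Ω, ‖W z‖ = Real.exp (-u z)) ∧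
      ∃ (η : ℂ → ℂ) (R : ℝ), AnalyticAt ℂ η 0 ∧ η 0 = 0 ∧ deriv η 0 ≠ 0 ∧
        ∀ z, R < ‖z‖ → z ∈ Ω ∧ W z = η z⁻¹ := by
  obtain ⟨R, hR0, hR⟩ := h.exists_radius
  have hGd : ∀ z, R < ‖z‖ → DifferentiableAt ℂ G z := fun z hz =>
    h.differentiableOn.differentiableAt (h.isOpen.mem_nhds (hR z hz))
  obtain ⟨H, hH0, R', hH⟩ := exists_expansion_at_infinity hGd
    (fun z hz => h.hasFDerivAt z (hR z hz)) h.log_growth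
  -- Differentiating `H (1/z)` gives `G z - 1/z = -H' (1/z) / z²`.
  have hzG : Tendsto (fun z => z * G z) (Bornology.cobounded ℂ) (𝓝 1) := by
    have h1 : Tendsto (fun z : ℂ => 1 - z⁻¹ * deriv H z⁻¹) (Bornology.cobounded ℂ)
        (𝓝 (1 - 0 * deriv H 0)) :=
      tendsto_const_nhds.sub (tendsto_inv₀_cobounded.mul
        (hH0.deriv.continuousAt.tendsto.comp tendsto_inv₀_cobounded))
    rw [zero_mul, sub_zero] at h1
    refine h1.congr' ?_
    filter_upwards [tendsto_norm_cobounded_atTop.eventually_gt_atTop (max R' 0)] with z hz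
    have hz0 : z ≠ 0 := norm_pos_iff.mp ((le_max_right _ _).trans_lt hz)
    obtain ⟨ha, hd⟩ := hH z ((le_max_left _ _).trans_lt hz)
    have h2 := ha.differentiableAt.hasDerivAt.comp z (hasDerivAt_inv hz0)
    have h3 := hd.unique h2
    have h4 : G z = 1 / z + deriv H z⁻¹ * -(z ^ 2)⁻¹ := by rw [← h3]; ring
    rw [h4]; field_simp; ring
  obtain ⟨p, hp⟩ := h.nonempty_compl
  have hex : IsExactOn (fun z => G z - 1 / (z - p)) Ω := by
    have := isExactOn_compl_of_forall (K := Ωᶜ) h.isOpen.isClosed_compl ⟨p, hp⟩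
      (by rw [compl_compl]; exact h.isConnected) (f := fun z => G z - 1 / (z - p))
      (fun ε hε => isExactOn_sub_pole h.isCompact_compl h.isPreconnected_compl hp
        (by rw [compl_compl]; exact h.differentiableOn)
        (tendsto_gradient_zero hGd (fun z hz => h.hasFDerivAt z (hR z hz)) h.log_growth) hzG hε)
    rwa [compl_compl] at this
  obtain ⟨F, hF⟩ := hex
  have hzp : ∀ z ∈ Ω, z - p ≠ 0 := fun z hz h0 => hp (by rwa [← sub_eq_zero.mp h0])
  have hlogp : ∀ z ∈ Ω, HasFDerivAt (fun z => (F z).re + Real.log ‖z - p‖) (reMul (G z)) z := by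
    intro z hz
    have h2 : HasFDerivAt (fun z => Real.log ‖z - p‖) (reMul (1 / (z - p))) z :=
      HasFDerivAt.comp (f := fun z : ℂ => z - p) z (hasFDerivAt_log_norm (hzp z hz))
        ((hasFDerivAt_id z).sub_const p)
    convert! (hasFDerivAt_re (hF z hz)).fun_add h2 using 1
    ext; simp; ring
  obtain ⟨c, hc⟩ := exists_sub_eq_of_hasFDerivAt h.isOpen h.isConnected.isPreconnected
    h.hasFDerivAt hlogp
  -- Here `u = c + Re F + log |z - p|`. The multivalued part of the conjugate of `u` is the argument
  -- of `z - p`, which exponentiation removes.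
  set W : ℂ → ℂ := fun z => Complex.exp (-F z - c) / (z - p) with hW
  have hWd : ∀ z ∈ Ω, HasDerivAt W (-G z * W z) z := by
    intro z hz
    have h1 := (((hF z hz).neg.sub_const (c : ℂ)).cexp).fun_div
      ((hasDerivAt_id z).sub_const p) (hzp z hz)
    convert! h1 using 1
    have := hzp z hz
    simp only [hW, id, Pi.neg_apply]; field_simp; ring
  have hWn : ∀ z ∈ Ω, ‖W z‖ = Real.exp (-u z) := by
    intro z hz
    have hpos : 0 < ‖z - p‖ := norm_pos_iff.mpr (hzp z hz)
    rw [hW, norm_div, Complex.norm_exp, show u z = c + ((F z).re + Real.log ‖z - p‖) by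
      linarith [hc z hz], show -(c + ((F z).re + Real.log ‖z - p‖))
        = (-F z - (c : ℂ)).re - Real.log ‖z - p‖ by simp; ring, Real.exp_sub, Real.exp_log hpos]
  have hWne : ∀ z ∈ Ω, W z ≠ 0 := fun z hz h0 => by
    have := hWn z hz
    rw [h0, norm_zero] at this
    exact (Real.exp_pos _).ne this
  refine ⟨W, hWd, hWn, ?_⟩
  set R₁ := max (max R R') 0 with hR₁
  have hR₁' : ∀ z : ℂ, R₁ < ‖z‖ → z ∈ Ω ∧ R' < ‖z‖ ∧ z ≠ 0 := fun z hz =>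
    ⟨hR z (((le_max_left _ _).trans (le_max_left _ _)).trans_lt hz),
      ((le_max_right _ _).trans (le_max_left _ _)).trans_lt hz,
      norm_pos_iff.mp ((le_max_right _ _).trans_lt hz)⟩
  -- The logarithmic derivatives `1/z`, `G - 1/z` and `-G` add up to zero. With the constant `b`
  -- this reads `W = b ζ exp (-H ζ)` for `ζ = 1/z`, a simple zero at infinity.
  have hY : ∀ z : ℂ, R₁ < ‖z‖ → HasDerivAt (fun z => z * Complex.exp (H z⁻¹) * W z) 0 z := by
    intro z hz
    obtain ⟨hzΩ, hz', hz0⟩ := hR₁' z hz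
    have h1 := ((hasDerivAt_id z).fun_mul (hH z hz').2.cexp).fun_mul (hWd z hzΩ)
    convert! h1 using 1
    simp only [id]; field_simp; ring
  obtain ⟨b, hb⟩ := (isOpen_lt continuous_const continuous_norm).exists_is_const_of_deriv_eq_zero
    (𝕜 := ℂ) (s := {z : ℂ | R₁ < ‖z‖}) (isPreconnected_norm_gt (le_max_right _ _))
    (fun z hz => (hY z hz).differentiableAt.differentiableWithinAt) (fun z hz => (hY z hz).deriv)
  refine ⟨fun ζ => b * ζ * Complex.exp (-H ζ), R₁, ?_, by simp, ?_, fun z hz => ⟨(hR₁' z hz).1, ?_⟩⟩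
  · exact (analyticAt_const.mul analyticAt_id).mul hH0.neg.cexp
  · have h1 : HasDerivAt (fun ζ => b * ζ * Complex.exp (-H ζ)) (b * Complex.exp (-H 0)) 0 := by
      have := ((hasDerivAt_id (0 : ℂ)).const_mul b).fun_mul
        (hH0.differentiableAt.hasDerivAt.neg.cexp)
      simpa using this
    rw [h1.deriv]
    refine mul_ne_zero ?_ (Complex.exp_ne_zero _)
    have hx : R₁ < ‖((R₁ + 1 : ℝ) : ℂ)‖ := by
      rw [Complex.norm_real]
      exact lt_of_lt_of_le (by linarith) (le_abs_self _)
    rw [← hb _ hx]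
    obtain ⟨hzΩ, -, hz0⟩ := hR₁' _ hx
    exact mul_ne_zero (mul_ne_zero hz0 (Complex.exp_ne_zero _)) (hWne _ hzΩ)
  · rw [← hb z hz]
    beta_reduce
    rw [Complex.exp_neg]
    have hz0 := (hR₁' z hz).2.2
    have := Complex.exp_ne_zero (H z⁻¹)
    field_simp

/-- `W = exp (-(u + i v))` for a conjugate `v` of the potential, with a simple zero at infinity. -/
structure IsExpPotential (Ω : Set ℂ) (u : ℂ → ℝ) (G W : ℂ → ℂ) (η : ℂ → ℂ) (R : ℝ) : Prop where
  hasDerivAt : ∀ z ∈ Ω, HasDerivAt W (-G z * W z) z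
  norm_eq : ∀ z ∈ Ω, ‖W z‖ = Real.exp (-u z)
  analyticAt : AnalyticAt ℂ η 0
  map_zero : η 0 = 0
  deriv_ne_zero : deriv η 0 ≠ 0
  eq_near_infinity : ∀ z, R < ‖z‖ → z ∈ Ω ∧ W z = η z⁻¹

section

variable {W η : ℂ → ℂ} {R : ℝ}

lemma tendsto_u_atTop (h : IsExteriorPotential Ω u G) :
    Tendsto u (Bornology.cobounded ℂ) atTop := by
  have h1 : Tendsto (fun z : ℂ => u z / Real.log ‖z‖ * Real.log ‖z‖) (Bornology.cobounded ℂ) atTop :=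
    h.log_growth.pos_mul_atTop one_pos
      (Real.tendsto_log_atTop.comp tendsto_norm_cobounded_atTop)
  refine h1.congr' ?_
  filter_upwards [tendsto_norm_cobounded_atTop.eventually_gt_atTop 1] with z hz
  have := (Real.log_pos hz).ne'
  field_simp

lemma expPotential_differentiableOn (hW : IsExpPotential Ω u G W η R) : DifferentiableOn ℂ W Ω :=
  fun z hz => (hW.hasDerivAt z hz).differentiableAt.differentiableWithinAt

lemma expPotential_ne_zero (hW : IsExpPotential Ω u G W η R) {z : ℂ} (hz : z ∈ Ω) : W z ≠ 0 := by
  intro h0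
  have := hW.norm_eq z hz
  rw [h0, norm_zero] at this
  exact (Real.exp_pos _).ne this

/-- The potential is positive inside. -/
lemma pos (h : IsExteriorPotential Ω u G) (hW : IsExpPotential Ω u G W η R) {z : ℂ} (hz : z ∈ Ω) :
    0 < u z := by
  -- A nonpositive value would, since `u → ∞` and `u = 0` on the frontier, force `u` to attain its
  -- minimum in `Ω`. Then `|W|` has an interior maximum, `W` is constant, and `u` cannot tend to
  -- infinity.
  by_contra hle
  rw [not_lt] at hle
  obtain ⟨ρ, hρ⟩ := exists_forall_norm_of_cobounded (h.tendsto_u_atTop.eventually_gt_atTop 0)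
  set A := closure Ω ∩ Metric.closedBall 0 (max ρ ‖z‖) with hA
  have hAc : IsCompact A := (isCompact_closedBall _ _).inter_left isClosed_closure
  have hzA : z ∈ A := ⟨subset_closure hz, by simp⟩
  obtain ⟨z₂, hz₂, hmin⟩ := hAc.exists_isMinOn ⟨z, hzA⟩ (h.continuousOn.mono inter_subset_left)
  have hmin' : ∀ w ∈ Ω, u z₂ ≤ u w := by
    intro w hw
    by_cases hwn : ‖w‖ ≤ max ρ ‖z‖
    · exact hmin ⟨subset_closure hw, by simpa using hwn⟩
    · have h1 := hρ w ((le_max_left _ _).trans_lt (not_le.mp hwn))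
      have h2 : u z₂ ≤ u z := hmin hzA
      linarith
  obtain ⟨z₃, hz₃, hmin₃⟩ : ∃ z₃ ∈ Ω, ∀ w ∈ Ω, u z₃ ≤ u w := by
    by_cases h2 : z₂ ∈ Ω
    · exact ⟨z₂, h2, hmin'⟩
    · have h3 : u z₂ = 0 := h.boundary z₂ (by
        rw [h.isOpen.frontier_eq]; exact ⟨hz₂.1, h2⟩)
      exact ⟨z, hz, fun w hw => hle.trans (h3 ▸ hmin' w hw)⟩
  have hmax : IsMaxOn (norm ∘ W) Ω z₃ := fun w hw => by
    simp only [Function.comp, mem_ofPred_eq]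
    rw [hW.norm_eq w hw, hW.norm_eq z₃ hz₃]
    exact Real.exp_le_exp.mpr (neg_le_neg (hmin₃ w hw))
  have hconst := Complex.eqOn_of_isPreconnected_of_isMaxOn_norm h.isConnected.isPreconnected
    h.isOpen (expPotential_differentiableOn hW) hz₃ hmax
  obtain ⟨R₀, -, hR₀⟩ := h.exists_radius
  obtain ⟨w, hw1, hw2⟩ := ((h.tendsto_u_atTop.eventually_gt_atTop (u z₃)).and
    (tendsto_norm_cobounded_atTop.eventually_gt_atTop R₀)).exists
  have h4 := congrArg norm (hconst (hR₀ w hw2))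
  rw [Function.const_apply, hW.norm_eq _ (hR₀ w hw2), hW.norm_eq _ hz₃, Real.exp_eq_exp] at h4
  linarith

/-- The part of the domain between two levels is compact. -/
lemma isCompact_between (h : IsExteriorPotential Ω u G) (hW : IsExpPotential Ω u G W η R)
    {a b : ℝ} (ha : 0 < a) (hb : b < 1) : IsCompact {z | z ∈ Ω ∧ ‖W z‖ ∈ Icc a b} := by
  have hset : {z | z ∈ Ω ∧ ‖W z‖ ∈ Icc a b} =
      closure Ω ∩ u ⁻¹' {x | a ≤ Real.exp (-x) ∧ Real.exp (-x) ≤ b} := by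
    ext z
    constructor
    · rintro ⟨hz, h1, h2⟩
      rw [hW.norm_eq z hz] at h1 h2
      exact ⟨subset_closure hz, h1, h2⟩
    · rintro ⟨hz, h1, h2⟩
      have hzΩ : z ∈ Ω := by
        by_contra hn
        have := h.boundary z (by rw [h.isOpen.frontier_eq]; exact ⟨hz, hn⟩)
        rw [this, neg_zero, Real.exp_zero] at h2
        linarith
      refine ⟨hzΩ, ?_⟩
      rw [hW.norm_eq z hzΩ]
      exact ⟨h1, h2⟩
  rw [hset]
  refine Metric.isCompact_of_isClosed_isBounded ?_ ?_
  · refine h.continuousOn.preimage_isClosed_of_isClosed isClosed_closure ?_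
    have hc : Continuous fun x : ℝ => Real.exp (-x) := Real.continuous_exp.comp continuous_neg
    exact (isClosed_le continuous_const hc).inter (isClosed_le hc continuous_const)
  · obtain ⟨ρ, hρ⟩ := exists_forall_norm_of_cobounded
      (h.tendsto_u_atTop.eventually_gt_atTop (-Real.log a))
    refine (Metric.isBounded_closedBall (x := (0 : ℂ)) (r := ρ)).subset fun z hz => ?_
    rw [mem_closedBall_zero_iff]
    by_contra hn
    have h1 := hρ z (not_le.mp hn)
    have h2 : a ≤ Real.exp (-u z) := hz.2.1
    rw [← Real.log_le_iff_le_exp ha] at h2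
    linarith

/-- `W` is small only near infinity. -/
lemma exists_norm_lt_imp_far (h : IsExteriorPotential Ω u G)
    (hW : IsExpPotential Ω u G W η R) (ρ : ℝ) :
    ∃ t > 0, ∀ z ∈ Ω, ‖W z‖ < t → ρ < ‖z‖ := by
  have hA : IsCompact (closure Ω ∩ Metric.closedBall 0 ρ) :=
    (isCompact_closedBall _ _).inter_left isClosed_closure
  obtain ⟨M, hM⟩ := hA.exists_bound_of_continuousOn (h.continuousOn.mono inter_subset_left)
  refine ⟨Real.exp (-M), Real.exp_pos _, fun z hz hlt => ?_⟩
  by_contra hn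
  have h1 := hM z ⟨subset_closure hz, by simpa using not_lt.mp hn⟩
  rw [hW.norm_eq z hz, Real.exp_lt_exp] at hlt
  have := le_abs_self (u z)
  rw [Real.norm_eq_abs] at h1
  linarith

lemma not_eventually_const (h : IsExteriorPotential Ω u G) (hW : IsExpPotential Ω u G W η R)
    {z : ℂ} (hz : z ∈ Ω) : ¬ ∀ᶠ w in 𝓝 z, W w = W z := by
  intro hc
  have ha : AnalyticOnNhd ℂ W Ω := (expPotential_differentiableOn hW).analyticOnNhd h.isOpen
  have heq : EqOn W (fun _ => W z) Ω :=
    ha.eqOn_of_preconnected_of_eventuallyEq analyticOnNhd_const h.isConnected.isPreconnected hz hc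
  obtain ⟨R₀, -, hR₀⟩ := h.exists_radius
  obtain ⟨w, hw1, hw2⟩ := ((h.tendsto_u_atTop.eventually_gt_atTop (u z)).and
    (tendsto_norm_cobounded_atTop.eventually_gt_atTop R₀)).exists
  have h4 := congrArg norm (heq (hR₀ w hw2))
  simp only at h4
  rw [hW.norm_eq _ (hR₀ w hw2), hW.norm_eq _ hz, Real.exp_eq_exp] at h4
  linarith

lemma nhds_le_map (h : IsExteriorPotential Ω u G) (hW : IsExpPotential Ω u G W η R)
    {z : ℂ} (hz : z ∈ Ω) : 𝓝 (W z) ≤ map W (𝓝 z) :=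
  (((expPotential_differentiableOn hW).analyticAt
    (h.isOpen.mem_nhds hz)).eventually_constant_or_nhds_le_map_nhds).resolve_left
      (h.not_eventually_const hW hz)

/-- Continuity method in the level: `W` is injective where it is small because of its simple zero at
infinity. If the supremum `T` of the good levels were below `1`, compactness would produce a failure
exactly at `|W| = T`, and an open-mapping argument would push it down to `|W| < T`. -/
lemma injOn (h : IsExteriorPotential Ω u G) (hW : IsExpPotential Ω u G W η R) : InjOn W Ω := by
  have hlt1 : ∀ z ∈ Ω, ‖W z‖ < 1 := fun z hz => by
    rw [hW.norm_eq z hz, Real.exp_lt_one_iff]; linarith [h.pos hW hz]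
  set S : Set ℝ := {t | t ≤ 1 ∧ InjOn W {z | z ∈ Ω ∧ ‖W z‖ < t}} with hS
  -- `W` is injective near infinity
  obtain ⟨t₀, ht₀, ht₀S⟩ : ∃ t > 0, t ∈ S := by
    have hstrict := hW.analyticAt.hasStrictDerivAt
    obtain ⟨V, hV, hinj⟩ : ∃ V ∈ 𝓝 (0 : ℂ), InjOn η V := by
      have := (hstrict.hasStrictFDerivAt_equiv hW.deriv_ne_zero).eventually_left_inverse
      refine ⟨_, this, fun x hx y hy hxy => ?_⟩
      have hx' : _ = x := hx
      have hy' : _ = y := hy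
      rw [← hx', ← hy', hxy]
    obtain ⟨δ, hδ, hball⟩ := Metric.mem_nhds_iff.mp hV
    obtain ⟨t, ht, hfar⟩ := h.exists_norm_lt_imp_far hW (max (max R (1 / δ)) 0)
    refine ⟨min t 1, lt_min ht one_pos, min_le_right _ _, fun x hx y hy hxy => ?_⟩
    have key : ∀ z ∈ Ω, ‖W z‖ < min t 1 → z⁻¹ ∈ V ∧ W z = η z⁻¹ := by
      intro z hz hzt
      have h1 := hfar z hz (hzt.trans_le (min_le_left _ _))
      have hpos : 0 < ‖z‖ := (le_max_right _ _).trans_lt h1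
      refine ⟨hball ?_, (hW.eq_near_infinity z
        (((le_max_left _ _).trans (le_max_left _ _)).trans_lt h1)).2⟩
      rw [mem_ball_zero_iff, norm_inv, inv_lt_comm₀ hpos hδ, ← one_div]
      exact ((le_max_right _ _).trans (le_max_left _ _)).trans_lt h1
    obtain ⟨hxV, hx'⟩ := key x hx.1 hx.2
    obtain ⟨hyV, hy'⟩ := key y hy.1 hy.2
    exact inv_injective (hinj hxV hyV (by rw [← hx', ← hy', hxy]))
  have hbdd : BddAbove S := ⟨1, fun t ht => ht.1⟩
  set T := sSup S with hT
  have hTpos : 0 < T := ht₀.trans_le (le_csSup hbdd ht₀S)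
  have hT1 : T ≤ 1 := csSup_le ⟨t₀, ht₀S⟩ fun t ht => ht.1
  have hTinj : InjOn W {z | z ∈ Ω ∧ ‖W z‖ < T} := by
    intro x hx y hy hxy
    obtain ⟨t, htS, ht⟩ := exists_lt_of_lt_csSup ⟨t₀, ht₀S⟩ (max_lt hx.2 hy.2)
    exact htS.2 ⟨hx.1, (le_max_left _ _).trans_lt ht⟩ ⟨hy.1, (le_max_right _ _).trans_lt ht⟩ hxy
  suffices hT' : T = 1 by
    intro x hx y hy hxy
    exact hTinj ⟨hx, hT' ▸ hlt1 x hx⟩ ⟨hy, hT' ▸ hlt1 y hy⟩ hxy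
  by_contra hne
  have hTlt : T < 1 := lt_of_le_of_ne hT1 hne
  -- two sequences of distinct points with the same image, just beyond the level `T`
  have hseq : ∀ n : ℕ, ∃ x y, x ∈ Ω ∧ y ∈ Ω ∧ x ≠ y ∧ W x = W y ∧
      ‖W x‖ < T + (1 - T) / 2 * (1 / ((n : ℝ) + 1)) := by
    intro n
    -- These levels decrease to `T` and stay below `(1 + T) / 2 < 1`, so the points remain in a
    -- compact band of `Ω`.
    set t := T + (1 - T) / 2 * (1 / ((n : ℝ) + 1)) with ht
    have hn1 : 1 / ((n : ℝ) + 1) ≤ 1 := by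
      rw [div_le_one (by positivity)]; linarith [n.cast_nonneg (α := ℝ)]
    have htT : T < t := by
      have : 0 < (1 - T) / 2 * (1 / ((n : ℝ) + 1)) := by
        have : 0 < 1 - T := by linarith
        positivity
      linarith
    have htS : t ∉ S := fun hmem => absurd (le_csSup hbdd hmem) (not_le.mpr htT)
    have ht1 : t ≤ 1 := by nlinarith
    have hninj : ¬ InjOn W {z | z ∈ Ω ∧ ‖W z‖ < t} := fun hi => htS ⟨ht1, hi⟩
    simp only [InjOn, not_forall] at hninj
    obtain ⟨x, hx, y, hy, hxy, hne⟩ := hninj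
    exact ⟨x, y, hx.1, hy.1, hne, hxy, hx.2⟩
  choose x y hxΩ hyΩ hxyne hxyW hxt using hseq
  have hge : ∀ n, T ≤ ‖W (x n)‖ := by
    intro n
    by_contra hlt
    rw [not_le] at hlt
    exact hxyne n (hTinj ⟨hxΩ n, hlt⟩ ⟨hyΩ n, hxyW n ▸ hlt⟩ (hxyW n))
  have hle : ∀ n, ‖W (x n)‖ ≤ (1 + T) / 2 := by
    intro n
    refine (hxt n).le.trans ?_
    have hn1 : 1 / ((n : ℝ) + 1) ≤ 1 := by
      rw [div_le_one (by positivity)]; linarith [n.cast_nonneg (α := ℝ)]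
    nlinarith
  have hAc := h.isCompact_between hW hTpos (b := (1 + T) / 2) (by linarith)
  obtain ⟨⟨a, b⟩, ⟨ha, hb⟩, φ, hφ, hlim⟩ := (hAc.prod hAc).tendsto_subseq
    (x := fun n => (x n, y n)) fun n => ⟨⟨hxΩ n, hge n, hle n⟩, hyΩ n, hxyW n ▸ hge n,
      hxyW n ▸ hle n⟩
  have hxlim : Tendsto (fun n => x (φ n)) atTop (𝓝 a) := (continuous_fst.tendsto _).comp hlim
  have hylim : Tendsto (fun n => y (φ n)) atTop (𝓝 b) := (continuous_snd.tendsto _).comp hlim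
  have hWc : ∀ z ∈ Ω, ContinuousAt W z := fun z hz => (hW.hasDerivAt z hz).continuousAt
  have hWa := (hWc a ha.1).tendsto.comp hxlim
  have hWb := (hWc b hb.1).tendsto.comp hylim
  have hab : W a = W b := by
    refine tendsto_nhds_unique hWa (hWb.congr fun n => ?_)
    simp only [Function.comp]
    exact (hxyW _).symm
  have haT : ‖W a‖ = T := by
    refine le_antisymm ?_ ha.2.1
    have h1 : Tendsto (fun n : ℕ => T + (1 - T) / 2 * (1 / ((φ n : ℝ) + 1))) atTop
        (𝓝 (T + (1 - T) / 2 * 0)) :=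
      tendsto_const_nhds.add ((tendsto_one_div_add_atTop_nhds_zero_nat.comp
        hφ.tendsto_atTop).const_mul _)
    rw [mul_zero, add_zero] at h1
    exact le_of_tendsto_of_tendsto' hWa.norm h1 fun n => (hxt _).le
  by_cases hab' : a = b
  · subst hab'
    by_cases hd : deriv W a = 0
    · have hv : -W a ≠ 0 := neg_ne_zero.mpr (expPotential_ne_zero hW ha.1)
      have := exists_ne_map_eq_of_deriv_eq_zero ((expPotential_differentiableOn hW).analyticAt
        (h.isOpen.mem_nhds ha.1)) (h.not_eventually_const hW ha.1) hd hv (h.isOpen.mem_nhds ha.1)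
      obtain ⟨τ, ⟨z₁, hz₁, z₂, hz₂, hne, h1, h2⟩, hτ0, hτ1⟩ := (this.and
        (Ioo_mem_nhdsGT (zero_lt_one' ℝ))).exists
      have hn : ‖W a + τ * -W a‖ < T := by
        rw [show W a + τ * -W a = ((1 - τ : ℝ) : ℂ) * W a by push_cast; ring, norm_mul, haT,
          Complex.norm_real, Real.norm_of_nonneg (by linarith)]
        nlinarith
      exact hne (hTinj ⟨hz₁, by rw [h1]; exact hn⟩ ⟨hz₂, by rw [h2]; exact hn⟩ (h1.trans h2.symm))
    · have hstrict := ((expPotential_differentiableOn hW).analyticAt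
        (h.isOpen.mem_nhds ha.1)).hasStrictDerivAt
      have hli := (hstrict.hasStrictFDerivAt_equiv hd).eventually_left_inverse
      obtain ⟨n, hn1, hn2⟩ := ((hxlim.eventually hli).and (hylim.eventually hli)).exists
      refine hxyne (φ n) ?_
      rw [← hn1, ← hn2, hxyW]
  -- For distinct limit points, `W` maps disjoint neighbourhoods onto neighbourhoods of the same
  -- value. These share a value of modulus below `T`, which is then taken twice.
  · obtain ⟨V, V', hV, hV', haV, hbV', hdisj⟩ := t2_separation hab'
    have h1 := h.nhds_le_map hW ha.1 (image_mem_map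
      (inter_mem (hV.mem_nhds haV) (h.isOpen.mem_nhds ha.1)))
    have h2 := h.nhds_le_map hW hb.1 (image_mem_map
      (inter_mem (hV'.mem_nhds hbV') (h.isOpen.mem_nhds hb.1)))
    rw [← hab] at h2
    have h3 : ∃ᶠ w in 𝓝 (W a), ‖w‖ < T := by
      have hlim : Tendsto (fun τ : ℝ => ((1 - τ : ℝ) : ℂ) * W a) (𝓝[>] 0) (𝓝 (W a)) := by
        have : Continuous fun τ : ℝ => ((1 - τ : ℝ) : ℂ) * W a := by fun_prop
        have := this.tendsto 0
        simp only [sub_zero, Complex.ofReal_one, one_mul] at this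
        exact this.mono_left nhdsWithin_le_nhds
      refine hlim.frequently (Eventually.frequently ?_)
      filter_upwards [Ioo_mem_nhdsGT (zero_lt_one' ℝ)] with τ hτ
      rw [norm_mul, haT, Complex.norm_real, Real.norm_of_nonneg (by linarith [hτ.2])]
      nlinarith [hτ.1]
    obtain ⟨w, hwT, ⟨z₁, hz₁, hz₁w⟩, z₂, hz₂, hz₂w⟩ := (h3.and_eventually
      (Filter.inter_mem h1 h2)).exists
    have : z₁ = z₂ := hTinj ⟨hz₁.2, by rw [hz₁w]; exact hwT⟩ ⟨hz₂.2, by rw [hz₂w]; exact hwT⟩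
      (hz₁w.trans hz₂w.symm)
    subst this
    exact disjoint_left.mp hdisj hz₁.1 hz₂.1

end

end IsExteriorPotential

end

/-! ### The conformal map from the punctured disc onto `Ω` -/

section

/-- `φ` is the inverse of the conformal map `W` of the exterior domain `Ω` onto the punctured unit
disc, with `φ ζ ∼ a / ζ` at `0`. -/
structure IsExteriorMap (Ω : Set ℂ) (u : ℂ → ℝ) (G W φ : ℂ → ℂ) (a : ℂ) : Prop where
  hasDerivAt_W : ∀ z ∈ Ω, HasDerivAt W (-G z * W z) z
  norm_W : ∀ z ∈ Ω, ‖W z‖ = Real.exp (-u z)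
  u_pos : ∀ z ∈ Ω, 0 < u z
  G_ne_zero : ∀ z ∈ Ω, G z ≠ 0
  mapsTo : ∀ ζ, ζ ≠ 0 → ‖ζ‖ < 1 → φ ζ ∈ Ω
  W_φ : ∀ ζ, ζ ≠ 0 → ‖ζ‖ < 1 → W (φ ζ) = ζ
  φ_W : ∀ z ∈ Ω, φ (W z) = z
  hasDerivAt_φ : ∀ ζ, ζ ≠ 0 → ‖ζ‖ < 1 → HasDerivAt φ (-1 / (ζ * G (φ ζ))) ζ
  a_ne_zero : a ≠ 0
  tendsto_zero : Tendsto (fun ζ => ζ * φ ζ) (𝓝[≠] 0) (𝓝 a)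

namespace IsExteriorPotential

variable {Ω : Set ℂ} {u : ℂ → ℝ} {G W η : ℂ → ℂ} {R : ℝ}

lemma norm_W_mem (h : IsExteriorPotential Ω u G) (hW : IsExpPotential Ω u G W η R) {z : ℂ}
    (hz : z ∈ Ω) : ‖W z‖ ∈ Ioo (0 : ℝ) 1 := by
  rw [hW.norm_eq z hz]
  exact ⟨Real.exp_pos _, by rw [Real.exp_lt_one_iff]; linarith [h.pos hW hz]⟩

/-- The image is open, and `isCompact_between` makes it relatively closed in the connected punctured
disc. -/
lemma image_eq (h : IsExteriorPotential Ω u G) (hW : IsExpPotential Ω u G W η R) :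
    W '' Ω = {w | ‖w‖ ∈ Ioo (0 : ℝ) 1} := by
  refine Subset.antisymm ?_ ?_
  · rintro _ ⟨z, hz, rfl⟩
    exact h.norm_W_mem hW hz
  · have hopen : IsOpen (W '' Ω) := by
      rw [isOpen_iff_mem_nhds]
      rintro _ ⟨z, hz, rfl⟩
      exact h.nhds_le_map hW hz (image_mem_map (h.isOpen.mem_nhds hz))
    refine isPreconnected_puncturedDisc.subset_of_closure_inter_subset hopen ?_ ?_
    · obtain ⟨z, hz⟩ := h.isConnected.nonempty
      exact ⟨W z, h.norm_W_mem hW hz, z, hz, rfl⟩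
    · rintro w ⟨hw, hw0, hw1⟩
      obtain ⟨x, hx, hlim⟩ := mem_closure_iff_seq_limit.mp hw
      choose z hz hzx using hx
      have hev : ∀ᶠ n in atTop, ‖x n‖ ∈ Icc (‖w‖ / 2) ((‖w‖ + 1) / 2) :=
        hlim.norm.eventually (Icc_mem_nhds (by linarith) (by linarith))
      have hcomp := h.isCompact_between hW (a := ‖w‖ / 2) (b := (‖w‖ + 1) / 2)
        (by linarith) (by linarith)
      obtain ⟨z₀, hz₀, ψ, hψ, hlimz⟩ := hcomp.tendsto_subseq' (x := z)
        (hev.mono fun n hn => (⟨hz n, by rw [hzx]; exact hn⟩ : z n ∈ Ω ∧ _)).frequently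
      have h1 := ((hW.hasDerivAt z₀ hz₀.1).continuousAt.tendsto.comp hlimz)
      have h2 : Tendsto (W ∘ (z ∘ ψ)) atTop (𝓝 w) :=
        (hlim.comp hψ.tendsto_atTop).congr fun n => by simp [hzx]
      exact ⟨z₀, hz₀.1, tendsto_nhds_unique h1 h2⟩

/-- A zero of `G` is a critical point of `W`, where injectivity would fail. -/
lemma gradient_ne_zero (h : IsExteriorPotential Ω u G) (hW : IsExpPotential Ω u G W η R) {z : ℂ}
    (hz : z ∈ Ω) : G z ≠ 0 := by
  intro h0
  have hd : deriv W z = 0 := by rw [(hW.hasDerivAt z hz).deriv, h0]; simp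
  obtain ⟨τ, z₁, hz₁, z₂, hz₂, hne, h1, h2⟩ := (exists_ne_map_eq_of_deriv_eq_zero
    ((expPotential_differentiableOn hW).analyticAt (h.isOpen.mem_nhds hz))
    (h.not_eventually_const hW hz) hd one_ne_zero (h.isOpen.mem_nhds hz)).exists
  exact hne (h.injOn hW hz₁ hz₂ (h1.trans h2.symm))

/-- The **conformal map** of the exterior domain. -/
theorem exists_exteriorMap (h : IsExteriorPotential Ω u G) :
    ∃ W φ a, IsExteriorMap Ω u G W φ a := by
  obtain ⟨W, hW1, hW2, η, R, h3, h4, h5, h6⟩ := h.exists_exp_potential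
  have hW : IsExpPotential Ω u G W η R := ⟨hW1, hW2, h3, h4, h5, h6⟩
  have hinj := h.injOn hW
  have himg := h.image_eq hW
  set φ := Function.invFunOn W Ω with hφ
  have hmem : ∀ ζ, ζ ≠ 0 → ‖ζ‖ < 1 → ζ ∈ W '' Ω := fun ζ h0 h1 => by
    rw [himg]; exact ⟨norm_pos_iff.mpr h0, h1⟩
  have hmaps : ∀ ζ, ζ ≠ 0 → ‖ζ‖ < 1 → φ ζ ∈ Ω := fun ζ h0 h1 =>
    Function.invFunOn_mem (hmem ζ h0 h1)
  have hWφ : ∀ ζ, ζ ≠ 0 → ‖ζ‖ < 1 → W (φ ζ) = ζ := fun ζ h0 h1 =>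
    Function.invFunOn_eq (hmem ζ h0 h1)
  have hφW : ∀ z ∈ Ω, φ (W z) = z := fun z hz => hinj.leftInvOn_invFunOn hz
  have hnhd : ∀ ζ, ζ ≠ 0 → ‖ζ‖ < 1 → ∀ᶠ w : ℂ in 𝓝 ζ, w ≠ 0 ∧ ‖w‖ < 1 := fun ζ h0 h1 =>
    (eventually_ne_nhds h0).and ((isOpen_lt continuous_norm continuous_const).mem_nhds h1)
  have hcont : ∀ ζ, ζ ≠ 0 → ‖ζ‖ < 1 → ContinuousAt φ ζ := by
    intro ζ h0 h1 V hV
    have hz := hmaps ζ h0 h1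
    have h2 := h.nhds_le_map hW hz (image_mem_map (inter_mem hV (h.isOpen.mem_nhds hz)))
    rw [hWφ ζ h0 h1] at h2
    change φ ⁻¹' V ∈ 𝓝 ζ
    refine mem_of_superset h2 ?_
    rintro _ ⟨z, ⟨hzV, hzΩ⟩, rfl⟩
    change φ (W z) ∈ V
    rwa [hφW z hzΩ]
  have hderiv : ∀ ζ, ζ ≠ 0 → ‖ζ‖ < 1 → HasDerivAt φ (-1 / (ζ * G (φ ζ))) ζ := by
    intro ζ h0 h1
    have hz := hmaps ζ h0 h1
    have hG := h.gradient_ne_zero hW hz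
    have hd := hW1 _ hz
    rw [hWφ ζ h0 h1] at hd
    have h2 := HasDerivAt.of_local_left_inverse (hcont ζ h0 h1) hd
      (mul_ne_zero (neg_ne_zero.mpr hG) h0)
      ((hnhd ζ h0 h1).mono fun w hw => hWφ w hw.1 hw.2)
    convert! h2 using 1
    field_simp
  refine ⟨W, φ, deriv η 0, hW1, hW2, fun z hz => h.pos hW hz,
    fun z hz => h.gradient_ne_zero hW hz, hmaps, hWφ, hφW, hderiv, h5, ?_⟩
  have hfar : Tendsto φ (𝓝[≠] 0) (Bornology.cobounded ℂ) := by
    rw [← tendsto_norm_atTop_iff_cobounded, tendsto_atTop]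
    intro ρ
    obtain ⟨t, ht, htρ⟩ := h.exists_norm_lt_imp_far hW ρ
    have hev : ∀ᶠ ζ : ℂ in 𝓝[≠] 0, ‖ζ‖ < min t 1 := by
      refine nhdsWithin_le_nhds ?_
      have := Metric.ball_mem_nhds (0 : ℂ) (lt_min ht one_pos)
      filter_upwards [this] with ζ hζ
      simpa using hζ
    filter_upwards [hev, self_mem_nhdsWithin] with ζ hζ h0
    have h1 : ‖ζ‖ < 1 := hζ.trans_le (min_le_right _ _)
    refine (htρ _ (hmaps ζ h0 h1) ?_).le
    rw [hWφ ζ h0 h1]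
    exact hζ.trans_le (min_le_left _ _)
  -- Since `η 0 = 0`, this is the difference quotient of `η` at `0`. Substituting `z = φ ζ`, where
  -- `η z⁻¹ = ζ`, gives the limit of `ζ φ ζ`.
  have hslope : Tendsto (fun z : ℂ => η z⁻¹ * z) (Bornology.cobounded ℂ) (𝓝 (deriv η 0)) := by
    have h7 : HasDerivAt η (deriv η 0) 0 := h3.differentiableAt.hasDerivAt
    rw [hasDerivAt_iff_tendsto_slope_zero] at h7
    have h8 : Tendsto (fun z : ℂ => z⁻¹) (Bornology.cobounded ℂ) (𝓝[≠] 0) :=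
      tendsto_inv₀_cobounded'
    refine (h7.comp h8).congr fun z => ?_
    simp [h4, mul_comm]
  refine (hslope.comp hfar).congr' ?_
  have hRev : ∀ᶠ ζ in 𝓝[≠] (0 : ℂ), R < ‖φ ζ‖ :=
    hfar.eventually (tendsto_norm_cobounded_atTop.eventually_gt_atTop R)
  have h1ev : ∀ᶠ ζ : ℂ in 𝓝[≠] 0, ‖ζ‖ < 1 := by
    refine nhdsWithin_le_nhds ?_
    filter_upwards [Metric.ball_mem_nhds (0 : ℂ) one_pos] with ζ hζ
    simpa using hζ
  filter_upwards [hRev, h1ev, self_mem_nhdsWithin] with ζ hζ h1 h0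
  simp only [Function.comp]
  rw [← (h6 _ hζ).2, hWφ ζ h0 h1]

end IsExteriorPotential

end

/-! ### Geometry of smooth Jordan curves: chord-arc bound, tangent discs, Hopf lemma -/

section

namespace IsJordanParam

variable {γ : ℝ → ℂ} {C : Set ℂ}

lemma two_pi_pos : (0 : ℝ) < 2 * π := by positivity

lemma contDiff_deriv (h : IsJordanParam γ C) : ContDiff ℝ ∞ (deriv γ) :=
  (contDiff_infty_iff_deriv.mp h.smooth).2

lemma hasDerivAt (h : IsJordanParam γ C) (t : ℝ) : HasDerivAt γ (deriv γ t) t :=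
  ((contDiff_infty_iff_deriv.mp h.smooth).1 t).hasDerivAt

lemma hasDerivAt_deriv (h : IsJordanParam γ C) (t : ℝ) :
    HasDerivAt (deriv γ) (deriv (deriv γ) t) t :=
  ((contDiff_infty_iff_deriv.mp h.contDiff_deriv).1 t).hasDerivAt

lemma continuous (h : IsJordanParam γ C) : Continuous γ := h.smooth.continuous

lemma continuous_deriv (h : IsJordanParam γ C) : Continuous (deriv γ) := h.contDiff_deriv.continuous

lemma periodic_deriv (h : IsJordanParam γ C) : Function.Periodic (deriv γ) (2 * π) := by
  intro t
  have h1 : (fun x => γ (x + 2 * π)) = γ := funext h.periodic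
  rw [← deriv_comp_add_const, h1]

lemma eq_iff (h : IsJordanParam γ C) {s t : ℝ} (hst : γ s = γ t) :
    ∃ n : ℤ, s = t + n * (2 * π) := by
  obtain ⟨s', hs', hs⟩ := h.periodic.exists_mem_Ico₀ two_pi_pos s
  obtain ⟨t', ht', ht⟩ := h.periodic.exists_mem_Ico₀ two_pi_pos t
  have h1 : toIcoMod two_pi_pos 0 s = toIcoMod two_pi_pos 0 t := by
    refine h.injOn ?_ ?_ ?_
    · simpa using toIcoMod_mem_Ico two_pi_pos 0 s
    · simpa using toIcoMod_mem_Ico two_pi_pos 0 t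
    · rw [toIcoMod, toIcoMod, h.periodic.sub_zsmul_eq, h.periodic.sub_zsmul_eq, hst]
  rw [toIcoMod, toIcoMod, zsmul_eq_mul, zsmul_eq_mul] at h1
  refine ⟨toIcoDiv two_pi_pos 0 s - toIcoDiv two_pi_pos 0 t, ?_⟩
  push_cast
  linear_combination h1

lemma exists_norm_deriv_ge (h : IsJordanParam γ C) : ∃ m > 0, ∀ t, m ≤ ‖deriv γ t‖ := by
  obtain ⟨t₀, -, ht₀⟩ := (isCompact_Icc (a := (0 : ℝ)) (b := 2 * π)).exists_isMinOn
    (nonempty_Icc.mpr two_pi_pos.le) h.continuous_deriv.norm.continuousOn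
  refine ⟨‖deriv γ t₀‖, norm_pos_iff.mpr (h.regular t₀), fun t => ?_⟩
  obtain ⟨t', ht', he⟩ := h.periodic_deriv.exists_mem_Ico₀ two_pi_pos t
  rw [he]
  exact ht₀ (Ico_subset_Icc_self ht')

/-- The Taylor estimate of second order, uniformly along the curve. -/
lemma exists_taylor_bound (h : IsJordanParam γ C) :
    ∃ M > 0, ∀ s t, ‖γ s - γ t - (s - t) • deriv γ t‖ ≤ M * |s - t| ^ 2 := by
  have hper2 : Function.Periodic (deriv (deriv γ)) (2 * π) := by
    intro t
    have h1 : (fun x => deriv γ (x + 2 * π)) = deriv γ := funext h.periodic_deriv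
    rw [← deriv_comp_add_const, h1]
  have hc2 : Continuous (deriv (deriv γ)) :=
    (contDiff_infty_iff_deriv.mp h.contDiff_deriv).2.continuous
  obtain ⟨M, hM⟩ := (isCompact_Icc (a := (0 : ℝ)) (b := 2 * π)).exists_bound_of_continuousOn
    hc2.continuousOn
  have hM' : ∀ t, ‖deriv (deriv γ) t‖ ≤ max M 1 := by
    intro t
    obtain ⟨t', ht', he⟩ := hper2.exists_mem_Ico₀ two_pi_pos t
    rw [he]
    exact (hM t' (Ico_subset_Icc_self ht')).trans (le_max_left _ _)
  refine ⟨max M 1, by positivity, fun s t => ?_⟩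
  have hlip : ∀ x y, ‖deriv γ x - deriv γ y‖ ≤ max M 1 * |x - y| := by
    intro x y
    have := convex_univ.norm_image_sub_le_of_norm_hasDerivWithin_le
      (f := deriv γ) (f' := deriv (deriv γ)) (fun z _ => (h.hasDerivAt_deriv z).hasDerivWithinAt)
      (fun z _ => hM' z) (mem_univ y) (mem_univ x)
    simpa using this
  have hd : ∀ x ∈ uIcc t s, HasDerivWithinAt (fun x => γ x - γ t - (x - t) • deriv γ t)
      (deriv γ x - deriv γ t) (uIcc t s) x := by
    intro x _
    have h1 := ((h.hasDerivAt x).sub_const (γ t)).fun_sub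
      (((hasDerivAt_id x).sub_const t).smul_const (deriv γ t))
    simpa using h1.hasDerivWithinAt
  have := (convex_uIcc t s).norm_image_sub_le_of_norm_hasDerivWithin_le hd
    (C := max M 1 * |s - t|) (fun x hx => (hlip x t).trans
      (mul_le_mul_of_nonneg_left (abs_sub_left_of_mem_uIcc hx) (by positivity))) left_mem_uIcc right_mem_uIcc
  simp only [sub_self, zero_smul, sub_zero] at this
  refine this.trans (le_of_eq ?_)
  rw [Real.norm_eq_abs]; ring

/-- The chord-arc estimate. -/
lemma exists_chord_arc (h : IsJordanParam γ C) :
    ∃ c > 0, ∀ s t, |s - t| ≤ π → c * |s - t| ≤ ‖γ s - γ t‖ := by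
  obtain ⟨m, hm, hm'⟩ := h.exists_norm_deriv_ge
  obtain ⟨M, hM, hM'⟩ := h.exists_taylor_bound
  -- For parameters this close, the quadratic Taylor error is at most half of the linear term.
  set η := m / (2 * M) with hη
  have hη0 : 0 < η := by positivity
  have hloc : ∀ s t, |s - t| ≤ η → m / 2 * |s - t| ≤ ‖γ s - γ t‖ := by
    intro s t hst
    have h1 := hM' s t
    have h2 : ‖(s - t) • deriv γ t‖ ≤ ‖γ s - γ t‖ + ‖γ s - γ t - (s - t) • deriv γ t‖ := by
      calc ‖(s - t) • deriv γ t‖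
          = ‖(γ s - γ t) - (γ s - γ t - (s - t) • deriv γ t)‖ := by congr 1; abel
        _ ≤ _ := norm_sub_le _ _
    rw [norm_smul, Real.norm_eq_abs] at h2
    have h3 : |s - t| * m ≤ |s - t| * ‖deriv γ t‖ := by gcongr; exact hm' t
    have h4 : M * |s - t| ^ 2 ≤ m / 2 * |s - t| := by
      have : M * |s - t| ≤ m / 2 := by
        calc M * |s - t| ≤ M * η := by gcongr
          _ = m / 2 := by rw [hη]; field_simp
      nlinarith [abs_nonneg (s - t)]
    linarith
  -- For the remaining pairs the chord has a positive minimum, by injectivity modulo the period.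
  -- Confining the second parameter to one period makes the set compact.
  set Q : Set (ℝ × ℝ) := {x | x.2 ∈ Icc 0 (2 * π) ∧ η ≤ |x.1 - x.2| ∧ |x.1 - x.2| ≤ π} with hQ
  have hQc : IsCompact Q := by
    refine Metric.isCompact_of_isClosed_isBounded ?_ ?_
    · have h1 : IsClosed {x : ℝ × ℝ | x.2 ∈ Icc 0 (2 * π)} :=
        isClosed_Icc.preimage continuous_snd
      have h2 : IsClosed {x : ℝ × ℝ | η ≤ |x.1 - x.2|} :=
        isClosed_le continuous_const (by fun_prop)
      have h3 : IsClosed {x : ℝ × ℝ | |x.1 - x.2| ≤ π} :=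
        isClosed_le (by fun_prop) continuous_const
      exact h1.inter (h2.inter h3)
    · refine ((Metric.isBounded_Icc (-π) (3 * π)).prod (Metric.isBounded_Icc 0 (2 * π))).subset ?_
      rintro ⟨s, t⟩ ⟨h1, -, h3⟩
      simp only at h1 h3
      rw [abs_le] at h3
      exact ⟨⟨by linarith [h1.1], by linarith [h1.2]⟩, h1⟩
  obtain ⟨c₂, hc₂, hc₂'⟩ : ∃ c > 0, ∀ x ∈ Q, c ≤ ‖γ x.1 - γ x.2‖ := by
    rcases Q.eq_empty_or_nonempty with hem | hne
    · exact ⟨1, one_pos, fun x hx => by simp [hem] at hx⟩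
    · have hcont : Continuous fun x : ℝ × ℝ => ‖γ x.1 - γ x.2‖ := by
        have := h.continuous; fun_prop
      obtain ⟨x₀, hx₀, hmin⟩ := hQc.exists_isMinOn hne hcont.continuousOn
      refine ⟨_, norm_pos_iff.mpr ?_, fun x hx => hmin hx⟩
      intro h0
      obtain ⟨n, hn⟩ := h.eq_iff (sub_eq_zero.mp h0)
      have h1 := hx₀.2.1
      have h2 := hx₀.2.2
      have h3 : x₀.1 - x₀.2 = n * (2 * π) := by linarith
      rw [h3, abs_mul, abs_of_pos two_pi_pos] at h1 h2
      rcases eq_or_ne n 0 with rfl | hn0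
      · simp at h1; linarith
      · have : (1 : ℝ) ≤ |(n : ℝ)| := by exact_mod_cast Int.one_le_abs hn0
        nlinarith [pi_pos]
  refine ⟨min (m / 2) (c₂ / π), by positivity, fun s t hst => ?_⟩
  rcases le_or_gt |s - t| η with hle | hgt
  · exact (mul_le_mul_of_nonneg_right (min_le_left _ _) (abs_nonneg _)).trans (hloc s t hle)
  · set k := toIcoDiv two_pi_pos 0 t with hk
    have ht' : t - k * (2 * π) ∈ Icc 0 (2 * π) := by
      have := toIcoMod_mem_Ico two_pi_pos 0 t
      rw [toIcoMod, zsmul_eq_mul, zero_add] at this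
      exact Ico_subset_Icc_self this
    have e1 : (s - k * (2 * π)) - (t - k * (2 * π)) = s - t := by ring
    have h1 := hc₂' (s - k * (2 * π), t - k * (2 * π)) ⟨ht', by rw [e1]; exact hgt.le, by rwa [e1]⟩
    simp only [h.periodic.sub_int_mul_eq] at h1
    refine le_trans ?_ h1
    calc min (m / 2) (c₂ / π) * |s - t| ≤ c₂ / π * π := by
          gcongr; exact min_le_right _ _
      _ = c₂ := by field_simp

lemma exists_near_rep (h : IsJordanParam γ C) (s t : ℝ) : ∃ s', γ s' = γ s ∧ |s' - t| ≤ π := by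
  refine ⟨toIcoMod two_pi_pos (t - π) s, ?_, ?_⟩
  · rw [toIcoMod, h.periodic.sub_zsmul_eq]
  · have := toIcoMod_mem_Ico two_pi_pos (t - π) s
    rw [abs_le]
    constructor <;> linarith [this.1, this.2]

lemma norm_normal (h : IsJordanParam γ C) (t : ℝ) : ‖normal γ t‖ = 1 := by
  have := norm_pos_iff.mpr (h.regular t)
  rw [normal, norm_mul, norm_div, Complex.norm_real, norm_norm, norm_neg, Complex.norm_I, one_mul,
    div_self this.ne']

lemma inner_deriv_normal (t : ℝ) : inner ℝ (deriv γ t) (normal γ t) = 0 := by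
  rw [Complex.inner, normal, show -Complex.I * (deriv γ t / ‖deriv γ t‖) * conj (deriv γ t)
    = ((‖deriv γ t‖ ^ 2 / ‖deriv γ t‖ : ℝ) : ℂ) * -Complex.I by
      push_cast; rw [← Complex.conj_mul']; ring]
  rw [Complex.re_ofReal_mul]
  simp

lemma continuous_normal (h : IsJordanParam γ C) : Continuous (normal γ) := by
  have := h.continuous_deriv
  refine continuous_const.mul (this.div (Complex.continuous_ofReal.comp this.norm) fun t => ?_)
  exact_mod_cast norm_ne_zero_iff.mpr (h.regular t)

/-- Both tangent discs of a small radius avoid the curve. -/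
lemma exists_tangent_disc (h : IsJordanParam γ C) :
    ∃ δ > 0, ∀ σ : ℝ, |σ| = 1 → ∀ t, Disjoint (Metric.ball (γ t + (σ * δ) • normal γ t) δ) C := by
  obtain ⟨M, hM, hM'⟩ := h.exists_taylor_bound
  obtain ⟨c, hc, hc'⟩ := h.exists_chord_arc
  -- In the squared distance from `γ s` to the centre, the linear term is at most `2 δ M |s - t|²`,
  -- while the squared chord is at least `c² |s - t|²`. This `δ` balances the two.
  refine ⟨c ^ 2 / (2 * M), by positivity, fun σ hσ t => ?_⟩
  set δ := c ^ 2 / (2 * M) with hδ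
  have hδ0 : 0 < δ := by positivity
  rw [disjoint_right]
  intro z hz hzball
  rw [← h.range_eq] at hz
  obtain ⟨s, rfl⟩ := hz
  obtain ⟨s', hs', hst⟩ := h.exists_near_rep s t
  rw [← hs', mem_ball_iff_norm, ← sub_sub] at hzball
  have h1 : ‖γ s' - γ t - (σ * δ) • normal γ t‖ ^ 2 =
      ‖γ s' - γ t‖ ^ 2 - 2 * (σ * δ) * inner ℝ (γ s' - γ t) (normal γ t) + δ ^ 2 := by
    have hσ2 : σ ^ 2 = 1 := by rw [← sq_abs, hσ, one_pow]
    rw [norm_sub_sq_real, inner_smul_right, norm_smul, h.norm_normal, mul_one, Real.norm_eq_abs,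
      sq_abs, mul_pow, hσ2]
    ring
  have h2 : |inner ℝ (γ s' - γ t) (normal γ t)| ≤ M * |s' - t| ^ 2 := by
    have e : inner ℝ (γ s' - γ t) (normal γ t) =
        inner ℝ (γ s' - γ t - (s' - t) • deriv γ t) (normal γ t) := by
      rw [inner_sub_left _ ((s' - t) • deriv γ t), real_inner_smul_left, inner_deriv_normal]; ring
    rw [e]
    refine (abs_real_inner_le_norm _ _).trans ?_
    rw [h.norm_normal, mul_one]
    exact hM' s' t
  have h3 := hc' s' t hst
  have h4 : c ^ 2 * |s' - t| ^ 2 ≤ ‖γ s' - γ t‖ ^ 2 := by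
    rw [← mul_pow]
    exact pow_le_pow_left₀ (by positivity) h3 2
  have h5 : |2 * (σ * δ) * inner ℝ (γ s' - γ t) (normal γ t)| ≤ c ^ 2 * |s' - t| ^ 2 := by
    rw [abs_mul, abs_mul, abs_mul, hσ, one_mul, abs_of_pos hδ0, abs_two]
    calc 2 * δ * |inner ℝ (γ s' - γ t) (normal γ t)| ≤ 2 * δ * (M * |s' - t| ^ 2) := by gcongr
      _ = c ^ 2 * |s' - t| ^ 2 := by rw [hδ]; field_simp
  have h6 := (abs_le.mp h5).2
  have h7 : ‖γ s' - γ t - (σ * δ) • normal γ t‖ ^ 2 < δ ^ 2 :=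
    pow_lt_pow_left₀ hzball (norm_nonneg _) two_ne_zero
  linarith

end IsJordanParam

/-- A connected set that misses the frontier of `Ω` but meets `Ω` lies in `Ω`. -/
lemma subset_of_disjoint_frontier {Ω s : Set ℂ} (hs : IsPreconnected s)
    (hd : Disjoint s (frontier Ω)) (hne : (s ∩ Ω).Nonempty) : s ⊆ Ω := by
  have hcover : s ⊆ interior Ω ∪ (closure Ω)ᶜ := by
    intro x hx
    by_cases hc : x ∈ closure Ω
    · by_contra hn
      exact disjoint_left.mp hd hx ⟨hc, fun h => hn (Or.inl h)⟩
    · exact Or.inr hc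
  refine (hs.subset_left_of_subset_union isOpen_interior isClosed_closure.isOpen_compl ?_ hcover
    ?_).trans interior_subset
  · exact disjoint_compl_right.mono_left (interior_subset.trans subset_closure)
  · obtain ⟨x, hx, hxΩ⟩ := hne
    exact ⟨x, hx, (hcover hx).resolve_right fun h => h (subset_closure hxΩ)⟩

/-- One of the two families of tangent discs lies in the domain. -/
lemma IsJordanParam.exists_tangent_disc_subset {Ω : Set ℂ} {γ : ℝ → ℂ} (hΩ : IsOpen Ω)
    (h : IsJordanParam γ (frontier Ω)) :
    ∃ δ > 0, ∃ σ : ℝ, |σ| = 1 ∧ ∀ t, Metric.ball (γ t + (σ * δ) • normal γ t) δ ⊆ Ω := by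
  obtain ⟨δ, hδ, hdisj⟩ := h.exists_tangent_disc
  refine ⟨δ, hδ, ?_⟩
  have hγ0 : γ 0 ∈ closure Ω := frontier_subset_closure (h.range_eq ▸ mem_range_self 0)
  obtain ⟨x, hxΩ, hx⟩ := Metric.mem_closure_iff.mp hγ0 δ hδ
  -- the point of the curve nearest to `x`
  obtain ⟨s, hs⟩ : ∃ s, ∀ t, ‖x - γ s‖ ≤ ‖x - γ t‖ := by
    obtain ⟨s, -, hmin⟩ := (isCompact_Icc (a := (0 : ℝ)) (b := 2 * π)).exists_isMinOn
      (f := fun t => ‖x - γ t‖) (nonempty_Icc.mpr two_pi_pos.le)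
      (continuous_const.sub h.continuous).norm.continuousOn
    refine ⟨s, fun t => ?_⟩
    obtain ⟨t', ht', he⟩ := h.periodic.exists_mem_Ico₀ two_pi_pos t
    rw [he]
    exact hmin (Ico_subset_Icc_self ht')
  have hd : ‖x - γ s‖ < δ := (hs 0).trans_lt (by rwa [← dist_eq_norm, dist_comm])
  have hdpos : 0 < ‖x - γ s‖ := by
    rw [norm_pos_iff, sub_ne_zero]
    rintro rfl
    have : γ s ∈ frontier Ω := h.range_eq ▸ mem_range_self s
    rw [hΩ.frontier_eq] at this
    exact this.2 hxΩ
  have horth : inner ℝ (x - γ s) (deriv γ s) = 0 := by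
    have h1 : HasDerivAt (fun t => ‖x - γ t‖ ^ 2) (2 * inner ℝ (x - γ s) (-deriv γ s)) s := by
      have := ((h.hasDerivAt s).const_sub x).norm_sq
      exact this
    have h2 : IsLocalMin (fun t => ‖x - γ t‖ ^ 2) s := Eventually.of_forall fun t =>
      pow_le_pow_left₀ (norm_nonneg _) (hs t) 2
    have h3 := h2.hasDerivAt_eq_zero h1
    rw [inner_neg_right] at h3
    linarith
  obtain ⟨l, hl⟩ : ∃ l : ℝ, x - γ s = l • normal γ s := by
    rw [Complex.inner] at horth
    have hne := norm_ne_zero_iff.mpr (h.regular s)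
    have hne' : (‖deriv γ s‖ : ℂ) ≠ 0 := by exact_mod_cast hne
    refine ⟨(deriv γ s * conj (x - γ s)).im * -(1 / ‖deriv γ s‖) * -1, ?_⟩
    set D := deriv γ s
    set y := x - γ s
    have e1 : D * conj y = ((D * conj y).im : ℂ) * Complex.I := by
      apply Complex.ext <;> simp [horth]
    have e2 : conj D * y = -((D * conj y).im : ℂ) * Complex.I := by
      have := congrArg conj e1
      simp only [map_mul, Complex.conj_conj, Complex.conj_ofReal, Complex.conj_I] at this
      rw [this]; ring
    have e3 : (‖D‖ : ℂ) ^ 2 = conj D * D := (Complex.conj_mul' D).symm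
    have hD : conj D ≠ 0 := by simpa using h.regular s
    apply mul_left_cancel₀ hD
    rw [e2, normal, Complex.real_smul]
    push_cast
    have e4 : conj D * (((D * conj y).im : ℂ) * -(1 / (‖D‖ : ℂ)) * -1 * (-Complex.I * (D / ‖D‖))) =
      -((D * conj y).im : ℂ) * Complex.I * ((conj D * D) / (‖D‖ : ℂ) ^ 2) := by ring
    rw [e4, e3, div_self (by rw [← e3]; exact pow_ne_zero 2 hne'), mul_one]
  have hlabs : |l| = ‖x - γ s‖ := by rw [hl, norm_smul, h.norm_normal, mul_one, Real.norm_eq_abs]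
  have hl0 : l ≠ 0 := by
    intro h0; rw [h0, abs_zero] at hlabs; linarith
  -- The vector from the nearest point `γ s` to `x` is normal to the curve. Its sign selects the
  -- side, and `x` then lies in the tangent disc at `γ s` on that side.
  set σ : ℝ := if 0 < l then 1 else -1 with hσ
  have hσ1 : |σ| = 1 := by rw [hσ]; split_ifs <;> simp
  have hlσ : l = σ * |l| := by
    rw [hσ]; split_ifs with h0
    · rw [abs_of_pos h0, one_mul]
    · rw [abs_of_nonpos (not_lt.mp h0)]; ring
  refine ⟨σ, hσ1, fun t => ?_⟩
  have hball : ∀ t, (Metric.ball (γ t + (σ * δ) • normal γ t) δ ∩ Ω).Nonempty →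
      Metric.ball (γ t + (σ * δ) • normal γ t) δ ⊆ Ω := fun t hne =>
    subset_of_disjoint_frontier (convex_ball _ _).isPreconnected (hdisj σ hσ1 t) hne
  have hcs : γ s + (σ * δ) • normal γ s ∈ Ω := by
    refine hball s ⟨x, ?_, hxΩ⟩ (Metric.mem_ball_self hδ)
    rw [mem_ball_iff_norm, show x - (γ s + (σ * δ) • normal γ s) = (σ * (|l| - δ)) • normal γ s by
      rw [← sub_sub, hl, ← sub_smul, mul_sub, ← hlσ], norm_smul, h.norm_normal, mul_one,
      Real.norm_eq_abs, abs_mul, hσ1, one_mul, abs_of_neg (by rw [hlabs]; linarith)]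
    linarith [abs_pos.mpr hl0]
  -- The centres form a connected set missing the frontier, so the side found at one point is the
  -- right one along the whole curve.
  have hpath : range (fun t => γ t + (σ * δ) • normal γ t) ⊆ Ω := by
    refine subset_of_disjoint_frontier (isPreconnected_range
      (by have := h.continuous; have := h.continuous_normal; fun_prop)) ?_ ⟨_, ⟨s, rfl⟩, hcs⟩
    rw [disjoint_left]
    rintro _ ⟨t, rfl⟩ hf
    exact disjoint_left.mp (hdisj σ hσ1 t) (Metric.mem_ball_self hδ) hf
  exact hball t ⟨_, Metric.mem_ball_self hδ, hpath ⟨t, rfl⟩⟩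

/-- The quantitative **Hopf lemma** in a disc, for `u = -log |W|`. -/
lemma exists_hopf_bound {W : ℂ → ℂ} {c : ℂ} {δ : ℝ} (hδ : 0 < δ)
    (hW : DifferentiableOn ℂ W (Metric.ball c δ)) (hW1 : ∀ z ∈ Metric.ball c δ, ‖W z‖ < 1) :
    ∃ N : ℕ, 0 < N ∧ ∀ z, δ / 2 ≤ ‖z - c‖ → ‖z - c‖ < δ → ‖W z‖ ^ N ≤ ‖z - c‖ / δ := by
  have hsub : Metric.sphere c (δ / 2) ⊆ Metric.ball c δ := fun z hz => by
    rw [mem_sphere_iff_norm] at hz; rw [mem_ball_iff_norm]; linarith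
  obtain ⟨z₁, hz₁, hmax⟩ := (isCompact_sphere c (δ / 2)).exists_isMaxOn
    (NormedSpace.sphere_nonempty.mpr (by positivity)) (hW.continuousOn.norm.mono hsub)
  obtain ⟨N, hN⟩ := exists_pow_lt_of_lt_one (show (0 : ℝ) < 1 / 2 by norm_num) (hW1 z₁ (hsub hz₁))
  have hN0 : 0 < N := by
    rcases Nat.eq_zero_or_pos N with rfl | h
    · norm_num at hN
    · exact h
  refine ⟨N, hN0, fun z hz1 hz2 => ?_⟩
  -- Maximum principle for `W ^ N · ρ / (w - c)` on the annulus `δ/2 < |w - c| < ρ`. On the inner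
  -- circle `|W| ^ N ≤ 1/2` beats the factor `ρ / (δ/2) ≤ 2`, and on the outer one `|W| < 1`. No
  -- boundary values of `W` are assumed, hence `ρ < δ` and a limit.
  have key : ∀ ρ, ‖z - c‖ < ρ → ρ < δ → ‖W z‖ ^ N * ρ ≤ ‖z - c‖ := by
    intro ρ hzρ hρδ
    have hρ0 : 0 < ρ := by linarith
    set A : Set ℂ := {w | δ / 2 < ‖w - c‖ ∧ ‖w - c‖ < ρ} with hA
    have hcn : Continuous fun w : ℂ => ‖w - c‖ := by fun_prop
    have hAo : IsOpen A := (isOpen_lt continuous_const hcn).inter (isOpen_lt hcn continuous_const)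
    have hAcl : closure A ⊆ {w | δ / 2 ≤ ‖w - c‖ ∧ ‖w - c‖ ≤ ρ} :=
      closure_minimal (fun w hw => ⟨hw.1.le, hw.2.le⟩)
        ((isClosed_le continuous_const hcn).inter (isClosed_le hcn continuous_const))
    have hAb : Bornology.IsBounded A := (Metric.isBounded_ball (x := c) (r := ρ)).subset
      fun w hw => by rw [mem_ball_iff_norm]; exact hw.2
    have hdiff : DifferentiableOn ℂ (fun w => W w ^ N * (ρ / (w - c))) (closure A) := by
      intro w hw
      have h1 := hAcl hw
      have h2 : w - c ≠ 0 := norm_pos_iff.mp (by linarith [h1.1])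
      have h3 : DifferentiableAt ℂ W w := hW.differentiableAt (Metric.isOpen_ball.mem_nhds
        (by rw [mem_ball_iff_norm]; linarith [h1.2]))
      exact ((h3.pow N).mul ((differentiableAt_const _).div (by fun_prop) h2)).differentiableWithinAt
    by_cases hzA : δ / 2 < ‖z - c‖
    · have hcl : DiffContOnCl ℂ (fun w => W w ^ N * (ρ / (w - c))) A := hdiff.diffContOnCl
      have hfr : ∀ w ∈ frontier A, ‖W w ^ N * (ρ / (w - c))‖ ≤ 1 := by
        intro w hw
        rw [hAo.frontier_eq] at hw
        obtain ⟨h1, h2⟩ := hAcl hw.1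
        have hpos : 0 < ‖w - c‖ := by linarith
        rw [norm_mul, norm_pow, norm_div, Complex.norm_real, Real.norm_of_nonneg hρ0.le]
        rcases h1.lt_or_eq with h3 | h3
        · rcases h2.lt_or_eq with h4 | h4
          · exact absurd ⟨h3, h4⟩ hw.2
          · rw [h4, div_self hρ0.ne', mul_one]
            exact pow_le_one₀ (norm_nonneg _) (hW1 w (by rw [mem_ball_iff_norm]; linarith)).le
        · have h5 : ‖W w‖ ≤ ‖W z₁‖ := hmax (by rw [mem_sphere_iff_norm]; exact h3.symm)
          have h6 : ‖W w‖ ^ N ≤ 1 / 2 := (pow_le_pow_left₀ (norm_nonneg _) h5 N).trans hN.le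
          rw [← h3]
          calc ‖W w‖ ^ N * (ρ / (δ / 2)) ≤ 1 / 2 * (δ / (δ / 2)) := by gcongr
            _ = 1 := by field_simp
      have := Complex.norm_le_of_forall_mem_frontier_norm_le hAb hcl hfr
        (subset_closure (⟨hzA, hzρ⟩ : z ∈ A))
      rw [norm_mul, norm_pow, norm_div, Complex.norm_real, Real.norm_of_nonneg hρ0.le,
        ← mul_div_assoc, div_le_one (by linarith)] at this
      exact this
    · have h3 : ‖z - c‖ = δ / 2 := le_antisymm (not_lt.mp hzA) hz1
      have h5 : ‖W z‖ ≤ ‖W z₁‖ := hmax (by rw [mem_sphere_iff_norm]; exact h3)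
      have h6 : ‖W z‖ ^ N ≤ 1 / 2 := (pow_le_pow_left₀ (norm_nonneg _) h5 N).trans hN.le
      rw [h3]
      calc ‖W z‖ ^ N * ρ ≤ 1 / 2 * δ := by gcongr
        _ = δ / 2 := by ring
  rw [le_div_iff₀ hδ]
  have ht : Tendsto (fun ρ : ℝ => ‖W z‖ ^ N * ρ) (𝓝[<] δ) (𝓝 (‖W z‖ ^ N * δ)) :=
    ((continuous_const.mul continuous_id).tendsto δ).mono_left nhdsWithin_le_nhds
  refine le_of_tendsto ht ?_
  filter_upwards [Ioo_mem_nhdsLT hz2] with ρ hρ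
  exact key ρ hρ.1 hρ.2

end

/-! ### Regularity up to the boundary and the normalized potential -/

section

/-- A boundary point lies in the closure of a tangent disc inside `Ω`, and a convex set with
interior points determines derivatives at every point of its closure. -/
lemma IsJordanParam.uniqueDiffOn_closure {Ω : Set ℂ} {γ : ℝ → ℂ} (hΩ : IsOpen Ω)
    (h : IsJordanParam γ (frontier Ω)) : UniqueDiffOn ℝ (closure Ω) := by
  obtain ⟨δ, hδ, σ, hσ, hball⟩ := h.exists_tangent_disc_subset hΩ
  intro z hz
  by_cases hzΩ : z ∈ Ω
  · exact (hΩ.uniqueDiffWithinAt hzΩ).mono subset_closure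
  · have hzf : z ∈ frontier Ω := by rw [hΩ.frontier_eq]; exact ⟨hz, hzΩ⟩
    rw [← h.range_eq] at hzf
    obtain ⟨t, rfl⟩ := hzf
    refine (uniqueDiffWithinAt_convex (convex_ball (γ t + (σ * δ) • normal γ t) δ) ?_ ?_).mono
      ((hball t).trans subset_closure)
    · rw [Metric.isOpen_ball.interior_eq]; exact Metric.nonempty_ball.mpr hδ
    · rw [closure_ball _ hδ.ne', Metric.mem_closedBall, dist_eq_norm, sub_add_cancel_left, norm_neg,
        norm_smul, h.norm_normal, mul_one, Real.norm_eq_abs, abs_mul, hσ, one_mul, abs_of_pos hδ]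

/-- The complement of a domain with connected frontier is connected. -/
lemma isPreconnected_compl_of_frontier {Ω : Set ℂ} (hΩ : IsOpen Ω) (hne : Ω.Nonempty)
    (hf : IsPreconnected (frontier Ω)) : IsPreconnected Ωᶜ := by
  -- If `s` contains the whole frontier, the part of `Ωᶜ` in `t` lies in the interior of `Ωᶜ` and is
  -- therefore clopen in the plane. It misses `Ω`, so it is empty.
  have key : ∀ s t : Set ℂ, IsClosed s → IsClosed t → Ωᶜ ⊆ s ∪ t → Ωᶜ ∩ (s ∩ t) = ∅ →
      frontier Ω ⊆ s → Ωᶜ ⊆ s := by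
    intro s t hs ht hst hdisj hfs
    have hcl : IsClosed (Ωᶜ ∩ t) := hΩ.isClosed_compl.inter ht
    have hop : IsOpen (Ωᶜ ∩ t) := by
      have : Ωᶜ ∩ t = interior Ωᶜ ∩ sᶜ := by
        ext x
        constructor
        · rintro ⟨hx, hxt⟩
          have hxs : x ∉ s := fun h => by
            have : x ∈ Ωᶜ ∩ (s ∩ t) := ⟨hx, h, hxt⟩
            rw [hdisj] at this; exact this
          refine ⟨?_, hxs⟩
          by_contra hn
          refine hxs (hfs ?_)
          rw [← frontier_compl]
          exact ⟨subset_closure hx, hn⟩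
        · rintro ⟨hx, hxs⟩
          exact ⟨interior_subset hx, (hst (interior_subset hx)).resolve_left hxs⟩
      rw [this]
      exact isOpen_interior.inter hs.isOpen_compl
    rcases isClopen_iff.mp ⟨hcl, hop⟩ with h0 | h1
    · intro x hx
      refine (hst hx).resolve_right fun hxt => ?_
      have : x ∈ Ωᶜ ∩ t := ⟨hx, hxt⟩
      rw [h0] at this; exact this
    · obtain ⟨y, hy⟩ := hne
      have : y ∈ Ωᶜ ∩ t := h1 ▸ mem_univ y
      exact absurd hy this.1
  have hfsub : frontier Ω ⊆ Ωᶜ := by rw [hΩ.frontier_eq]; exact fun x hx => hx.2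
  rw [isPreconnected_iff_subset_of_disjoint_closed]
  intro s t hs ht hst hdisj
  rcases isPreconnected_iff_subset_of_disjoint_closed.mp hf s t hs ht (hfsub.trans hst)
    (subset_empty_iff.mp (hdisj ▸ inter_subset_inter_left _ hfsub)) with h1 | h1
  · exact Or.inl (key s t hs ht hst hdisj h1)
  · exact Or.inr (key t s ht hs (by rwa [union_comm]) (by rwa [inter_comm t]) h1)

/-- An unbounded domain with bounded frontier contains a neighbourhood of infinity. -/
lemma isBounded_compl_of_frontier {Ω : Set ℂ} (hub : ¬ Bornology.IsBounded Ω)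
    (hf : Bornology.IsBounded (frontier Ω)) : Bornology.IsBounded Ωᶜ := by
  obtain ⟨R, hR⟩ := hf.exists_norm_le
  have hsub : {z : ℂ | max R 0 < ‖z‖} ⊆ Ω := by
    refine subset_of_disjoint_frontier (isPreconnected_norm_gt (le_max_right _ _)) ?_ ?_
    · rw [disjoint_right]
      intro z hz hz'
      exact absurd ((le_max_left R 0).trans_lt hz') (not_lt.mpr (hR z hz))
    · by_contra hn
      refine hub (isBounded_iff_forall_norm_le.mpr ⟨max R 0, fun z hz => ?_⟩)
      by_contra hlt
      exact hn ⟨z, not_le.mp hlt, hz⟩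
  refine isBounded_iff_forall_norm_le.mpr ⟨max R 0, fun z hz => ?_⟩
  by_contra hlt
  exact hz (hsub (not_le.mp hlt))

/-- The derivative of a function that is holomorphic in `Ω` and smooth up to the boundary. -/
def derivUpTo (Ω : Set ℂ) (F : ℂ → ℂ) (z : ℂ) : ℂ := fderivWithin ℝ F (closure Ω) z 1

section

variable {Ω : Set ℂ} {F : ℂ → ℂ}

lemma fderivWithin_closure_of_mem {E : Type*} [NormedAddCommGroup E] [NormedSpace ℝ E]
    (hΩ : IsOpen Ω) {f : ℂ → E} {z : ℂ} (hz : z ∈ Ω) :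
    fderivWithin ℝ f (closure Ω) z = fderiv ℝ f z :=
  fderivWithin_of_mem_nhds (mem_of_superset (hΩ.mem_nhds hz) subset_closure)

lemma contDiffOn_fderivWithin_apply {E : Type*} [NormedAddCommGroup E] [NormedSpace ℝ E]
    {S : Set ℂ} (hS : UniqueDiffOn ℝ S) {f : ℂ → E} (hf : ContDiffOn ℝ ∞ f S) (v : ℂ) :
    ContDiffOn ℝ ∞ (fun z => fderivWithin ℝ f S z v) S :=
  ((contDiffOn_infty_iff_fderivWithin hS).mp hf).2.clm_apply contDiffOn_const

lemma contDiffOn_derivUpTo (hu : UniqueDiffOn ℝ (closure Ω)) (hF : ContDiffOn ℝ ∞ F (closure Ω)) :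
    ContDiffOn ℝ ∞ (derivUpTo Ω F) (closure Ω) := contDiffOn_fderivWithin_apply hu hF 1

lemma derivUpTo_eq_deriv (hΩ : IsOpen Ω) (hd : DifferentiableOn ℂ F Ω) {z : ℂ} (hz : z ∈ Ω) :
    derivUpTo Ω F z = deriv F z := by
  have h1 := (hd.differentiableAt (hΩ.mem_nhds hz)).hasDerivAt
  rw [derivUpTo, fderivWithin_closure_of_mem hΩ hz, (h1.hasFDerivAt.restrictScalars ℝ).fderiv]
  simp

lemma differentiableOn_derivUpTo (hΩ : IsOpen Ω) (hd : DifferentiableOn ℂ F Ω) :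
    DifferentiableOn ℂ (derivUpTo Ω F) Ω :=
  (hd.deriv hΩ).congr fun _ hz => derivUpTo_eq_deriv hΩ hd hz

/-- Complex linearity of the real differential holds in `Ω` and passes to the closure by continuity.
-/
lemma hasDerivWithinAt_derivUpTo (hΩ : IsOpen Ω) (hu : UniqueDiffOn ℝ (closure Ω))
    (hF : ContDiffOn ℝ ∞ F (closure Ω)) (hd : DifferentiableOn ℂ F Ω) {z : ℂ}
    (hz : z ∈ closure Ω) : HasDerivWithinAt F (derivUpTo Ω F z) (closure Ω) z := by
  have hlin : ∀ z ∈ closure Ω, ∀ v, fderivWithin ℝ F (closure Ω) z v = derivUpTo Ω F z * v := by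
    intro z hz v
    have hc : ContinuousOn (fun z => fderivWithin ℝ F (closure Ω) z v - derivUpTo Ω F z * v)
        (closure Ω) := (contDiffOn_fderivWithin_apply hu hF v).continuousOn.sub
      ((contDiffOn_derivUpTo hu hF).continuousOn.mul continuousOn_const)
    have h0 : EqOn (fun z => fderivWithin ℝ F (closure Ω) z v - derivUpTo Ω F z * v) 0 Ω := by
      intro w hw
      have h1 := (hd.differentiableAt (hΩ.mem_nhds hw)).hasDerivAt
      simp only [Pi.zero_apply]
      rw [derivUpTo_eq_deriv hΩ hd hw, fderivWithin_closure_of_mem hΩ hw,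
        (h1.hasFDerivAt.restrictScalars ℝ).fderiv]
      simp [mul_comm]
    exact sub_eq_zero.mp (h0.of_subset_closure hc continuousOn_const subset_closure Subset.rfl hz)
  have h1 := ((hF.differentiableOn (by simp)) z hz).hasFDerivWithinAt
  rw [hasDerivWithinAt_iff_hasFDerivWithinAt, hasFDerivWithinAt_iff_tendsto]
  rw [hasFDerivWithinAt_iff_tendsto] at h1
  refine h1.congr fun w => ?_
  rw [hlin z hz]
  simp [mul_comm]

end

/-- An exterior potential that is smooth up to the boundary; `G₁` and `G₂` are the first two
complex derivatives of `G`. -/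
structure IsSmoothPotential (Ω : Set ℂ) (u : ℂ → ℝ) (G G₁ G₂ : ℂ → ℂ) : Prop
    extends IsExteriorPotential Ω u G where
  hasFDerivWithinAt : ∀ z ∈ closure Ω, HasFDerivWithinAt u (reMul (G z)) (closure Ω) z
  hasDerivWithinAt : ∀ z ∈ closure Ω, HasDerivWithinAt G (G₁ z) (closure Ω) z
  hasDerivWithinAt₁ : ∀ z ∈ closure Ω, HasDerivWithinAt G₁ (G₂ z) (closure Ω) z
  continuousOn₂ : ContinuousOn G₂ (closure Ω)

lemma norm_reMul (g : ℂ) : ‖reMul g‖ = ‖g‖ := by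
  refine le_antisymm ?_ ?_
  · refine ContinuousLinearMap.opNorm_le_bound _ (norm_nonneg g) fun v => ?_
    rw [reMul_apply, Real.norm_eq_abs, ← norm_mul]
    exact Complex.abs_re_le_norm _
  · rcases eq_or_ne g 0 with rfl | hg
    · simp
    · have h1 := (reMul g).le_opNorm (conj g)
      rw [reMul_apply, Complex.mul_conj, Complex.ofReal_re, Complex.normSq_eq_norm_sq,
        RCLike.norm_conj, norm_pow, norm_norm, sq] at h1
      exact le_of_mul_le_mul_right h1 (norm_pos_iff.mpr hg)

lemma eq_reMul (L : ℂ →L[ℝ] ℝ) : L = reMul (L 1 - Complex.I * L Complex.I) := by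
  ext v
  have : v = v.re • (1 : ℂ) + v.im • Complex.I := by
    rw [Complex.real_smul, Complex.real_smul, mul_one, Complex.re_add_im]
  conv_lhs => rw [this, map_add, map_smul, map_smul]
  rw [reMul_apply]
  simp
  ring

lemma IsJordanParam.length_pos {γ : ℝ → ℂ} {C : Set ℂ} (h : IsJordanParam γ C) : 0 < length γ :=
  intervalIntegral.intervalIntegral_pos_of_pos
    (h.continuous_deriv.norm.intervalIntegrable _ _) (fun t => norm_pos_iff.mpr (h.regular t))
    two_pi_pos

/-- The normalized potential of an exterior Dirichlet problem. -/
theorem IsExteriorDirichlet.exists_smoothPotential {Ω : Set ℂ} {γ₀ : ℝ → ℂ} {U : ℂ → ℝ} {Φ : ℝ}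
    (h : IsExteriorDirichlet Ω γ₀ U Φ) : ∃ (c : ℝ) (u : ℂ → ℝ) (G G₁ G₂ : ℂ → ℂ),
      IsSmoothPotential Ω u G G₁ G₂ ∧ (∀ z, U z = c - Φ / (2 * π) * u z) ∧
      (∀ z ∈ closure Ω, intensity Ω U z = Φ / (2 * π) * ‖G z‖) ∧
      ∫ t in (0 : ℝ)..(2 * π), (G (γ₀ t) * deriv γ₀ t).im = 2 * π := by
  obtain ⟨c, hc⟩ := h.const_boundary
  have hΦ := h.flux_pos
  have hπ := pi_pos
  have huniq := h.boundary.uniqueDiffOn_closure h.isOpen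
  -- Normalized to boundary value `0`, growth `log |z|` and total flux `2π`. The function `G` below
  -- is `u_x - i u_y`, so that `du = Re (G dz)`.
  set u : ℂ → ℝ := fun z => -(2 * π / Φ) * (U z - c) with hu
  set S := closure Ω with hS
  set G : ℂ → ℂ := fun z => fderivWithin ℝ u S z 1 - Complex.I * fderivWithin ℝ u S z Complex.I
    with hG
  have husm : ContDiffOn ℝ ∞ u S := contDiffOn_const.mul (h.smooth.sub contDiffOn_const)
  have hUu : ∀ z, U z = c - Φ / (2 * π) * u z := by
    intro z; simp only [hu]; field_simp; ring
  have hGsm : ContDiffOn ℝ ∞ G S := by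
    have h1 := Complex.ofRealCLM.contDiff.comp_contDiffOn (contDiffOn_fderivWithin_apply huniq husm 1)
    have h2 := Complex.ofRealCLM.contDiff.comp_contDiffOn
      (contDiffOn_fderivWithin_apply huniq husm Complex.I)
    exact h1.sub (contDiffOn_const.mul h2)
  have hfd : ∀ z ∈ S, HasFDerivWithinAt u (reMul (G z)) S z := by
    intro z hz
    have h1 := ((husm.differentiableOn (by simp)) z hz).hasFDerivWithinAt
    rwa [eq_reMul (fderivWithin ℝ u S z)] at h1
  have hGd : DifferentiableOn ℂ G Ω := by
    intro z hz
    have hharm : InnerProductSpace.HarmonicAt u z := by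
      have h1 : InnerProductSpace.HarmonicAt (-(2 * π / Φ) • (U - fun _ => c)) z :=
        ((h.harmonic z hz).sub (InnerProductSpace.harmonicAt_const c)).const_smul
      exact h1
    refine ((HarmonicAt.differentiableAt_complex_partial
      hharm).congr_of_eventuallyEq ?_).differentiableWithinAt
    filter_upwards [h.isOpen.mem_nhds hz] with w hw
    simp only [hG, hS]
    rw [fderivWithin_closure_of_mem h.isOpen hw]
  have hf_int : ∀ z ∈ S, fderivWithin ℝ U S z = -(Φ / (2 * π)) • reMul (G z) := by
    intro z hz
    have h1 : HasFDerivWithinAt U (-(Φ / (2 * π)) • reMul (G z)) S z := by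
      have := ((hfd z hz).const_smul (-(Φ / (2 * π)))).const_add c
      refine HasFDerivWithinAt.congr (f := fun w => c + (-(Φ / (2 * π)) • u) w) this
        (fun w _ => ?_) ?_ <;>
      · rw [hUu]; simp; ring
    exact h1.fderivWithin (huniq z hz)
  have hcb : Bornology.IsBounded Ωᶜ := by
    refine isBounded_compl_of_frontier h.unbounded ?_
    rw [← h.boundary.range_eq, ← h.boundary.periodic.image_Icc two_pi_pos 0]
    exact (isCompact_Icc.image h.boundary.continuous).isBounded
  have hpot : IsExteriorPotential Ω u G :=
    { isOpen := h.isOpen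
      isConnected := h.isConnected
      isCompact_compl := Metric.isCompact_of_isClosed_isBounded h.isOpen.isClosed_compl hcb
      isPreconnected_compl := by
        refine isPreconnected_compl_of_frontier h.isOpen h.isConnected.nonempty ?_
        rw [← h.boundary.range_eq]
        exact isPreconnected_range h.boundary.continuous
      nonempty_compl := by
        refine ⟨γ₀ 0, ?_⟩
        have : γ₀ 0 ∈ frontier Ω := h.boundary.range_eq ▸ mem_range_self 0
        rw [h.isOpen.frontier_eq] at this
        exact this.2
      differentiableOn := hGd
      hasFDerivAt := fun z hz => (hfd z (subset_closure hz)).hasFDerivAt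
        (mem_of_superset (h.isOpen.mem_nhds hz) subset_closure)
      -- The length in the asymptotic condition only adds a constant to the logarithm and disappears
      -- in the quotient.
      log_growth := by
        have hL := h.boundary.length_pos
        have hlog : Tendsto (fun z : ℂ => Real.log ‖z‖) (Bornology.cobounded ℂ) atTop :=
          Real.tendsto_log_atTop.comp tendsto_norm_cobounded_atTop
        have hev : ∀ᶠ z : ℂ in Bornology.cobounded ℂ, Real.log (2 * π * ‖z‖ / length γ₀)
            = Real.log (2 * π / length γ₀) + Real.log ‖z‖ := by
          filter_upwards [tendsto_norm_cobounded_atTop.eventually_gt_atTop 0] with z hz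
          rw [← Real.log_mul (by positivity) hz.ne']; congr 1; ring
        set v : ℂ → ℝ := fun r => -(Φ / (2 * π)) * Real.log (2 * π * ‖r‖ / length γ₀) with hv
        have hv' : Tendsto (fun z => v z / Real.log ‖z‖) (Bornology.cobounded ℂ)
            (𝓝 (-(Φ / (2 * π)))) := by
          have h1 : Tendsto (fun z : ℂ => -(Φ / (2 * π)) *
              (Real.log (2 * π / length γ₀) * (Real.log ‖z‖)⁻¹ + 1)) (Bornology.cobounded ℂ)
              (𝓝 (-(Φ / (2 * π)) * (Real.log (2 * π / length γ₀) * 0 + 1))) :=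
            ((hlog.inv_tendsto_atTop.const_mul _).add_const _).const_mul _
          rw [mul_zero, zero_add, mul_one] at h1
          refine h1.congr' ?_
          filter_upwards [hev, hlog.eventually_gt_atTop 0] with z hz hz'
          simp only [hv]
          rw [hz]; field_simp
        have hvne : ∀ᶠ z in Bornology.cobounded ℂ, v z ≠ 0 := by
          filter_upwards [hv'.eventually_ne (show -(Φ / (2 * π)) ≠ 0 by
            rw [neg_ne_zero]; positivity)] with z hz h0
          rw [h0, zero_div] at hz; exact hz rfl
        have h2 := ((isEquivalent_iff_tendsto_one hvne).mp h.at_infinity).mul hv'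
        have h3 : Tendsto (fun z : ℂ => -(2 * π / Φ) * (U z / Real.log ‖z‖ - c * (Real.log ‖z‖)⁻¹))
            (Bornology.cobounded ℂ) (𝓝 (-(2 * π / Φ) * ((1 * -(Φ / (2 * π))) - c * 0))) := by
          refine (Tendsto.sub ?_ (hlog.inv_tendsto_atTop.const_mul _)).const_mul _
          refine h2.congr' ?_
          filter_upwards [hvne] with z hz
          simp only [Pi.div_apply]
          rw [div_mul_div_cancel₀ hz]
        have e : -(2 * π / Φ) * ((1 * -(Φ / (2 * π))) - c * 0) = 1 := by field_simp; ring
        rw [e] at h3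
        refine h3.congr fun z => ?_
        simp only [hu]; ring
      continuousOn := husm.continuousOn
      boundary := fun z hz => by simp [hu, hc z hz] }
  refine ⟨c, u, G, derivUpTo Ω G, derivUpTo Ω (derivUpTo Ω G), ⟨hpot, hfd, ?_, ?_, ?_⟩, hUu, ?_, ?_⟩
  · exact fun z hz => hasDerivWithinAt_derivUpTo h.isOpen huniq hGsm hGd hz
  · exact fun z hz => hasDerivWithinAt_derivUpTo h.isOpen huniq (contDiffOn_derivUpTo huniq hGsm)
      (differentiableOn_derivUpTo h.isOpen hGd) hz
  · exact (contDiffOn_derivUpTo huniq (contDiffOn_derivUpTo huniq hGsm)).continuousOn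
  · intro z hz
    rw [intensity, grad, gradientWithin, LinearIsometryEquiv.norm_map, hf_int z hz, norm_smul,
      norm_reMul, norm_neg, Real.norm_of_nonneg (by positivity)]
  · have h1 := h.flux
    have h2 : ∀ t, inner ℝ (normal γ₀ t) (grad Ω U (γ₀ t)) * ‖deriv γ₀ t‖ =
        -(Φ / (2 * π)) * (G (γ₀ t) * deriv γ₀ t).im := by
      intro t
      have hmem : γ₀ t ∈ S := frontier_subset_closure (h.boundary.range_eq ▸ mem_range_self t)
      have hne : (‖deriv γ₀ t‖ : ℂ) ≠ 0 := by
        exact_mod_cast norm_ne_zero_iff.mpr (h.boundary.regular t)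
      -- The normal is `-i` times the unit tangent, so the normal derivative of `u` times the speed
      -- is `Im (G γ')`.
      have e : G (γ₀ t) * normal γ₀ t * ‖deriv γ₀ t‖ = -Complex.I * (G (γ₀ t) * deriv γ₀ t) := by
        rw [normal]; field_simp
      have e2 : (G (γ₀ t) * normal γ₀ t).re * ‖deriv γ₀ t‖ = (G (γ₀ t) * deriv γ₀ t).im := by
        rw [← Complex.re_mul_ofReal, e]; simp
      rw [real_inner_comm, grad, gradientWithin, InnerProductSpace.toDual_symm_apply, hf_int _ hmem]
      simp only [smul_apply, reMul_apply, smul_eq_mul]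
      rw [mul_assoc, e2]
    rw [arcIntegral] at h1
    simp only [h2] at h1
    rw [intervalIntegral.integral_const_mul] at h1
    field_simp at h1
    linarith

end

/-! ### Nonvanishing gradient on the boundary and the half-plane parametrization -/

section

variable {Ω : Set ℂ} {u : ℂ → ℝ} {G G₁ G₂ W φ : ℂ → ℂ} {a : ℂ}

/-- The gradient does not vanish up to the boundary. -/
lemma IsSmoothPotential.G_ne_zero (h : IsSmoothPotential Ω u G G₁ G₂)
    (hm : IsExteriorMap Ω u G W φ a) {γ₀ : ℝ → ℂ} (hγ : IsJordanParam γ₀ (frontier Ω)) {z : ℂ}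
    (hz : z ∈ closure Ω) : G z ≠ 0 := by
  by_cases hzΩ : z ∈ Ω
  · exact hm.G_ne_zero z hzΩ
  have hzf : z ∈ frontier Ω := by rw [h.isOpen.frontier_eq]; exact ⟨hz, hzΩ⟩
  have hu0 := h.boundary z hzf
  obtain ⟨δ, hδ, σ, hσ, hball⟩ := hγ.exists_tangent_disc_subset h.isOpen
  rw [← hγ.range_eq] at hzf
  obtain ⟨t, rfl⟩ := hzf
  set c := γ₀ t + (σ * δ) • normal γ₀ t with hc
  obtain ⟨N, hN, hhopf⟩ := exists_hopf_bound (W := W) hδ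
    (fun w hw => (hm.hasDerivAt_W w (hball t hw)).differentiableAt.differentiableWithinAt)
    (fun w hw => by
      rw [hm.norm_W w (hball t hw), Real.exp_lt_one_iff]
      linarith [hm.u_pos w (hball t hw)])
  have hN' : (0 : ℝ) < N := by exact_mod_cast hN
  intro hG0
  have hfd := h.hasFDerivWithinAt _ hz
  set zr : ℝ → ℂ := fun r => γ₀ t + (σ * r) • normal γ₀ t with hzr
  have hdist : ∀ r, ‖zr r - c‖ = |r - δ| := by
    intro r
    simp only [hzr, hc]
    rw [add_sub_add_left_eq_sub, ← sub_smul, ← mul_sub, norm_smul, hγ.norm_normal, mul_one,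
      Real.norm_eq_abs, abs_mul, hσ, one_mul]
  have hmem : ∀ r ∈ Ioo 0 (δ / 2), zr r ∈ Metric.ball c δ := by
    intro r hr
    rw [mem_ball_iff_norm, hdist, abs_of_neg (by linarith [hr.2])]
    linarith [hr.1]
  -- Along the normal into `Ω` the Hopf bound reads `e^{-N u} ≤ 1 - r/δ ≤ e^{-r/δ}`, so `u` grows at
  -- least linearly. If `G` vanished at the boundary point, `u` would be `o(r)`.
  have hlow : ∀ r ∈ Ioo 0 (δ / 2), r / (N * δ) ≤ u (zr r) := by
    intro r hr
    have e : ‖zr r - c‖ = δ - r := by rw [hdist, abs_of_neg (by linarith [hr.2])]; ring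
    have h1 := hhopf (zr r) (by rw [e]; linarith [hr.2]) (by rw [e]; linarith [hr.1])
    rw [hm.norm_W _ (hball t (hmem r hr)), e, ← Real.exp_nat_mul] at h1
    have h2 : (δ - r) / δ ≤ Real.exp (-(r / δ)) := by
      have := Real.add_one_le_exp (-(r / δ))
      rw [sub_div, div_self hδ.ne']; linarith
    have h3 := Real.exp_le_exp.mp (h1.trans h2)
    rw [div_mul_eq_div_div_swap, div_le_iff₀ hN']
    linarith
  have hzr0 : zr 0 = γ₀ t := by simp [hzr]
  have htend : Tendsto zr (𝓝[>] 0) (𝓝[closure Ω] (γ₀ t)) := by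
    refine tendsto_nhdsWithin_iff.mpr ⟨?_, ?_⟩
    · have : Continuous zr := by fun_prop
      have := this.tendsto 0
      rw [hzr0] at this
      exact this.mono_left nhdsWithin_le_nhds
    · filter_upwards [Ioo_mem_nhdsGT (half_pos hδ)] with r hr
      exact subset_closure (hball t (hmem r hr))
  have hlo := hfd.isLittleO.def (show (0 : ℝ) < 1 / (2 * (N * δ)) by positivity)
  obtain ⟨r, hr1, hr2⟩ := ((htend.eventually hlo).and (Ioo_mem_nhdsGT (half_pos hδ))).exists
  have h3 := hlow r hr2
  rw [hu0, hG0] at hr1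
  have e2 : ‖zr r - γ₀ t‖ = r := by
    simp only [hzr]
    rw [add_sub_cancel_left, norm_smul, hγ.norm_normal, mul_one, Real.norm_eq_abs, abs_mul, hσ,
      one_mul, abs_of_pos hr2.1]
  rw [e2, reMul_apply, zero_mul, Complex.zero_re, sub_zero, sub_zero, Real.norm_eq_abs] at hr1
  have h4 := (le_abs_self _).trans hr1
  have h5 : 1 / (2 * (N * δ)) * r = r / (N * δ) / 2 := by field_simp
  have h6 : 0 < r / (N * δ) := div_pos hr2.1 (by positivity)
  linarith

lemma IsExteriorPotential.isCompact_sublevel (h : IsExteriorPotential Ω u G) (M : ℝ) :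
    IsCompact {z ∈ closure Ω | u z ≤ M} := by
  refine Metric.isCompact_of_isClosed_isBounded
    (h.continuousOn.preimage_isClosed_of_isClosed isClosed_closure isClosed_Iic) ?_
  have h1 := h.tendsto_u_atTop.eventually_gt_atTop M
  have h2 : Bornology.IsBounded {z | M < u z}ᶜ := Bornology.isBounded_def.mpr (by
    rw [compl_compl]; exact h1)
  exact h2.subset fun z hz => not_lt.mpr hz.2

/-- `Ψ` is the conformal parametrization of `closure Ω` by the closed right half-plane; it is
periodic with period `2πi`, and `u (Ψ z) = z.re`. -/
structure IsHalfPlaneMap (Ω : Set ℂ) (u : ℂ → ℝ) (G φ Ψ : ℂ → ℂ) : Prop where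
  continuousOn : ContinuousOn Ψ {z : ℂ | 0 ≤ z.re}
  eq_φ : ∀ z : ℂ, 0 < z.re → Ψ z = φ (Complex.exp (-z))
  mapsTo : ∀ z : ℂ, 0 ≤ z.re → Ψ z ∈ closure Ω
  u_eq : ∀ z : ℂ, 0 ≤ z.re → u (Ψ z) = z.re
  surj : ∀ z ∈ closure Ω, ∃ α : ℝ, Ψ (u z + α * Complex.I) = z
  periodic : ∀ z : ℂ, 0 ≤ z.re → Ψ (z + 2 * π * Complex.I) = Ψ z
  G_ne_zero : ∀ z ∈ closure Ω, G z ≠ 0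

namespace IsHalfPlaneMap

variable {Ψ : ℂ → ℂ}

/-- Clamping the real part at zero turns continuity on the closed half-plane into continuity on the
whole plane, the form needed for parametric integrals. -/
lemma continuous_comp (hΨ : IsHalfPlaneMap Ω u G φ Ψ) {E : Type*} [TopologicalSpace E] {H : ℂ → E}
    (hH : ContinuousOn H (closure Ω)) :
    Continuous fun x : ℝ × ℝ => H (Ψ ((max x.1 0 : ℝ) + x.2 * Complex.I)) := by
  have h1 : Continuous fun x : ℝ × ℝ => ((max x.1 0 : ℝ) : ℂ) + x.2 * Complex.I := by fun_prop
  have hre : ∀ x : ℝ × ℝ, 0 ≤ (((max x.1 0 : ℝ) : ℂ) + x.2 * Complex.I).re := by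
    intro x; simp
  exact hH.comp_continuous (hΨ.continuousOn.comp_continuous h1 hre) fun x => hΨ.mapsTo _ (hre x)

lemma continuous_comp_right (hΨ : IsHalfPlaneMap Ω u G φ Ψ) {E : Type*} [TopologicalSpace E]
    {H : ℂ → E} (hH : ContinuousOn H (closure Ω)) {s : ℝ} (hs : 0 ≤ s) :
    Continuous fun α : ℝ => H (Ψ (s + α * Complex.I)) := by
  have := (hΨ.continuous_comp hH).comp (Continuous.prodMk_right s)
  simpa only [Function.comp_def, max_eq_left hs] using this

lemma continuousOn_integral (hΨ : IsHalfPlaneMap Ω u G φ Ψ) {E : Type*} [NormedAddCommGroup E]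
    [NormedSpace ℝ E] {H : ℂ → E} (hH : ContinuousOn H (closure Ω)) (b c : ℝ) :
    ContinuousOn (fun s : ℝ => ∫ α in b..c, H (Ψ (s + α * Complex.I))) (Ici 0) := by
  have h1 : Continuous fun s : ℝ => ∫ α in b..c, H (Ψ ((max s 0 : ℝ) + α * Complex.I)) :=
    intervalIntegral.continuous_parametric_intervalIntegral_of_continuous'
      (hΨ.continuous_comp hH) b c
  refine h1.continuousOn.congr fun s hs => ?_
  simp only [max_eq_left (show (0 : ℝ) ≤ s from hs)]

lemma hasDerivAt_of_pos (hΨ : IsHalfPlaneMap Ω u G φ Ψ) (hm : IsExteriorMap Ω u G W φ a) {z : ℂ}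
    (hz : 0 < z.re) : HasDerivAt Ψ (1 / G (Ψ z)) z := by
  have h1 : Complex.exp (-z) ≠ 0 := Complex.exp_ne_zero _
  have h2 : ‖Complex.exp (-z)‖ < 1 := by
    rw [Complex.norm_exp, Real.exp_lt_one_iff]; simpa using hz
  have h3 := (hm.hasDerivAt_φ _ h1 h2).comp z ((hasDerivAt_id z).neg.cexp)
  have hev : Ψ =ᶠ[𝓝 z] φ ∘ fun w => Complex.exp (-w) := by
    filter_upwards [(isOpen_lt continuous_const Complex.continuous_re).mem_nhds hz] with w hw
    exact hΨ.eq_φ w hw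
  have h4 := HasDerivAt.congr_of_eventuallyEq h3 hev
  convert! h4 using 1
  rw [hΨ.eq_φ z hz]
  simp only [Pi.neg_apply, id]
  field_simp

/-- On the boundary line holomorphy is not available. The integrated form of the equation for `s >
0` passes to `s = 0` by continuity and is differentiated there. -/
lemma hasDerivAt (hΨ : IsHalfPlaneMap Ω u G φ Ψ) (hm : IsExteriorMap Ω u G W φ a)
    (hG : ContinuousOn G (closure Ω)) {s : ℝ} (hs : 0 ≤ s) (α : ℝ) :
    HasDerivAt (fun α : ℝ => Ψ (s + α * Complex.I)) (Complex.I / G (Ψ (s + α * Complex.I))) α := by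
  have hH : ContinuousOn (fun z => Complex.I / G z) (closure Ω) :=
    continuousOn_const.div hG hΨ.G_ne_zero
  have hpos : ∀ s : ℝ, 0 < s → ∀ α : ℝ, HasDerivAt (fun α : ℝ => Ψ (s + α * Complex.I))
      (Complex.I / G (Ψ (s + α * Complex.I))) α := by
    intro s hs α
    have h1 := hΨ.hasDerivAt_of_pos hm (z := s + α * Complex.I) (by simpa using hs)
    have h2 : HasDerivAt (fun α : ℝ => (s : ℂ) + α * Complex.I) Complex.I α := by
      simpa using ((hasDerivAt_id α).ofReal_comp.mul_const Complex.I).const_add (s : ℂ)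
    convert! h1.comp α h2 using 1
    ring
  rcases hs.lt_or_eq with hs' | rfl
  · exact hpos s hs' α
  · have hint_eq : ∀ β : ℝ, Ψ ((0 : ℝ) + β * Complex.I) - Ψ ((0 : ℝ) + (0 : ℝ) * Complex.I) =
        ∫ α in (0 : ℝ)..β, Complex.I / G (Ψ ((0 : ℝ) + α * Complex.I)) := by
      intro β
      have hc := fun β : ℝ => (hΨ.continuousOn.comp (s := Ici (0 : ℝ))
        (f := fun s : ℝ => (s : ℂ) + β * Complex.I) (by fun_prop)
        (fun s hs => by simpa using hs))
      have heq : EqOn (fun s : ℝ => Ψ (s + β * Complex.I) - Ψ (s + (0 : ℝ) * Complex.I))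
          (fun s : ℝ => ∫ α in (0 : ℝ)..β, Complex.I / G (Ψ (s + α * Complex.I))) (Ioi 0) := by
        intro s hs
        exact (intervalIntegral.integral_eq_sub_of_hasDerivAt (fun x _ => hpos s hs x)
          ((hΨ.continuous_comp_right hH (le_of_lt hs)).intervalIntegrable _ _)).symm
      exact heq.of_subset_closure (t := Ici 0) ((hc β).sub (hc 0))
        (hΨ.continuousOn_integral hH 0 β) Ioi_subset_Ici_self (closure_Ioi (0 : ℝ)).ge
        (mem_Ici.mpr le_rfl)
    have hcr := hΨ.continuous_comp_right hH le_rfl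
    have h1 := intervalIntegral.integral_hasDerivAt_right (hcr.intervalIntegrable 0 α)
      (hcr.stronglyMeasurableAtFilter _ _) hcr.continuousAt
    refine (h1.add_const (Ψ ((0 : ℝ) + (0 : ℝ) * Complex.I))).congr_of_eventuallyEq ?_
    refine Eventually.of_forall fun β => ?_
    simp only
    rw [← hint_eq]; ring

end IsHalfPlaneMap

/-- Existence of the conformal parametrization by the closed half-plane. -/
theorem IsSmoothPotential.exists_halfPlaneMap (h : IsSmoothPotential Ω u G G₁ G₂)
    (hm : IsExteriorMap Ω u G W φ a) {γ₀ : ℝ → ℂ} (hγ : IsJordanParam γ₀ (frontier Ω)) :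
    ∃ Ψ, IsHalfPlaneMap Ω u G φ Ψ := by
  have hGne : ∀ z ∈ closure Ω, G z ≠ 0 := fun z hz => h.G_ne_zero hm hγ hz
  have hGc : ContinuousOn G (closure Ω) := fun z hz => (h.hasDerivWithinAt z hz).continuousWithinAt
  set ψ : ℂ → ℂ := fun z => φ (Complex.exp (-z)) with hψ
  have hexp : ∀ z : ℂ, 0 < z.re → ‖Complex.exp (-z)‖ < 1 := by
    intro z hz
    rw [Complex.norm_exp, Real.exp_lt_one_iff]; simpa using hz
  have hψΩ : ∀ z : ℂ, 0 < z.re → ψ z ∈ Ω := fun z hz =>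
    hm.mapsTo _ (Complex.exp_ne_zero _) (hexp z hz)
  have hψu : ∀ z : ℂ, 0 < z.re → u (ψ z) = z.re := by
    intro z hz
    have h1 := hm.norm_W _ (hψΩ z hz)
    rw [hψ, hm.W_φ _ (Complex.exp_ne_zero _) (hexp z hz), Complex.norm_exp] at h1
    have := Real.exp_injective h1
    simp only [Complex.neg_re] at this
    simp only [hψ]
    linarith
  have hψd : ∀ z : ℂ, 0 < z.re → HasDerivAt ψ (1 / G (ψ z)) z := by
    intro z hz
    have h3 := (hm.hasDerivAt_φ _ (Complex.exp_ne_zero _) (hexp z hz)).comp z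
      ((hasDerivAt_id z).neg.cexp)
    convert! h3 using 1
    have := Complex.exp_ne_zero (-z)
    simp only [hψ, Pi.neg_apply, id]
    field_simp
  -- the extension
  obtain ⟨m, hm0, hmG⟩ : ∃ m > 0, ∀ z ∈ closure Ω, u z ≤ 1 → m ≤ ‖G z‖ := by
    rcases ({z ∈ closure Ω | u z ≤ 1}).eq_empty_or_nonempty with he | hne
    · exact ⟨1, one_pos, fun z hz hz1 => by
        have : z ∈ {z ∈ closure Ω | u z ≤ 1} := ⟨hz, hz1⟩
        rw [he] at this; exact this.elim⟩
    · obtain ⟨z₀, hz₀, hmin⟩ := (h.isCompact_sublevel 1).exists_isMinOn hne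
        (hGc.norm.mono fun z hz => hz.1)
      exact ⟨‖G z₀‖, norm_pos_iff.mpr (hGne z₀ hz₀.1), fun z hz hz1 => hmin ⟨hz, hz1⟩⟩
  -- On this convex strip `u (ψ z) < 1`, hence `|ψ'| = 1/|G| ≤ 1/m` and `ψ` is Lipschitz. A
  -- Lipschitz extension to the plane supplies the boundary values.
  set S : Set ℂ := {z | z.re ∈ Ioo (0 : ℝ) 1} with hS
  have hSconv : Convex ℝ S := (convex_Ioo 0 1).linear_preimage Complex.reLm
  have hlip : LipschitzOnWith (1 / m).toNNReal ψ S := by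
    refine hSconv.lipschitzOnWith_of_nnnorm_hasDerivWithin_le
      (fun z hz => (hψd z hz.1).hasDerivWithinAt) fun z hz => ?_
    rw [← NNReal.coe_le_coe, coe_nnnorm, Real.coe_toNNReal _ (by positivity), norm_div, norm_one]
    exact one_div_le_one_div_of_le hm0 (hmG _ (subset_closure (hψΩ z hz.1))
      (by rw [hψu z hz.1]; exact hz.2.le))
  obtain ⟨g, hg, hgS⟩ := hlip.extend_finite_dimension
  classical
  set Ψ : ℂ → ℂ := fun z => if 0 < z.re then ψ z else g z with hΨ
  have hΨψ : ∀ z : ℂ, 0 < z.re → Ψ z = ψ z := fun z hz => if_pos hz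
  have hΨg : ∀ z : ℂ, z.re < 1 → Ψ z = g z := by
    intro z hz
    by_cases h0 : 0 < z.re
    · rw [hΨψ z h0]; exact hgS ⟨h0, hz⟩
    · exact if_neg h0
  have hcont : ContinuousOn Ψ {z | 0 ≤ z.re} := by
    intro z hz
    refine ContinuousAt.continuousWithinAt ?_
    by_cases h0 : 0 < z.re
    · refine (hψd z h0).continuousAt.congr ?_
      filter_upwards [(isOpen_lt continuous_const Complex.continuous_re).mem_nhds h0] with w hw
      exact (hΨψ w hw).symm
    · have h1 : z.re < 1 := lt_of_le_of_lt (not_lt.mp h0) one_pos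
      refine hg.continuous.continuousAt.congr ?_
      filter_upwards [(isOpen_lt Complex.continuous_re continuous_const).mem_nhds h1] with w hw
      exact (hΨg w hw).symm
  have hcl : closure {z : ℂ | 0 < z.re} = {z | 0 ≤ z.re} := Complex.closure_setOfPred_lt_re 0
  have hmaps : MapsTo Ψ {z | 0 ≤ z.re} (closure Ω) := by
    rw [← hcl]
    refine MapsTo.closure_of_continuousOn (fun z hz => ?_) (by rwa [hcl])
    rw [hΨψ z hz]; exact hψΩ z hz
  have hu : ∀ z : ℂ, 0 ≤ z.re → u (Ψ z) = z.re := by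
    have : EqOn (fun z => u (Ψ z)) Complex.re {z | 0 ≤ z.re} := by
      refine EqOn.of_subset_closure (s := {z | 0 < z.re}) (fun z hz => ?_)
        (h.continuousOn.comp hcont hmaps) Complex.continuous_re.continuousOn
        (fun z hz => le_of_lt hz) hcl.ge
      simp only [hΨψ z hz]
      exact hψu z hz
    exact fun z hz => this hz
  refine ⟨Ψ, hcont, hΨψ, hmaps, hu, fun z hz => ?_, fun z hz => ?_, hGne⟩
  -- The image of this compact rectangle, one period high, is closed. It contains every point `w` of
  -- `Ω` near `z`, through `-log (W w)`, and so contains `z`.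
  · set K : Set ℂ := Icc 0 (u z + 1) ×ℂ Icc (-π) π with hK
    have hKc : IsCompact K := isCompact_Icc.reProdIm isCompact_Icc
    have hKsub : K ⊆ {z | 0 ≤ z.re} := fun w hw => hw.1.1
    have hcl2 : IsClosed (Ψ '' K) := (hKc.image_of_continuousOn (hcont.mono hKsub)).isClosed
    have hne : (𝓝[Ω] z).NeBot := mem_closure_iff_nhdsWithin_neBot.mp hz
    have hmem : z ∈ Ψ '' K := by
      refine hcl2.mem_of_tendsto (f := id) (b := 𝓝[Ω] z) nhdsWithin_le_nhds ?_
      have h1 := ((h.continuousOn z hz).mono subset_closure).eventually_lt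
        (continuousWithinAt_const (b := u z + 1)) (lt_add_one (u z))
      filter_upwards [h1, self_mem_nhdsWithin] with w hw hwΩ
      have hWne : W w ≠ 0 := by
        rw [← norm_pos_iff, hm.norm_W w hwΩ]; exact Real.exp_pos _
      have hre : (-Complex.log (W w)).re = u w := by
        rw [Complex.neg_re, Complex.log_re, hm.norm_W w hwΩ, Real.log_exp, neg_neg]
      have hupos := hm.u_pos w hwΩ
      refine ⟨-Complex.log (W w), ⟨?_, ?_⟩, ?_⟩
      · rw [mem_preimage, hre]; exact ⟨hupos.le, hw.le⟩
      · rw [mem_preimage, Complex.neg_im, Complex.log_im]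
        exact ⟨neg_le_neg (Complex.arg_le_pi _), by linarith [Complex.neg_pi_lt_arg (W w)]⟩
      · rw [hΨψ _ (by rw [hre]; exact hupos)]
        simp only [hψ, neg_neg, id]
        rw [Complex.exp_log hWne, hm.φ_W w hwΩ]
    obtain ⟨w, hw, hwz⟩ := hmem
    refine ⟨w.im, ?_⟩
    have := hu w (hKsub hw)
    rw [hwz] at this
    rw [this, Complex.re_add_im, hwz]
  · have : EqOn (fun z : ℂ => Ψ (z + 2 * π * Complex.I)) Ψ {z | 0 ≤ z.re} := by
      refine EqOn.of_subset_closure (s := {z | 0 < z.re}) (fun z hz => ?_)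
        (hcont.comp (by fun_prop) fun z hz => by simpa using hz) hcont
        (fun z hz => le_of_lt hz) hcl.ge
      rw [hΨψ z hz, hΨψ _ (by simpa using hz)]
      simp only [hψ]
      rw [neg_add, ← sub_eq_add_neg, Complex.exp_periodic.sub_eq]
    exact this hz

end

/-! ### Lifting level curves to the angle variable -/

section

variable {Ω : Set ℂ} {u : ℂ → ℝ} {G G₁ G₂ W φ Ψ : ℂ → ℂ} {a : ℂ}

/-- The level set of `u` in `closure Ω`. -/
def potentialLevel (Ω : Set ℂ) (u : ℂ → ℝ) (s : ℝ) : Set ℂ := {z ∈ closure Ω | u z = s}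

/-- The integral of `H` over the level `s` with respect to harmonic measure of total mass `2π`. -/
def levelIntegral (Ψ : ℂ → ℂ) (H : ℂ → ℝ) (s : ℝ) : ℝ :=
  ∫ α in (0 : ℝ)..(2 * π), H (Ψ (s + α * Complex.I))

/-- A continuous function without zeros on the line has constant sign. -/
lemma pos_or_neg_of_continuous {f : ℝ → ℝ} (hf : Continuous f) (h0 : ∀ t, f t ≠ 0) :
    (∀ t, 0 < f t) ∨ ∀ t, f t < 0 := by
  by_contra hcon
  push Not at hcon
  obtain ⟨⟨t₁, h1⟩, ⟨t₂, h2⟩⟩ := hcon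
  obtain ⟨t, ht⟩ := mem_range_of_exists_le_of_exists_ge hf ⟨t₁, h1⟩ ⟨t₂, h2⟩
  exact h0 t ht

lemma hasDerivAt_comp_curve {S : Set ℂ} {F : ℂ → ℂ} {F' : ℂ} {γ : ℝ → ℂ} {γ' : ℂ} {t : ℝ}
    (hF : HasDerivWithinAt F F' S (γ t)) (hγ : HasDerivAt γ γ' t) (hmem : ∀ t, γ t ∈ S) :
    HasDerivAt (fun t => F (γ t)) (F' * γ') t := by
  have h1 := (hF.hasFDerivWithinAt.restrictScalars ℝ).comp_hasDerivAt t hγ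
    (Eventually.of_forall hmem)
  convert! h1 using 1
  simp [mul_comm]

lemma IsHalfPlaneMap.periodic_right (hΨ : IsHalfPlaneMap Ω u G φ Ψ) {s : ℝ} (hs : 0 ≤ s) :
    Function.Periodic (fun α : ℝ => Ψ (s + α * Complex.I)) (2 * π) := by
  intro α
  have h1 := hΨ.periodic (s + α * Complex.I) (by simpa using hs)
  simp only
  rw [← h1]; congr 1; push_cast; ring

lemma IsSmoothPotential.continuousOn_G (h : IsSmoothPotential Ω u G G₁ G₂) :
    ContinuousOn G (closure Ω) := fun z hz => (h.hasDerivWithinAt z hz).continuousWithinAt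

lemma IsSmoothPotential.continuousOn_G₁ (h : IsSmoothPotential Ω u G G₁ G₂) :
    ContinuousOn G₁ (closure Ω) := fun z hz => (h.hasDerivWithinAt₁ z hz).continuousWithinAt

section

variable {s : ℝ} {γ : ℝ → ℂ}

lemma IsJordanParam.mem (hγ : IsJordanParam γ (potentialLevel Ω u s)) (t : ℝ) :
    γ t ∈ closure Ω ∧ u (γ t) = s := by
  have : γ t ∈ potentialLevel Ω u s := hγ.range_eq ▸ mem_range_self t
  exact this

/-- `Re (G γ')` is the derivative of `u` along a level, hence zero. What remains, `Im (G γ')`, is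
the angular speed. -/
lemma IsSmoothPotential.G_mul_deriv (h : IsSmoothPotential Ω u G G₁ G₂)
    (hγ : IsJordanParam γ (potentialLevel Ω u s)) (t : ℝ) :
    G (γ t) * deriv γ t = (G (γ t) * deriv γ t).im * Complex.I := by
  have h1 := (h.hasFDerivWithinAt _ (hγ.mem t).1).comp_hasDerivAt t (hγ.hasDerivAt t)
    (Eventually.of_forall fun t => (hγ.mem t).1)
  have h2 : u ∘ γ = fun _ => s := funext fun t => (hγ.mem t).2
  rw [h2] at h1
  have h3 := h1.unique (hasDerivAt_const t s)
  rw [reMul_apply] at h3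
  apply Complex.ext <;> simp [h3]

lemma IsSmoothPotential.continuous_angularSpeed (h : IsSmoothPotential Ω u G G₁ G₂)
    (hγ : IsJordanParam γ (potentialLevel Ω u s)) :
    Continuous fun t => (G (γ t) * deriv γ t).im :=
  Complex.continuous_im.comp ((h.continuousOn_G.comp_continuous hγ.continuous
    fun t => (hγ.mem t).1).mul hγ.continuous_deriv)

/-- The reciprocal of the field is Lipschitz on a smooth level curve. -/
lemma IsSmoothPotential.exists_lipschitzOnWith (h : IsSmoothPotential Ω u G G₁ G₂)
    (hG : ∀ z ∈ closure Ω, G z ≠ 0) (hγ : IsJordanParam γ (potentialLevel Ω u s)) :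
    ∃ K, LipschitzOnWith K (fun z => 1 / G z) (potentialLevel Ω u s) := by
  obtain ⟨c, hc, hca⟩ := hγ.exists_chord_arc
  set D : ℝ → ℂ := fun t => -(G₁ (γ t) * deriv γ t) / G (γ t) ^ 2 with hD
  have hder : ∀ t, HasDerivAt (fun t => 1 / G (γ t)) (D t) t := by
    intro t
    have h1 := hasDerivAt_comp_curve (h.hasDerivWithinAt _ (hγ.mem t).1) (hγ.hasDerivAt t)
      fun t => (hγ.mem t).1
    simp only [one_div]
    exact h1.inv (hG _ (hγ.mem t).1)
  have hDc : Continuous D := by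
    have h1 := h.continuousOn_G.comp_continuous hγ.continuous fun t => (hγ.mem t).1
    have h2 := h.continuousOn_G₁.comp_continuous hγ.continuous fun t => (hγ.mem t).1
    exact ((h2.mul hγ.continuous_deriv).neg).div (h1.pow 2)
      fun t => pow_ne_zero 2 (hG _ (hγ.mem t).1)
  have hDp : Function.Periodic D (2 * π) := by
    intro t
    simp only [hD, hγ.periodic t, hγ.periodic_deriv t]
  obtain ⟨M, hM⟩ := (isCompact_Icc (a := (0 : ℝ)) (b := 2 * π)).exists_bound_of_continuousOn
    hDc.continuousOn
  have hM' : ∀ t, ‖D t‖ ≤ max M 0 := by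
    intro t
    obtain ⟨t', ht', he⟩ := hDp.exists_mem_Ico₀ two_pi_pos t
    rw [he]
    exact (hM t' (Ico_subset_Icc_self ht')).trans (le_max_left _ _)
  refine ⟨(max M 0 / c).toNNReal, LipschitzOnWith.of_dist_le_mul fun x hx y hy => ?_⟩
  rw [← hγ.range_eq] at hx hy
  obtain ⟨s₁, rfl⟩ := hx
  obtain ⟨t, rfl⟩ := hy
  -- The chord-arc bound needs parameters at most half a period apart. It converts the derivative
  -- bound `M` in the parameter into the Lipschitz constant `M / c` in the plane.
  obtain ⟨s', hs', hst⟩ := hγ.exists_near_rep s₁ t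
  rw [← hs', dist_eq_norm, dist_eq_norm, Real.coe_toNNReal _ (by positivity)]
  have h1 := convex_univ.norm_image_sub_le_of_norm_hasDerivWithin_le
    (fun z _ => (hder z).hasDerivWithinAt) (fun z _ => hM' z) (mem_univ t) (mem_univ s')
  refine h1.trans ?_
  rw [Real.norm_eq_abs, div_mul_eq_mul_div, le_div_iff₀ hc, mul_assoc, mul_comm |s' - t|]
  exact mul_le_mul_of_nonneg_left (hca s' t hst) (le_max_right _ _)

/-- A level curve, lifted to the half-plane. -/
lemma IsSmoothPotential.exists_lift (h : IsSmoothPotential Ω u G G₁ G₂)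
    (hm : IsExteriorMap Ω u G W φ a) (hΨ : IsHalfPlaneMap Ω u G φ Ψ) (hs : 0 ≤ s)
    (hγ : IsJordanParam γ (potentialLevel Ω u s)) :
    ∃ θ : ℝ → ℝ, (∀ t, HasDerivAt θ (G (γ t) * deriv γ t).im t) ∧
      ∀ t, γ t = Ψ (s + θ t * Complex.I) := by
  obtain ⟨α, hα⟩ := hΨ.surj (γ 0) (hγ.mem 0).1
  rw [(hγ.mem 0).2] at hα
  set w : ℝ → ℝ := fun t => (G (γ t) * deriv γ t).im with hw
  have hwc : Continuous w := h.continuous_angularSpeed hγ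
  set θ : ℝ → ℝ := fun t => α + ∫ x in (0 : ℝ)..t, w x with hθ
  have hθd : ∀ t, HasDerivAt θ (w t) t := fun t =>
    (intervalIntegral.integral_hasDerivAt_right (hwc.intervalIntegrable 0 t)
      (hwc.stronglyMeasurableAtFilter _ _) hwc.continuousAt).const_add α
  refine ⟨θ, hθd, ?_⟩
  obtain ⟨K, hK⟩ := h.exists_lipschitzOnWith hΨ.G_ne_zero hγ
  have hwp : Function.Periodic w (2 * π) := by
    intro t
    simp only [hw, hγ.periodic t, hγ.periodic_deriv t]
  obtain ⟨M, hM⟩ := (isCompact_Icc (a := (0 : ℝ)) (b := 2 * π)).exists_bound_of_continuousOn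
    hwc.continuousOn
  have hM' : ∀ t, ‖w t‖ ≤ max M 0 := by
    intro t
    obtain ⟨t', ht', he⟩ := hwp.exists_mem_Ico₀ two_pi_pos t
    rw [he]
    exact (hM t' (Ico_subset_Icc_self ht')).trans (le_max_left _ _)
  have hlip : ∀ t, LipschitzOnWith ((max M 0).toNNReal * K)
      (fun z => (w t * Complex.I) * (1 / G z)) (potentialLevel Ω u s) := by
    intro t
    refine LipschitzOnWith.of_dist_le_mul fun x hx y hy => ?_
    rw [dist_eq_norm, ← mul_sub, norm_mul, norm_mul, Complex.norm_I, mul_one, Complex.norm_real,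
      ← dist_eq_norm, NNReal.coe_mul, Real.coe_toNNReal _ (le_max_right _ _), mul_assoc]
    exact mul_le_mul (hM' t) (hK.dist_le_mul x hx y hy) dist_nonneg (le_max_right _ _)
  -- Both curves solve `z' = i w(t) / G z` with the same initial value and stay on the level set, so
  -- a Lipschitz bound on that set alone suffices for uniqueness.
  have key := ODE_solution_unique_univ (t₀ := 0) (f := γ) (g := fun t => Ψ (s + θ t * Complex.I))
    (v := fun t z => (w t * Complex.I) * (1 / G z)) (s := fun _ => potentialLevel Ω u s) hlip ?_ ?_ ?_
  · exact fun t => congrFun key t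
  · intro t
    refine ⟨?_, hγ.mem t⟩
    convert! hγ.hasDerivAt t using 1
    have := hΨ.G_ne_zero _ (hγ.mem t).1
    simp only [hw]
    rw [← h.G_mul_deriv hγ t]
    field_simp
  · intro t
    refine ⟨?_, hΨ.mapsTo _ (by simpa using hs),
      by simpa using hΨ.u_eq (s + θ t * Complex.I) (by simpa using hs)⟩
    have h1 := (hΨ.hasDerivAt hm h.continuousOn_G hs (θ t)).scomp t (hθd t)
    convert! h1 using 1
    rw [Complex.real_smul]; ring
  · simp only [hθ, intervalIntegral.integral_same, add_zero]
    exact hα.symm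

lemma IsSmoothPotential.angularSpeed_ne_zero (h : IsSmoothPotential Ω u G G₁ G₂)
    (hΨ : IsHalfPlaneMap Ω u G φ Ψ) (hγ : IsJordanParam γ (potentialLevel Ω u s)) (t : ℝ) :
    (G (γ t) * deriv γ t).im ≠ 0 := by
  intro h0
  have h1 := h.G_mul_deriv hγ t
  rw [h0, Complex.ofReal_zero, zero_mul, mul_eq_zero] at h1
  exact h1.elim (hΨ.G_ne_zero _ (hγ.mem t).1) (hγ.regular t)

/-- Substitution of the angle along a lifted level curve. -/
lemma IsSmoothPotential.integral_lift (h : IsSmoothPotential Ω u G G₁ G₂)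
    (hΨ : IsHalfPlaneMap Ω u G φ Ψ) (hs : 0 ≤ s) (hγ : IsJordanParam γ (potentialLevel Ω u s))
    {θ : ℝ → ℝ} (hθ : ∀ t, HasDerivAt θ (G (γ t) * deriv γ t).im t)
    (hγθ : ∀ t, γ t = Ψ (s + θ t * Complex.I)) {H : ℂ → ℝ} (hH : ContinuousOn H (closure Ω)) :
    ∫ t in (0 : ℝ)..(2 * π), H (γ t) * (G (γ t) * deriv γ t).im =
      ∫ α in θ 0..θ (2 * π), H (Ψ (s + α * Complex.I)) := by
  rw [← intervalIntegral.integral_comp_mul_deriv (f := θ)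
    (g := fun α => H (Ψ (s + α * Complex.I))) (fun x _ => hθ x)
    (h.continuous_angularSpeed hγ).continuousOn (hΨ.continuous_comp_right hH hs)]
  refine intervalIntegral.integral_congr fun t _ => ?_
  simp only [Function.comp_apply]
  rw [← hγθ t]

/-- Twice the area enclosed by a level curve. -/
lemma IsSmoothPotential.area_lift (h : IsSmoothPotential Ω u G G₁ G₂)
    (hΨ : IsHalfPlaneMap Ω u G φ Ψ) (hγ : IsJordanParam γ (potentialLevel Ω u s)) (t : ℝ) :
    (conj (γ t) * deriv γ t).im =
      (conj (γ t) / G (γ t)).re * (G (γ t) * deriv γ t).im := by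
  have hG := hΨ.G_ne_zero _ (hγ.mem t).1
  have h1 : deriv γ t = (G (γ t) * deriv γ t).im * Complex.I / G (γ t) := by
    rw [← h.G_mul_deriv hγ t]; field_simp
  have h2 : conj (γ t) * deriv γ t =
      ((G (γ t) * deriv γ t).im : ℂ) * (conj (γ t) / G (γ t) * Complex.I) := by
    conv_lhs => rw [h1]
    ring
  rw [h2, Complex.im_ofReal_mul]
  simp [mul_comm]

/-- The integrand of twice the enclosed area. -/
def areaDensity (G : ℂ → ℂ) (z : ℂ) : ℝ := (conj z / G z).re

lemma continuousOn_areaDensity (h : IsSmoothPotential Ω u G G₁ G₂)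
    (hΨ : IsHalfPlaneMap Ω u G φ Ψ) : ContinuousOn (areaDensity G) (closure Ω) :=
  Complex.continuous_re.comp_continuousOn
    (Complex.continuous_conj.continuousOn.div h.continuousOn_G hΨ.G_ne_zero)

/-- Points of a level are determined by the angle. -/
def IsAngleInjective (Ψ : ℂ → ℂ) (s : ℝ) : Prop :=
  ∀ α β : ℝ, Ψ (s + α * Complex.I) = Ψ (s + β * Complex.I) → ∃ n : ℤ, α = β + n * (2 * π)

/-- A counterclockwise level curve runs once through the angles. -/
theorem IsSmoothPotential.exists_angle (h : IsSmoothPotential Ω u G G₁ G₂)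
    (hm : IsExteriorMap Ω u G W φ a) (hΨ : IsHalfPlaneMap Ω u G φ Ψ) (hs : 0 ≤ s)
    (hinj : IsAngleInjective Ψ s) (hA : 0 < levelIntegral Ψ (areaDensity G) s)
    (hγ : IsJordanParam γ (potentialLevel Ω u s)) :
    (∀ t, 0 < (G (γ t) * deriv γ t).im) ∧
    ∀ H : ℂ → ℝ, ContinuousOn H (closure Ω) →
      ∫ t in (0 : ℝ)..(2 * π), H (γ t) * (G (γ t) * deriv γ t).im = levelIntegral Ψ H s := by
  obtain ⟨θ, hθ, hγθ⟩ := h.exists_lift hm hΨ hs hγ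
  obtain ⟨n, hn⟩ := hinj (θ (2 * π)) (θ 0) (by
    rw [← hγθ, ← hγθ]; simpa using hγ.periodic 0)
  have hper : ∀ H : ℂ → ℝ, Function.Periodic (fun α : ℝ => H (Ψ (s + α * Complex.I))) (2 * π) :=
    fun H α => by
      have := hΨ.periodic_right hs α
      simp only at this ⊢
      rw [this]
  -- The curve makes `n` turns of angle, so its signed area is `n` times that of one turn. Both
  -- areas are positive, one because the curve is counterclockwise and the other by hypothesis.
  have hnpos : 0 < n := by
    have h1 := hγ.counterclockwise
    simp only [h.area_lift hΨ hγ] at h1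
    have h2 := h.integral_lift hΨ hs hγ hθ hγθ (continuousOn_areaDensity h hΨ)
    have h3 := (hper (areaDensity G)).intervalIntegral_add_zsmul_eq n (θ 0) fun t₁ t₂ =>
      (hΨ.continuous_comp_right (continuousOn_areaDensity h hΨ) hs).intervalIntegrable t₁ t₂
    rw [(hper (areaDensity G)).intervalIntegral_add_eq (θ 0) 0, zero_add] at h3
    simp only [zsmul_eq_mul] at h3
    rw [← hn, ← h2] at h3
    have h4 : (0 : ℝ) < n * levelIntegral Ψ (areaDensity G) s := h3 ▸ h1
    exact_mod_cast pos_of_mul_pos_left h4 hA.le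
  have hpos : ∀ t, 0 < (G (γ t) * deriv γ t).im := by
    refine (pos_or_neg_of_continuous (h.continuous_angularSpeed hγ)
      (h.angularSpeed_ne_zero hΨ hγ)).resolve_right fun hneg => ?_
    have h1 : StrictAnti θ := strictAnti_of_hasDerivAt_neg hθ hneg
    have h2 := h1 two_pi_pos
    have : (0 : ℝ) < n * (2 * π) := mul_pos (by exact_mod_cast hnpos) two_pi_pos
    linarith
  have hmono : StrictMono θ := strictMono_of_hasDerivAt_pos hθ hpos
  -- With two or more turns the angle would pass `θ 0 + 2π` strictly inside the period, and the
  -- curve would revisit its initial point.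
  have hn1 : n = 1 := by
    by_contra hne
    have hn2 : (2 : ℝ) ≤ n := by exact_mod_cast (show (2 : ℤ) ≤ n by omega)
    have hc : ContinuousOn θ (Icc 0 (2 * π)) := fun t _ => (hθ t).continuousAt.continuousWithinAt
    obtain ⟨t, ht, he⟩ := intermediate_value_Ioo two_pi_pos.le hc
      (show θ 0 + 2 * π ∈ Ioo (θ 0) (θ (2 * π)) from
        ⟨by linarith [two_pi_pos], by rw [hn]; nlinarith [two_pi_pos]⟩)
    have h1 : γ t = γ 0 := by
      rw [hγθ t, hγθ 0, he]
      exact hΨ.periodic_right hs (θ 0)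
    have := hγ.injOn ⟨ht.1.le, ht.2⟩ ⟨le_rfl, two_pi_pos⟩ h1
    linarith [ht.1]
  refine ⟨hpos, fun H hH => ?_⟩
  rw [h.integral_lift hΨ hs hγ hθ hγθ hH, hn, hn1, Int.cast_one, one_mul,
    (hper H).intervalIntegral_add_eq (θ 0) 0, zero_add]
  rfl

end

lemma IsExteriorMap.isAngleInjective (hm : IsExteriorMap Ω u G W φ a)
    (hΨ : IsHalfPlaneMap Ω u G φ Ψ) {s : ℝ} (hs : 0 < s) : IsAngleInjective Ψ s := by
  intro α β hαβ
  have hre : ∀ α : ℝ, 0 < ((s : ℂ) + α * Complex.I).re := fun α => by simpa using hs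
  have hexp : ∀ α : ℝ, ‖Complex.exp (-((s : ℂ) + α * Complex.I))‖ < 1 := fun α => by
    rw [Complex.norm_exp, Real.exp_lt_one_iff]; simpa using hs
  rw [hΨ.eq_φ _ (hre α), hΨ.eq_φ _ (hre β)] at hαβ
  have h1 := congrArg W hαβ
  rw [hm.W_φ _ (Complex.exp_ne_zero _) (hexp α), hm.W_φ _ (Complex.exp_ne_zero _) (hexp β)] at h1
  obtain ⟨n, hn⟩ := Complex.exp_eq_exp_iff_exists_int.mp h1
  refine ⟨-n, ?_⟩
  have := congrArg Complex.im hn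
  simp at this
  push_cast
  linarith

lemma IsSmoothPotential.potentialLevel_zero (h : IsSmoothPotential Ω u G G₁ G₂)
    (hm : IsExteriorMap Ω u G W φ a) : potentialLevel Ω u 0 = frontier Ω := by
  ext z
  constructor
  · rintro ⟨hz, hz0⟩
    rw [h.isOpen.frontier_eq]
    exact ⟨hz, fun hzΩ => (hm.u_pos z hzΩ).ne' hz0⟩
  · exact fun hz => ⟨frontier_subset_closure hz, h.boundary z hz⟩

/-- At the boundary, the flux condition makes the angle injective, and the orientation makes the
area positive. -/
lemma IsSmoothPotential.boundary_angle (h : IsSmoothPotential Ω u G G₁ G₂)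
    (hm : IsExteriorMap Ω u G W φ a) (hΨ : IsHalfPlaneMap Ω u G φ Ψ) {γ₀ : ℝ → ℂ}
    (hγ₀ : IsJordanParam γ₀ (frontier Ω))
    (hflux : ∫ t in (0 : ℝ)..(2 * π), (G (γ₀ t) * deriv γ₀ t).im = 2 * π) :
    IsAngleInjective Ψ 0 ∧ 0 < levelIntegral Ψ (areaDensity G) 0 := by
  have hγ : IsJordanParam γ₀ (potentialLevel Ω u 0) := by rwa [h.potentialLevel_zero hm]
  obtain ⟨θ, hθ, hγθ⟩ := h.exists_lift hm hΨ le_rfl hγ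
  have hwc := h.continuous_angularSpeed hγ
  -- The flux condition fixes the total angle along the boundary to exactly one turn.
  have hT : θ (2 * π) = θ 0 + 2 * π := by
    rw [intervalIntegral.integral_eq_sub_of_hasDerivAt (fun x _ => hθ x)
      (hwc.intervalIntegrable _ _)] at hflux
    linarith
  have hper := hΨ.periodic_right (s := 0) le_rfl
  constructor
  · have hc : ContinuousOn θ (Icc 0 (2 * π)) := fun t _ => (hθ t).continuousAt.continuousWithinAt
    -- Every angle is reached within one period of `γ₀`, so injectivity of `γ₀` transfers to the
    -- angle without any boundary injectivity of the conformal map.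
    have hrep : ∀ α : ℝ, ∃ t ∈ Ico 0 (2 * π), ∃ k : ℤ, α = θ t + k * (2 * π) := by
      intro α
      have h1 := toIcoMod_mem_Ico two_pi_pos (θ 0) α
      obtain ⟨t, ht, he⟩ := intermediate_value_Ico two_pi_pos.le hc (by rw [hT]; exact h1)
      refine ⟨t, ht, toIcoDiv two_pi_pos (θ 0) α, ?_⟩
      rw [he, ← zsmul_eq_mul, toIcoMod_add_toIcoDiv_zsmul]
    intro α β hαβ
    obtain ⟨t₁, ht₁, k₁, rfl⟩ := hrep α
    obtain ⟨t₂, ht₂, k₂, rfl⟩ := hrep β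
    have e : ∀ (t : ℝ) (k : ℤ), Ψ ((0 : ℝ) + ((θ t + k * (2 * π) : ℝ) : ℂ) * Complex.I) = γ₀ t := by
      intro t k
      rw [hγθ t]
      have := hper.int_mul k (θ t)
      simpa only using this
    rw [e, e] at hαβ
    have := hγ.injOn ht₁ ht₂ hαβ
    refine ⟨k₁ - k₂, ?_⟩
    rw [this]; push_cast; ring
  · have h1 := hγ.counterclockwise
    simp only [h.area_lift hΨ hγ] at h1
    have h2 := h.integral_lift hΨ le_rfl hγ hθ hγθ (continuousOn_areaDensity h hΨ)
    have hp : Function.Periodic (fun α : ℝ => areaDensity G (Ψ ((0 : ℝ) + α * Complex.I)))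
        (2 * π) := fun α => by
      have := hper α
      simp only at this ⊢
      rw [this]
    rw [hT, hp.intervalIntegral_add_eq (θ 0) 0, zero_add] at h2
    rw [levelIntegral, ← h2]
    exact h1

/-- The interior level curves. -/
lemma IsSmoothPotential.isJordanParam_level (h : IsSmoothPotential Ω u G G₁ G₂)
    (hm : IsExteriorMap Ω u G W φ a) (hΨ : IsHalfPlaneMap Ω u G φ Ψ) {s : ℝ} (hs : 0 < s)
    (hA : 0 < levelIntegral Ψ (areaDensity G) s) :
    IsJordanParam (fun α : ℝ => Ψ (s + α * Complex.I)) (potentialLevel Ω u s) := by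
  have hre : ∀ α : ℝ, 0 < ((s : ℂ) + α * Complex.I).re := fun α => by simpa using hs
  have hd := fun α => hΨ.hasDerivAt hm h.continuousOn_G hs.le α
  have hmem : ∀ α : ℝ, Ψ (s + α * Complex.I) ∈ closure Ω := fun α => hΨ.mapsTo _ (hre α).le
  refine ⟨?_, hΨ.periodic_right hs.le, fun α => ?_, ?_, ?_, ?_⟩
  · rw [contDiff_iff_contDiffAt]
    intro α
    have hdiff : DifferentiableOn ℂ Ψ {z | 0 < z.re} := fun z hz =>
      (hΨ.hasDerivAt_of_pos hm hz).differentiableAt.differentiableWithinAt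
    have h1 : ContDiffAt ℝ ∞ Ψ (s + α * Complex.I) :=
      ((hdiff.analyticAt ((isOpen_lt continuous_const Complex.continuous_re).mem_nhds
        (hre α))).contDiffAt).restrict_scalars ℝ
    have h2 : ContDiff ℝ ∞ fun α : ℝ => (s : ℂ) + α * Complex.I :=
      contDiff_const.add (Complex.ofRealCLM.contDiff.mul contDiff_const)
    exact h1.comp α h2.contDiffAt
  · rw [(hd α).deriv]
    exact div_ne_zero Complex.I_ne_zero (hΨ.G_ne_zero _ (hmem α))
  · intro α hα β hβ hαβ
    obtain ⟨n, hn⟩ := hm.isAngleInjective hΨ hs α β hαβ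
    have h1 : (n : ℝ) < 1 := by
      by_contra hcon
      nlinarith [hα.1, hα.2, hβ.1, hβ.2, two_pi_pos]
    have h2 : (-1 : ℝ) < n := by
      by_contra hcon
      nlinarith [hα.1, hα.2, hβ.1, hβ.2, two_pi_pos]
    have h3 : n = 0 := by
      have h1' : n < 1 := by exact_mod_cast h1
      have h2' : -1 < n := by exact_mod_cast h2
      omega
    rw [hn, h3]; simp
  · ext z
    constructor
    · rintro ⟨α, rfl⟩
      refine ⟨hmem α, ?_⟩
      simpa using hΨ.u_eq _ (hre α).le
    · rintro ⟨hz, rfl⟩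
      obtain ⟨α, hα⟩ := hΨ.surj z hz
      exact ⟨α, hα⟩
  · convert! hA using 1
    refine intervalIntegral.integral_congr fun α _ => ?_
    rw [(hd α).deriv, areaDensity, show conj (Ψ (s + α * Complex.I)) *
      (Complex.I / G (Ψ (s + α * Complex.I))) =
      conj (Ψ (s + α * Complex.I)) / G (Ψ (s + α * Complex.I)) * Complex.I by ring]
    simp

end

/-! ### Holomorphic functions on the disc and the basic level inequalities -/

section

variable {Ω : Set ℂ} {u : ℂ → ℝ} {G G₁ G₂ W φ Ψ B ℓ b : ℂ → ℂ} {a : ℂ}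

/-- The holomorphic functions on the unit disc attached to an exterior map `φ`: its regular part
`B`, the logarithm `ℓ` of `ζ / G (φ ζ)`, and `b = ζ ℓ'`. -/
structure IsDiscModel (G G₁ G₂ φ : ℂ → ℂ) (a : ℂ) (B ℓ b : ℂ → ℂ) : Prop where
  diff_B : DifferentiableOn ℂ B (Metric.ball 0 1)
  φ_eq : ∀ ζ, ζ ≠ 0 → ‖ζ‖ < 1 → φ ζ = a / ζ + B ζ
  inv_G : ∀ ζ, ζ ≠ 0 → ‖ζ‖ < 1 → 1 / G (φ ζ) = a / ζ - ζ * deriv B ζ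
  diff_b : DifferentiableOn ℂ b (Metric.ball 0 1)
  b_zero : b 0 = 0
  b_eq : ∀ ζ, ζ ≠ 0 → ‖ζ‖ < 1 → b ζ = 1 + G₁ (φ ζ) / G (φ ζ) ^ 2
  mul_deriv_b : ∀ ζ, ζ ≠ 0 → ‖ζ‖ < 1 → ζ * deriv b ζ =
    -(G₂ (φ ζ) / G (φ ζ) ^ 3 - 2 * G₁ (φ ζ) ^ 2 / G (φ ζ) ^ 4)
  diff_ℓ : DifferentiableOn ℂ ℓ (Metric.ball 0 1)
  mul_deriv_ℓ : ∀ ζ, ‖ζ‖ < 1 → ζ * deriv ℓ ζ = b ζ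
  re_ℓ : ∀ ζ, ζ ≠ 0 → ‖ζ‖ < 1 → (ℓ ζ).re = Real.log ‖ζ‖ - Real.log ‖G (φ ζ)‖

/-- A nonvanishing holomorphic function on a disc has a logarithm. -/
lemma exists_log_of_ne_zero {p : ℂ → ℂ} (hp : DifferentiableOn ℂ p (Metric.ball 0 1))
    (hp0 : ∀ ζ ∈ Metric.ball (0 : ℂ) 1, p ζ ≠ 0) :
    ∃ ℓ : ℂ → ℂ, (∀ ζ ∈ Metric.ball (0 : ℂ) 1, HasDerivAt ℓ (deriv p ζ / p ζ) ζ) ∧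
      ∀ ζ ∈ Metric.ball (0 : ℂ) 1, Complex.exp (ℓ ζ) = p ζ := by
  have h0 : (0 : ℂ) ∈ Metric.ball (0 : ℂ) 1 := Metric.mem_ball_self one_pos
  obtain ⟨ℓ, hℓ0, hℓ⟩ := ((hp.deriv Metric.isOpen_ball).div hp hp0).isExactOn_ball.with_val_at 0
    (Complex.log (p 0))
  refine ⟨ℓ, hℓ, fun ζ hζ => ?_⟩
  have hd : ∀ z ∈ Metric.ball (0 : ℂ) 1, HasDerivAt (fun z => p z * Complex.exp (-ℓ z)) 0 z := by
    intro z hz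
    have h1 := (hp.differentiableAt (Metric.isOpen_ball.mem_nhds hz)).hasDerivAt.fun_mul
      (hℓ z hz).neg.cexp
    convert! h1 using 1
    have := hp0 z hz
    simp only [Pi.neg_apply, Pi.div_apply]
    field_simp
    ring
  have h1 := Metric.isOpen_ball.is_const_of_deriv_eq_zero (convex_ball (0 : ℂ) 1).isPreconnected
    (fun z hz => (hd z hz).differentiableAt.differentiableWithinAt) (fun z hz => (hd z hz).deriv)
    hζ h0
  simp only [hℓ0] at h1
  rw [Complex.exp_neg, Complex.exp_neg, Complex.exp_log (hp0 0 h0), mul_inv_cancel₀ (hp0 0 h0)] at h1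
  exact (eq_of_div_eq_one (by rwa [div_eq_mul_inv])).symm

lemma IsSmoothPotential.hasDerivAt_G (h : IsSmoothPotential Ω u G G₁ G₂) {z : ℂ} (hz : z ∈ Ω) :
    HasDerivAt G (G₁ z) z := (h.hasDerivWithinAt z (subset_closure hz)).hasDerivAt
      (mem_of_superset (h.isOpen.mem_nhds hz) subset_closure)

lemma IsSmoothPotential.hasDerivAt_G₁ (h : IsSmoothPotential Ω u G G₁ G₂) {z : ℂ} (hz : z ∈ Ω) :
    HasDerivAt G₁ (G₂ z) z := (h.hasDerivWithinAt₁ z (subset_closure hz)).hasDerivAt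
      (mem_of_superset (h.isOpen.mem_nhds hz) subset_closure)

/-- The function `ζ φ ζ` has a removable singularity at `0` with value `a`, which yields `B`. The
differential equation of `φ` reads `1 / G (φ ζ) = -ζ φ' ζ`, hence `ζ / G (φ ζ) = a - ζ² B' ζ`. This
is holomorphic and nonvanishing, also at `0`, so it has a logarithm `ℓ`. -/
theorem IsSmoothPotential.exists_discModel (h : IsSmoothPotential Ω u G G₁ G₂)
    (hm : IsExteriorMap Ω u G W φ a) : ∃ B ℓ b, IsDiscModel G G₁ G₂ φ a B ℓ b := by
  have hball : ∀ {ζ : ℂ}, ‖ζ‖ < 1 → ζ ∈ Metric.ball (0 : ℂ) 1 := fun {ζ} h => by simpa using h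
  have hball' : ∀ {ζ : ℂ}, ζ ∈ Metric.ball (0 : ℂ) 1 → ‖ζ‖ < 1 := fun {ζ} h => by simpa using h
  have h0 : (0 : ℂ) ∈ Metric.ball (0 : ℂ) 1 := Metric.mem_ball_self one_pos
  have hnear : ∀ {ζ : ℂ}, ζ ≠ 0 → ‖ζ‖ < 1 → ∀ᶠ z in 𝓝 ζ, z ≠ 0 ∧ ‖z‖ < 1 := by
    intro ζ h1 h2
    filter_upwards [isOpen_ne.mem_nhds h1, Metric.isOpen_ball.mem_nhds (hball h2)] with z hz hz'
    exact ⟨hz, hball' hz'⟩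
  set N : ℂ → ℂ := Function.update (fun ζ => ζ * φ ζ) 0 a with hN
  have hNne : ∀ ζ, ζ ≠ 0 → N ζ = ζ * φ ζ := fun ζ hζ => by rw [hN, Function.update_of_ne hζ]
  have hN0 : N 0 = a := by simp [hN]
  have hNdiff : DifferentiableOn ℂ N (Metric.ball 0 1) := by
    rw [← Complex.differentiableOn_compl_singleton_and_continuousAt_iff
      (Metric.isOpen_ball.mem_nhds h0)]
    refine ⟨fun ζ hζ => ?_, continuousAt_update_same.mpr hm.tendsto_zero⟩
    have h1 := (hasDerivAt_id ζ).fun_mul (hm.hasDerivAt_φ ζ hζ.2 (hball' hζ.1))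
    refine (h1.differentiableAt.congr_of_eventuallyEq ?_).differentiableWithinAt
    filter_upwards [isOpen_ne.mem_nhds hζ.2] with z hz
    exact hNne z hz
  set B : ℂ → ℂ := dslope N 0 with hB
  have hBdiff : DifferentiableOn ℂ B (Metric.ball 0 1) :=
    (Complex.differentiableOn_dslope (Metric.isOpen_ball.mem_nhds h0)).mpr hNdiff
  have hNB : ∀ ζ, N ζ = a + ζ * B ζ := by
    intro ζ
    have h1 := sub_smul_dslope N 0 ζ
    rw [sub_zero, smul_eq_mul, hN0] at h1
    linear_combination -h1
  have hφ : ∀ ζ, ζ ≠ 0 → φ ζ = a / ζ + B ζ := by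
    intro ζ hζ
    have := hNB ζ
    rw [hNne ζ hζ] at this
    field_simp
    linear_combination this
  have hinv : ∀ ζ, ζ ≠ 0 → ‖ζ‖ < 1 → 1 / G (φ ζ) = a / ζ - ζ * deriv B ζ := by
    intro ζ hζ hζ1
    have h1 := hm.hasDerivAt_φ ζ hζ hζ1
    have h2 : HasDerivAt φ (a * -(ζ ^ 2)⁻¹ + deriv B ζ) ζ := by
      have := ((hasDerivAt_inv hζ).const_mul a).fun_add
        (hBdiff.differentiableAt (Metric.isOpen_ball.mem_nhds (hball hζ1))).hasDerivAt
      refine this.congr_of_eventuallyEq ?_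
      filter_upwards [isOpen_ne.mem_nhds hζ] with z hz
      rw [hφ z hz]; ring
    have h3 := h1.unique h2
    have hG := hm.G_ne_zero _ (hm.mapsTo ζ hζ hζ1)
    field_simp at h3 ⊢
    linear_combination -h3
  set p : ℂ → ℂ := fun ζ => a - ζ ^ 2 * deriv B ζ with hp
  have hpdiff : DifferentiableOn ℂ p (Metric.ball 0 1) :=
    (differentiableOn_const a).sub ((differentiableOn_id.pow 2).mul (hBdiff.deriv Metric.isOpen_ball))
  have hpG : ∀ ζ, ζ ≠ 0 → ‖ζ‖ < 1 → p ζ = ζ / G (φ ζ) := by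
    intro ζ hζ hζ1
    rw [div_eq_mul_one_div, hinv ζ hζ hζ1]
    simp only [hp]
    field_simp
  have hpne : ∀ ζ ∈ Metric.ball (0 : ℂ) 1, p ζ ≠ 0 := by
    intro ζ hζ
    rcases eq_or_ne ζ 0 with rfl | hne
    · simpa [hp] using hm.a_ne_zero
    · rw [hpG ζ hne (hball' hζ)]
      exact div_ne_zero hne (hm.G_ne_zero _ (hm.mapsTo ζ hne (hball' hζ)))
  obtain ⟨ℓ, hℓ, hexp⟩ := exists_log_of_ne_zero hpdiff hpne
  set b : ℂ → ℂ := fun ζ => ζ * (deriv p ζ / p ζ) with hb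
  have hbeq : ∀ ζ, ζ ≠ 0 → ‖ζ‖ < 1 → b ζ = 1 + G₁ (φ ζ) / G (φ ζ) ^ 2 := by
    intro ζ hζ hζ1
    have hΩ := hm.mapsTo ζ hζ hζ1
    have hG := hm.G_ne_zero _ hΩ
    have h1 := (hasDerivAt_id ζ).fun_div
      ((h.hasDerivAt_G hΩ).comp ζ (hm.hasDerivAt_φ ζ hζ hζ1)) hG
    have h2 := h1.congr_of_eventuallyEq (f₁ := p) (by
      filter_upwards [hnear hζ hζ1] with z hz
      rw [hpG z hz.1 hz.2]; rfl)
    simp only [hb]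
    rw [h2.deriv, hpG ζ hζ hζ1]
    simp only [Function.comp_apply, id]
    field_simp
    ring
  refine ⟨B, ℓ, b, hBdiff, fun ζ hζ _ => hφ ζ hζ, hinv,
    differentiableOn_id.mul ((hpdiff.deriv Metric.isOpen_ball).div hpdiff hpne), by simp [hb], hbeq,
    fun ζ hζ hζ1 => ?_, fun ζ hζ => (hℓ ζ hζ).differentiableAt.differentiableWithinAt,
    fun ζ hζ1 => ?_, fun ζ hζ hζ1 => ?_⟩
  · have hΩ := hm.mapsTo ζ hζ hζ1
    have hG := hm.G_ne_zero _ hΩ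
    have hφd := hm.hasDerivAt_φ ζ hζ hζ1
    have h1 := (((h.hasDerivAt_G₁ hΩ).comp ζ hφd).fun_div
      (((h.hasDerivAt_G hΩ).comp ζ hφd).fun_pow 2) (pow_ne_zero 2 hG)).const_add 1
    have h2 := h1.congr_of_eventuallyEq (f₁ := b) (by
      filter_upwards [hnear hζ hζ1] with z hz
      rw [hbeq z hz.1 hz.2]; rfl)
    rw [h2.deriv]
    simp only [Function.comp_apply]
    field_simp
    ring
  · rw [(hℓ ζ (hball hζ1)).deriv]
  · have h1 := congrArg norm (hexp ζ (hball hζ1))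
    rw [Complex.norm_exp, hpG ζ hζ hζ1, norm_div] at h1
    have hG := norm_ne_zero_iff.mpr (hm.G_ne_zero _ (hm.mapsTo ζ hζ hζ1))
    rw [← Real.log_exp (ℓ ζ).re, h1, Real.log_div (norm_ne_zero_iff.mpr hζ) hG]

lemma exists_ne_of_deriv_ne_zero {P : ℂ → ℂ} {ζ : ℂ} (hζ : ‖ζ‖ < 1) (hd : deriv P ζ ≠ 0) :
    ∃ z ∈ Metric.ball (0 : ℂ) 1, P z ≠ P 0 := by
  by_contra hcon
  push Not at hcon
  refine hd ?_
  have : P =ᶠ[𝓝 ζ] fun _ => P 0 := by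
    filter_upwards [Metric.isOpen_ball.mem_nhds (show ζ ∈ Metric.ball (0 : ℂ) 1 by simpa using hζ)]
      with z hz
    exact hcon z hz
  rw [this.deriv_eq, deriv_const]

lemma polarPt_ne_zero {r : ℝ} (hr : 0 < r) (θ : ℝ) : polarPt r θ ≠ 0 := by
  rw [← norm_pos_iff, norm_polarPt, abs_of_pos hr]; exact hr

lemma norm_polarPt_lt_one {r : ℝ} (hr : r ∈ Ioo (0 : ℝ) 1) (θ : ℝ) : ‖polarPt r θ‖ < 1 := by
  rw [norm_polarPt, abs_of_pos hr.1]; exact hr.2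

/-- Since `Ψ z = φ (e^{-z})`, increasing `α` runs clockwise on the circle of radius `r`. Reflection
and periodicity undo the reversal. -/
lemma IsHalfPlaneMap.levelIntegral_eq (hΨ : IsHalfPlaneMap Ω u G φ Ψ) (H : ℂ → ℝ) {r : ℝ}
    (hr : r ∈ Ioo (0 : ℝ) 1) : levelIntegral Ψ H (-Real.log r) =
      ∫ θ in (0 : ℝ)..(2 * π), H (φ (polarPt r θ)) := by
  have hlog : 0 < -Real.log r := by linarith [Real.log_neg hr.1 hr.2]
  have h1 : ∀ α : ℝ, Ψ (((-Real.log r : ℝ) : ℂ) + α * Complex.I) = φ (polarPt r (-α)) := by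
    intro α
    rw [hΨ.eq_φ _ (by simpa using hlog), polarPt]
    congr 1
    rw [neg_add, Complex.exp_add, ← Complex.ofReal_neg, neg_neg, ← Complex.ofReal_exp,
      Real.exp_log hr.1]
    push_cast; ring_nf
  simp only [levelIntegral, h1]
  rw [intervalIntegral.integral_comp_neg (f := fun θ => H (φ (polarPt r θ)))]
  have hp : Function.Periodic (fun θ : ℝ => H (φ (polarPt r θ))) (2 * π) := by
    intro θ
    simp only [polarPt]
    rw [Complex.ofReal_add, add_mul, show ((2 * π : ℝ) : ℂ) * Complex.I = 2 * π * Complex.I by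
      push_cast; ring, Complex.exp_periodic]
  have := hp.intervalIntegral_add_eq (-(2 * π)) 0
  simpa using this

lemma IsHalfPlaneMap.continuousOn_levelIntegral_log (hΨ : IsHalfPlaneMap Ω u G φ Ψ) {H : ℂ → ℝ}
    (hH : ContinuousOn H (closure Ω)) :
    ContinuousOn (fun r => levelIntegral Ψ H (-Real.log r)) (Ioc 0 1) :=
  (hΨ.continuousOn_integral hH 0 (2 * π)).comp
    (Real.continuousOn_log.mono fun r hr => hr.1.ne').neg
    fun r hr => by
      have := Real.log_nonpos hr.1.le hr.2
      simpa using this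

/-- The domain is the exterior of a disc: `G = 1 / (z - z₀)`. -/
def IsRound (Ω : Set ℂ) (G G₁ : ℂ → ℂ) : Prop := ∀ z ∈ Ω, 1 + G₁ z / G z ^ 2 = 0

lemma IsDiscModel.exists_b_ne_zero (hd : IsDiscModel G G₁ G₂ φ a B ℓ b)
    (hm : IsExteriorMap Ω u G W φ a) (hnr : ¬ IsRound Ω G G₁) :
    ∃ ζ, ζ ≠ 0 ∧ ‖ζ‖ < 1 ∧ b ζ ≠ 0 := by
  unfold IsRound at hnr
  push Not at hnr
  obtain ⟨z, hz, hne⟩ := hnr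
  have h0 : W z ≠ 0 := by rw [← norm_pos_iff, hm.norm_W z hz]; exact Real.exp_pos _
  have h1 : ‖W z‖ < 1 := by
    rw [hm.norm_W z hz, Real.exp_lt_one_iff]; linarith [hm.u_pos z hz]
  refine ⟨W z, h0, h1, ?_⟩
  rwa [hd.b_eq _ h0 h1, hm.φ_W z hz]

/-- `Re b` as a function on `closure Ω`. -/
def reB (G G₁ : ℂ → ℂ) (z : ℂ) : ℝ := (1 + G₁ z / G z ^ 2).re

lemma continuousOn_b (h : IsSmoothPotential Ω u G G₁ G₂) (hΨ : IsHalfPlaneMap Ω u G φ Ψ) :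
    ContinuousOn (fun z => 1 + G₁ z / G z ^ 2) (closure Ω) :=
  continuousOn_const.add (h.continuousOn_G₁.div (h.continuousOn_G.pow 2)
    fun z hz => pow_ne_zero 2 (hΨ.G_ne_zero z hz))

lemma continuousOn_reB (h : IsSmoothPotential Ω u G G₁ G₂) (hΨ : IsHalfPlaneMap Ω u G φ Ψ) :
    ContinuousOn (reB G G₁) (closure Ω) :=
  Complex.continuous_re.comp_continuousOn (continuousOn_b h hΨ)

/-- The weighted inequality behind the covariance estimates. -/
theorem levelIntegral_rpow_pos (h : IsSmoothPotential Ω u G G₁ G₂)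
    (hm : IsExteriorMap Ω u G W φ a) (hΨ : IsHalfPlaneMap Ω u G φ Ψ)
    (hnr : ¬ IsRound Ω G G₁) {e : ℝ} (he : e ≠ 0) {s : ℝ} (hs : 0 ≤ s) :
    0 < e * levelIntegral Ψ (fun z => ‖G z‖ ^ (-e) * reB G G₁ z) s := by
  obtain ⟨B, ℓ, b, hd⟩ := h.exists_discModel hm
  -- On `|ζ| = r` one has `|P|² = r^e |G|^{-e}` and `ζ P' = (e/2) b P`. The pairing of `P` is
  -- therefore the weighted integral of `Re b`, up to the factor `r^e` kept in `X`.
  set P : ℂ → ℂ := fun ζ => Complex.exp ((e / 2 : ℝ) * ℓ ζ) with hP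
  have hPd : ∀ ζ, ‖ζ‖ < 1 → HasDerivAt P (P ζ * ((e / 2 : ℝ) * deriv ℓ ζ)) ζ := by
    intro ζ hζ
    exact ((hd.diff_ℓ.differentiableAt (Metric.isOpen_ball.mem_nhds
      (by simpa using hζ))).hasDerivAt.const_mul _).cexp
  have hPdiff : DifferentiableOn ℂ P (Metric.ball 0 1) := fun ζ hζ =>
    (hPd ζ (by simpa using hζ)).differentiableAt.differentiableWithinAt
  have he2 : ((e / 2 : ℝ) : ℂ) ≠ 0 := by exact_mod_cast div_ne_zero he two_ne_zero
  obtain ⟨ζ₀, hζ0, hζ1, hbζ⟩ := hd.exists_b_ne_zero hm hnr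
  have hnc : ∃ z ∈ Metric.ball (0 : ℂ) 1, P z ≠ P 0 := by
    refine exists_ne_of_deriv_ne_zero hζ1 ?_
    rw [(hPd ζ₀ hζ1).deriv]
    refine mul_ne_zero (Complex.exp_ne_zero _) (mul_ne_zero he2 fun h0 => hbζ ?_)
    rw [← hd.mul_deriv_ℓ ζ₀ hζ1, h0, mul_zero]
  set H : ℂ → ℝ := fun z => ‖G z‖ ^ (-e) * reB G G₁ z with hH
  have hHc : ContinuousOn H (closure Ω) :=
    (h.continuousOn_G.norm.rpow_const fun z hz =>
      Or.inl (norm_ne_zero_iff.mpr (hΨ.G_ne_zero z hz))).mul (continuousOn_reB h hΨ)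
  set X : ℝ → ℝ := fun r => r ^ e * (e * levelIntegral Ψ H (-Real.log r)) with hX
  have hXc : ContinuousOn X (Ioc 0 1) :=
    (continuousOn_id.rpow_const fun r hr => Or.inl hr.1.ne').mul
      (continuousOn_const.mul (hΨ.continuousOn_levelIntegral_log hHc))
  have hXP : ∀ r ∈ Ioo (0 : ℝ) 1, X r = 2 * discPairing P r := by
    intro r hr
    simp only [hX]
    rw [hΨ.levelIntegral_eq H hr, discPairing, ← mul_assoc, ← intervalIntegral.integral_const_mul,
      ← intervalIntegral.integral_const_mul]
    refine intervalIntegral.integral_congr fun θ _ => ?_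
    set ζ := polarPt r θ with hζ
    have hζne := polarPt_ne_zero hr.1 θ
    have hζlt := norm_polarPt_lt_one hr θ
    rw [← hζ] at hζne hζlt
    have hnζ : ‖ζ‖ = r := by rw [hζ, norm_polarPt, abs_of_pos hr.1]
    have hG := norm_pos_iff.mpr (hm.G_ne_zero _ (hm.mapsTo ζ hζne hζlt))
    have h1 : ‖P ζ‖ ^ 2 = r ^ e * ‖G (φ ζ)‖ ^ (-e) := by
      rw [hP, Complex.norm_exp, Complex.re_ofReal_mul, hd.re_ℓ ζ hζne hζlt, hnζ,
        Real.rpow_def_of_pos hr.1, Real.rpow_def_of_pos hG, ← Real.exp_add, ← Real.exp_nat_mul]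
      congr 1
      push_cast; ring
    have h2 : conj (P ζ) * (ζ * deriv P ζ) = ((‖P ζ‖ ^ 2 * (e / 2) : ℝ) : ℂ) * b ζ := by
      rw [(hPd ζ hζlt).deriv, ← hd.mul_deriv_ℓ ζ hζlt]
      push_cast
      rw [← Complex.conj_mul']; ring
    rw [h2, Complex.re_ofReal_mul, h1, hd.b_eq ζ hζne hζlt]
    simp only [hH, reB]
    ring
  have hr : Real.exp (-s) ∈ Ioc (0 : ℝ) 1 := ⟨Real.exp_pos _, by simpa using hs⟩
  have := pos_of_eq_discPairing hPdiff hnc hXc two_pos hXP hr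
  simp only [hX, Real.log_exp, neg_neg] at this
  exact pos_of_mul_pos_right this (by positivity)

/-- A relation between levels that holds in the interior holds on the boundary. -/
lemma IsHalfPlaneMap.levelIntegral_nonneg_of_interior (hΨ : IsHalfPlaneMap Ω u G φ Ψ) {H : ℂ → ℝ}
    (hH : ContinuousOn H (closure Ω))
    (h0 : ∀ r ∈ Ioo (0 : ℝ) 1, 0 ≤ levelIntegral Ψ H (-Real.log r)) {s : ℝ} (hs : 0 ≤ s) :
    0 ≤ levelIntegral Ψ H s := by
  have h1 : ∀ s ∈ Ioi (0 : ℝ), 0 ≤ levelIntegral Ψ H s := by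
    intro s hs
    have := h0 (Real.exp (-s)) ⟨Real.exp_pos _, by simpa using hs⟩
    rwa [Real.log_exp, neg_neg] at this
  have hc : ContinuousOn (levelIntegral Ψ H) (Ici 0) := hΨ.continuousOn_integral hH 0 (2 * π)
  have h2 : MapsTo (levelIntegral Ψ H) (closure (Ioi 0)) (closure (Ici 0)) :=
    MapsTo.closure_of_continuousOn h1 (by rwa [closure_Ioi])
  rw [closure_Ioi, closure_Ici] at h2
  exact h2 hs

/-- Mean value property with `b 0 = 0`; geometrically, the total curvature of a level curve is `2π`.
The boundary level follows by closing the two inequalities separately. -/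
lemma levelIntegral_reB (h : IsSmoothPotential Ω u G G₁ G₂) (hm : IsExteriorMap Ω u G W φ a)
    (hΨ : IsHalfPlaneMap Ω u G φ Ψ) {s : ℝ} (hs : 0 ≤ s) : levelIntegral Ψ (reB G G₁) s = 0 := by
  obtain ⟨B, ℓ, b, hd⟩ := h.exists_discModel hm
  have key : ∀ r ∈ Ioo (0 : ℝ) 1, levelIntegral Ψ (reB G G₁) (-Real.log r) = 0 := by
    intro r hr
    rw [hΨ.levelIntegral_eq _ hr]
    have h1 := integral_polarPt_of_differentiableOn hd.diff_b hr.1.le hr.2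
    rw [hd.b_zero, mul_zero] at h1
    have hc := continuous_comp_polarPt hd.diff_b.continuousOn hr.1.le hr.2
    have h2 := Complex.reCLM.intervalIntegral_comp_comm
      (hc.intervalIntegrable (μ := volume) 0 (2 * π))
    rw [h1] at h2
    simp only [Complex.reCLM_apply, Complex.zero_re] at h2
    refine Eq.trans (intervalIntegral.integral_congr fun θ _ => ?_) h2
    rw [hd.b_eq _ (polarPt_ne_zero hr.1 θ) (norm_polarPt_lt_one hr θ)]
    rfl
  refine le_antisymm ?_ (hΨ.levelIntegral_nonneg_of_interior (continuousOn_reB h hΨ)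
    (fun r hr => (key r hr).ge) hs)
  have h1 := hΨ.levelIntegral_nonneg_of_interior (continuousOn_reB h hΨ).neg (fun r hr => by
    have := key r hr
    simp only [levelIntegral, Pi.neg_apply, intervalIntegral.integral_neg] at this ⊢
    rw [this, neg_zero]) hs
  simp only [levelIntegral, Pi.neg_apply, intervalIntegral.integral_neg] at h1 ⊢
  linarith

/-- On a circle `-log |G| = Re ℓ - log r`. The constant is annihilated by `Re b`, and `Re ℓ · Re (ζ
ℓ')` integrates to half the pairing of `ℓ`. -/
theorem levelIntegral_log_pos (h : IsSmoothPotential Ω u G G₁ G₂)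
    (hm : IsExteriorMap Ω u G W φ a) (hΨ : IsHalfPlaneMap Ω u G φ Ψ)
    (hnr : ¬ IsRound Ω G G₁) {s : ℝ} (hs : 0 ≤ s) :
    0 < levelIntegral Ψ (fun z => reB G G₁ z * -Real.log ‖G z‖) s := by
  obtain ⟨B, ℓ, b, hd⟩ := h.exists_discModel hm
  obtain ⟨ζ₀, hζ0, hζ1, hbζ⟩ := hd.exists_b_ne_zero hm hnr
  have hnc : ∃ z ∈ Metric.ball (0 : ℂ) 1, ℓ z ≠ ℓ 0 := by
    refine exists_ne_of_deriv_ne_zero hζ1 fun h0 => hbζ ?_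
    rw [← hd.mul_deriv_ℓ ζ₀ hζ1, h0, mul_zero]
  set H : ℂ → ℝ := fun z => reB G G₁ z * -Real.log ‖G z‖ with hH
  have hHc : ContinuousOn H (closure Ω) := (continuousOn_reB h hΨ).mul
    (h.continuousOn_G.norm.log fun z hz => norm_ne_zero_iff.mpr (hΨ.G_ne_zero z hz)).neg
  have hXP : ∀ r ∈ Ioo (0 : ℝ) 1, levelIntegral Ψ H (-Real.log r) = 1 / 2 * discPairing ℓ r := by
    intro r hr
    have h0 := levelIntegral_reB h hm hΨ (s := -Real.log r)
      (by linarith [Real.log_neg hr.1 hr.2])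
    rw [hΨ.levelIntegral_eq _ hr] at h0 ⊢
    rw [← integral_re_mul_re_deriv hd.diff_ℓ hr.1.le hr.2]
    have hc : Continuous fun θ => (b (polarPt r θ)).re :=
      Complex.continuous_re.comp (continuous_comp_polarPt hd.diff_b.continuousOn hr.1.le hr.2)
    have hcℓ : Continuous fun θ => (ℓ (polarPt r θ)).re :=
      Complex.continuous_re.comp (continuous_comp_polarPt hd.diff_ℓ.continuousOn hr.1.le hr.2)
    have hb : ∀ θ, reB G G₁ (φ (polarPt r θ)) = (b (polarPt r θ)).re := fun θ => by
      rw [hd.b_eq _ (polarPt_ne_zero hr.1 θ) (norm_polarPt_lt_one hr θ)]; rfl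
    simp only [hb] at h0
    have h2 : ∀ θ, H (φ (polarPt r θ)) = (ℓ (polarPt r θ)).re *
        (polarPt r θ * deriv ℓ (polarPt r θ)).re - Real.log r * (b (polarPt r θ)).re := by
      intro θ
      rw [hd.mul_deriv_ℓ _ (norm_polarPt_lt_one hr θ),
        hd.re_ℓ _ (polarPt_ne_zero hr.1 θ) (norm_polarPt_lt_one hr θ), norm_polarPt,
        abs_of_pos hr.1]
      simp only [hH, hb]
      ring
    simp only [h2]
    rw [intervalIntegral.integral_sub, intervalIntegral.integral_const_mul, h0, mul_zero, sub_zero]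
    · refine Continuous.intervalIntegrable ?_ _ _
      simp only [hd.mul_deriv_ℓ _ (norm_polarPt_lt_one hr _)]
      exact hcℓ.mul hc
    · exact (continuous_const.mul hc).intervalIntegrable _ _
  have hr : Real.exp (-s) ∈ Ioc (0 : ℝ) 1 := ⟨Real.exp_pos _, by simpa using hs⟩
  have := pos_of_eq_discPairing hd.diff_ℓ hnc (hΨ.continuousOn_levelIntegral_log hHc) one_half_pos
    hXP hr
  simpa only [Real.log_exp, neg_neg] using this

/-- The tangential derivative of `Re b`, up to a factor. -/
def imZDerivB (G G₁ G₂ : ℂ → ℂ) (z : ℂ) : ℝ := (-(G₂ z / G z ^ 3 - 2 * G₁ z ^ 2 / G z ^ 4)).im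

lemma continuousOn_imZDerivB (h : IsSmoothPotential Ω u G G₁ G₂)
    (hΨ : IsHalfPlaneMap Ω u G φ Ψ) : ContinuousOn (imZDerivB G G₁ G₂) (closure Ω) := by
  refine Complex.continuous_im.comp_continuousOn (ContinuousOn.neg ?_)
  exact (h.continuousOn₂.div (h.continuousOn_G.pow 3)
      fun z hz => pow_ne_zero 3 (hΨ.G_ne_zero z hz)).sub
    ((continuousOn_const.mul (h.continuousOn_G₁.pow 2)).div (h.continuousOn_G.pow 4)
      fun z hz => pow_ne_zero 4 (hΨ.G_ne_zero z hz))

/-- For `P = i b` the real parts of `P` and `ζ P'` are `-Im b` and `-Im (ζ b')`, so the integral is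
half the pairing of `P`. -/
theorem levelIntegral_deriv_pos (h : IsSmoothPotential Ω u G G₁ G₂)
    (hm : IsExteriorMap Ω u G W φ a) (hΨ : IsHalfPlaneMap Ω u G φ Ψ)
    (hnr : ¬ IsRound Ω G G₁) {s : ℝ} (hs : 0 ≤ s) :
    0 < levelIntegral Ψ (fun z => (1 + G₁ z / G z ^ 2).im * imZDerivB G G₁ G₂ z) s := by
  obtain ⟨B, ℓ, b, hd⟩ := h.exists_discModel hm
  obtain ⟨ζ₀, hζ0, hζ1, hbζ⟩ := hd.exists_b_ne_zero hm hnr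
  set P : ℂ → ℂ := fun ζ => Complex.I * b ζ with hP
  have hPdiff : DifferentiableOn ℂ P (Metric.ball 0 1) := hd.diff_b.const_mul _
  have hnc : ∃ z ∈ Metric.ball (0 : ℂ) 1, P z ≠ P 0 := by
    refine ⟨ζ₀, by simpa using hζ1, ?_⟩
    simp only [hP, hd.b_zero, mul_zero]
    exact mul_ne_zero Complex.I_ne_zero hbζ
  set H : ℂ → ℝ := fun z => (1 + G₁ z / G z ^ 2).im * imZDerivB G G₁ G₂ z with hH
  have hHc : ContinuousOn H (closure Ω) :=
    (Complex.continuous_im.comp_continuousOn (continuousOn_b h hΨ)).mul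
      (continuousOn_imZDerivB h hΨ)
  have hXP : ∀ r ∈ Ioo (0 : ℝ) 1, levelIntegral Ψ H (-Real.log r) = 1 / 2 * discPairing P r := by
    intro r hr
    rw [hΨ.levelIntegral_eq _ hr, ← integral_re_mul_re_deriv hPdiff hr.1.le hr.2]
    refine intervalIntegral.integral_congr fun θ _ => ?_
    have hne := polarPt_ne_zero hr.1 θ
    have hlt := norm_polarPt_lt_one hr θ
    have h1 : deriv P (polarPt r θ) = Complex.I * deriv b (polarPt r θ) :=
      (hd.diff_b.differentiableAt (Metric.isOpen_ball.mem_nhds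
        (polarPt_mem_ball hr.1.le hr.2))).hasDerivAt.const_mul Complex.I |>.deriv
    simp only [hH, imZDerivB]
    rw [h1, mul_left_comm, hd.mul_deriv_b _ hne hlt]
    simp only [hP]
    rw [hd.b_eq _ hne hlt]
    simp
    ring
  have hr : Real.exp (-s) ∈ Ioc (0 : ℝ) 1 := ⟨Real.exp_pos _, by simpa using hs⟩
  have := pos_of_eq_discPairing hPdiff hnc (hΨ.continuousOn_levelIntegral_log hHc) one_half_pos
    hXP hr
  simpa only [Real.log_exp, neg_neg] using this

end

/-! ### The area theorem and the case of concentric circles -/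

section

variable {Ω : Set ℂ} {u : ℂ → ℝ} {G G₁ G₂ W φ Ψ B ℓ b : ℂ → ℂ} {a : ℂ}

lemma integral_re_polarPt_eq_zero {Q : ℂ → ℂ} (hQ : DifferentiableOn ℂ Q (Metric.ball 0 1))
    (hQ0 : Q 0 = 0) {r : ℝ} (hr : r ∈ Ioo (0 : ℝ) 1) :
    ∫ θ in (0 : ℝ)..(2 * π), (Q (polarPt r θ)).re = 0 := by
  have h1 := integral_polarPt_of_differentiableOn hQ hr.1.le hr.2
  rw [hQ0, mul_zero] at h1
  have hc := continuous_comp_polarPt hQ.continuousOn hr.1.le hr.2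
  have h2 := Complex.reCLM.intervalIntegral_comp_comm
    (hc.intervalIntegrable (μ := volume) 0 (2 * π))
  rw [h1] at h2
  simpa using h2

lemma conj_polarPt {r : ℝ} (hr : 0 < r) (θ : ℝ) : conj (polarPt r θ) = r ^ 2 / polarPt r θ := by
  rw [eq_div_iff (polarPt_ne_zero hr θ), Complex.conj_mul', norm_polarPt, abs_of_pos hr]

lemma continuous_discPairing_integrand {P : ℂ → ℂ} (hP : DifferentiableOn ℂ P (Metric.ball 0 1))
    {r : ℝ} (hr : r ∈ Ioo (0 : ℝ) 1) : Continuous fun θ =>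
      (conj (P (polarPt r θ)) * (polarPt r θ * deriv P (polarPt r θ))).re := by
  have h1 := continuous_comp_polarPt hP.continuousOn hr.1.le hr.2
  have h2 := continuous_comp_polarPt (hP.deriv Metric.isOpen_ball).continuousOn hr.1.le hr.2
  have h3 : Continuous fun θ => polarPt r θ := by unfold polarPt; fun_prop
  exact Complex.continuous_re.comp ((Complex.continuous_conj.comp h1).mul (h3.mul h2))

/-- The area theorem: twice the area enclosed by an interior level curve. -/
lemma IsDiscModel.levelIntegral_area (hd : IsDiscModel G G₁ G₂ φ a B ℓ b)
    (hΨ : IsHalfPlaneMap Ω u G φ Ψ) {r : ℝ} (hr : r ∈ Ioo (0 : ℝ) 1) :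
    levelIntegral Ψ (areaDensity G) (-Real.log r) =
      2 * π * (‖a‖ ^ 2 / r ^ 2) - discPairing B r := by
  have hr0 := hr.1
  rw [hΨ.levelIntegral_eq _ hr]
  -- On `|ζ| = r` one has `conj ζ = r²/ζ`, which makes the cross terms of `a / ζ` with `B` the real
  -- part of this holomorphic function, up to `r²`. It vanishes at `0` and drops out of the mean.
  set Q : ℂ → ℂ := fun ζ => conj a * (ζ * B ζ - ζ ^ 2 * deriv B ζ) with hQ
  have hQd : DifferentiableOn ℂ Q (Metric.ball 0 1) :=
    ((differentiableOn_id.mul hd.diff_B).sub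
      ((differentiableOn_id.pow 2).mul (hd.diff_B.deriv Metric.isOpen_ball))).const_mul _
  have hkey : ∀ θ, areaDensity G (φ (polarPt r θ)) = ‖a‖ ^ 2 / r ^ 2 +
      (1 / r ^ 2) * (Q (polarPt r θ)).re -
      (conj (B (polarPt r θ)) * (polarPt r θ * deriv B (polarPt r θ))).re := by
    intro θ
    have hne := polarPt_ne_zero hr.1 θ
    have hlt := norm_polarPt_lt_one hr θ
    rw [areaDensity, div_eq_mul_one_div, hd.inv_G _ hne hlt, hd.φ_eq _ hne hlt]
    set ζ := polarPt r θ with hζ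
    have hc : conj ζ = (r : ℂ) ^ 2 / ζ := conj_polarPt hr.1 θ
    have hrne : (r : ℂ) ≠ 0 := by exact_mod_cast hr.1.ne'
    have e1 : conj (a / ζ + B ζ) * (a / ζ - ζ * deriv B ζ) =
        conj a * a / r ^ 2 - conj a * (ζ ^ 2 * deriv B ζ) / r ^ 2 + conj (B ζ) * (a / ζ) -
          conj (B ζ) * (ζ * deriv B ζ) := by
      rw [map_add, map_div₀, hc]
      field_simp
      ring
    have e2 : (conj (B ζ) * (a / ζ)).re = (conj a * (ζ * B ζ) / r ^ 2).re := by
      rw [← Complex.conj_re, map_mul, map_div₀, Complex.conj_conj, hc]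
      congr 1
      field_simp
    have e3 : ∀ z : ℂ, (z / (r : ℂ) ^ 2).re = 1 / r ^ 2 * z.re := by
      intro z
      rw [← Complex.ofReal_pow, Complex.div_ofReal_re]; ring
    rw [e1, Complex.sub_re, Complex.add_re, Complex.sub_re, e2, Complex.conj_mul', e3, e3, e3,
      ← Complex.ofReal_pow, Complex.ofReal_re]
    simp only [hQ, mul_sub, Complex.sub_re]
    ring
  have hcQ : Continuous fun θ => (Q (polarPt r θ)).re :=
    Complex.continuous_re.comp (continuous_comp_polarPt hQd.continuousOn hr.1.le hr.2)
  simp only [hkey]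
  rw [intervalIntegral.integral_sub, intervalIntegral.integral_add,
    intervalIntegral.integral_const_mul, integral_re_polarPt_eq_zero hQd (by simp [hQ]) hr]
  · simp [discPairing]
    ring
  · exact intervalIntegrable_const
  · exact (continuous_const.mul hcQ).intervalIntegrable _ _
  · exact (continuous_const.add (continuous_const.mul hcQ)).intervalIntegrable _ _
  · exact (continuous_discPairing_integrand hd.diff_B hr).intervalIntegrable _ _

/-- The enclosed area grows with the level. -/
lemma IsSmoothPotential.levelIntegral_area_pos (h : IsSmoothPotential Ω u G G₁ G₂)
    (hm : IsExteriorMap Ω u G W φ a) (hΨ : IsHalfPlaneMap Ω u G φ Ψ)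
    (h0 : 0 < levelIntegral Ψ (areaDensity G) 0) {s : ℝ} (hs : 0 ≤ s) :
    0 < levelIntegral Ψ (areaDensity G) s := by
  obtain ⟨B, ℓ, b, hd⟩ := h.exists_discModel hm
  rcases hs.lt_or_eq with hs' | rfl
  swap
  · exact h0
  -- The area `2π |a|² / r² - discPairing B r` decreases in `r`. The boundary value is its limit as
  -- `r → 1`, hence a lower bound.
  refine h0.trans_le ?_
  set r := Real.exp (-s) with hr
  have hr0 : 0 < r := Real.exp_pos _
  have hr1 : r < 1 := by rw [hr, Real.exp_lt_one_iff]; linarith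
  have hc := (hΨ.continuousOn_levelIntegral_log (continuousOn_areaDensity h hΨ)) 1 ⟨one_pos, le_rfl⟩
  have ht : Tendsto (fun r => levelIntegral Ψ (areaDensity G) (-Real.log r)) (𝓝[Ioo 0 1] 1)
      (𝓝 (levelIntegral Ψ (areaDensity G) 0)) := by
    have := hc.mono Ioo_subset_Ioc_self
    simpa [ContinuousWithinAt] using this
  have hne : (𝓝[Ioo (0 : ℝ) 1] 1).NeBot :=
    mem_closure_iff_nhdsWithin_neBot.mp (by rw [closure_Ioo zero_ne_one]; simp)
  refine le_of_tendsto ht ?_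
  have hev : ∀ᶠ x in 𝓝[Ioo (0 : ℝ) 1] 1, r < x := nhdsWithin_le_nhds (lt_mem_nhds hr1)
  filter_upwards [hev, self_mem_nhdsWithin] with x hx hx01
  have e : s = -Real.log r := by rw [hr, Real.log_exp, neg_neg]
  rw [e, hd.levelIntegral_area hΨ hx01, hd.levelIntegral_area hΨ ⟨hr0, hr1⟩]
  have h1 := discPairing_mono hd.diff_B hr0.le hx.le hx01.2
  have h2 : ‖a‖ ^ 2 / x ^ 2 ≤ ‖a‖ ^ 2 / r ^ 2 := by gcongr
  have h3 : 2 * π * (‖a‖ ^ 2 / x ^ 2) ≤ 2 * π * (‖a‖ ^ 2 / r ^ 2) := by gcongr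
  linarith

lemma IsSmoothPotential.continuousOn_inv_norm (h : IsSmoothPotential Ω u G G₁ G₂)
    (hΨ : IsHalfPlaneMap Ω u G φ Ψ) : ContinuousOn (fun z => ‖G z‖⁻¹) (closure Ω) :=
  h.continuousOn_G.norm.inv₀ fun z hz => norm_ne_zero_iff.mpr (hΨ.G_ne_zero z hz)

/-- The mean of `1/E²` dominates the area. -/
lemma IsSmoothPotential.levelIntegral_sq_sub_area_nonneg (h : IsSmoothPotential Ω u G G₁ G₂)
    (hm : IsExteriorMap Ω u G W φ a) (hΨ : IsHalfPlaneMap Ω u G φ Ψ) {s : ℝ} (hs : 0 ≤ s) :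
    0 ≤ levelIntegral Ψ (fun z => ‖G z‖⁻¹ ^ 2 - areaDensity G z) s := by
  obtain ⟨B, ℓ, b, hd⟩ := h.exists_discModel hm
  refine hΨ.levelIntegral_nonneg_of_interior (((h.continuousOn_inv_norm hΨ).pow 2).sub
    (continuousOn_areaDensity h hΨ)) (fun r hr => ?_) hs
  have hr0 := hr.1
  rw [hΨ.levelIntegral_eq _ hr]
  -- The cross terms again have mean zero. The difference reduces to the mean of `|ζ B'|²` plus the
  -- pairing of `B`, both nonnegative.
  set Q : ℂ → ℂ := fun ζ => conj a * (ζ * (ζ * deriv B ζ + B ζ)) with hQ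
  have hBd := hd.diff_B.deriv Metric.isOpen_ball
  have hQd : DifferentiableOn ℂ Q (Metric.ball 0 1) :=
    (differentiableOn_id.mul ((differentiableOn_id.mul hBd).add hd.diff_B)).const_mul _
  have hkey : ∀ θ, ‖G (φ (polarPt r θ))‖⁻¹ ^ 2 - areaDensity G (φ (polarPt r θ)) =
      -(1 / r ^ 2) * (Q (polarPt r θ)).re + ‖polarPt r θ * deriv B (polarPt r θ)‖ ^ 2 +
      (conj (B (polarPt r θ)) * (polarPt r θ * deriv B (polarPt r θ))).re := by
    intro θ
    have hne := polarPt_ne_zero hr.1 θ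
    have hlt := norm_polarPt_lt_one hr θ
    rw [areaDensity, div_eq_mul_one_div (conj _), ← norm_inv, ← one_div, hd.inv_G _ hne hlt,
      hd.φ_eq _ hne hlt]
    set ζ := polarPt r θ with hζ
    have hc : conj ζ = (r : ℂ) ^ 2 / ζ := conj_polarPt hr.1 θ
    have hrne : (r : ℂ) ≠ 0 := by exact_mod_cast hr.1.ne'
    set D := ζ * deriv B ζ with hD
    have e0 : ‖a / ζ - D‖ ^ 2 = (conj (a / ζ - D) * (a / ζ - D)).re := by
      rw [Complex.conj_mul', ← Complex.ofReal_pow, Complex.ofReal_re]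
    have e0' : ‖D‖ ^ 2 = (conj D * D).re := by
      rw [Complex.conj_mul', ← Complex.ofReal_pow, Complex.ofReal_re]
    have e1 : conj (a / ζ - D) * (a / ζ - D) - conj (a / ζ + B ζ) * (a / ζ - D) =
        -(conj (D + B ζ) * (a / ζ)) + conj D * D + conj (B ζ) * D := by
      simp only [map_add, map_sub]; ring
    have e2 : (conj (D + B ζ) * (a / ζ)).re = (Q ζ / (r : ℂ) ^ 2).re := by
      rw [← Complex.conj_re, map_mul, map_div₀, Complex.conj_conj, hc]
      congr 1
      simp only [hQ, hD]
      field_simp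
    rw [e0, e0', ← Complex.sub_re, e1, Complex.add_re, Complex.add_re, Complex.neg_re, e2,
      ← Complex.ofReal_pow, Complex.div_ofReal_re]
    ring
  have hcQ : Continuous fun θ => (Q (polarPt r θ)).re :=
    Complex.continuous_re.comp (continuous_comp_polarPt hQd.continuousOn hr.1.le hr.2)
  have hcD : Continuous fun θ => ‖polarPt r θ * deriv B (polarPt r θ)‖ ^ 2 := by
    have h3 : Continuous fun θ => polarPt r θ := by unfold polarPt; fun_prop
    exact (h3.mul (continuous_comp_polarPt hBd.continuousOn hr.1.le hr.2)).norm.pow 2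
  refine le_of_le_of_eq ?_ (intervalIntegral.integral_congr fun θ _ => hkey θ).symm
  rw [intervalIntegral.integral_add, intervalIntegral.integral_add,
    intervalIntegral.integral_const_mul, integral_re_polarPt_eq_zero hQd (by simp [hQ]) hr, mul_zero,
    zero_add]
  · refine add_nonneg (intervalIntegral.integral_nonneg two_pi_pos.le fun θ _ => by positivity) ?_
    exact (hasSum_discPairing hd.diff_B hr.1.le hr.2).nonneg fun n => by positivity
  · exact (continuous_const.mul hcQ).intervalIntegrable _ _
  · exact hcD.intervalIntegrable _ _
  · exact ((continuous_const.mul hcQ).add hcD).intervalIntegrable _ _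
  · exact (continuous_discPairing_integrand hd.diff_B hr).intervalIntegrable _ _

/-- Outside a disc, the levels are concentric circles. -/
lemma IsRound.exists_param (hround : IsRound Ω G G₁) (h : IsSmoothPotential Ω u G G₁ G₂)
    (hm : IsExteriorMap Ω u G W φ a) (hΨ : IsHalfPlaneMap Ω u G φ Ψ) {s : ℝ} (hs : 0 ≤ s) :
    ∃ z₀ g₀ : ℂ, g₀ ≠ 0 ∧ ∀ α : ℝ, Ψ (s + α * Complex.I) = z₀ + g₀ * Complex.exp (α * Complex.I) ∧
      1 / G (Ψ (s + α * Complex.I)) = g₀ * Complex.exp (α * Complex.I) := by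
  have hcl : ∀ z ∈ closure Ω, 1 + G₁ z / G z ^ 2 = 0 := fun z hz =>
    (show EqOn (fun z => 1 + G₁ z / G z ^ 2) 0 Ω from fun z hz => hround z hz).of_subset_closure
      (continuousOn_b h hΨ) continuousOn_const subset_closure Subset.rfl hz
  have hmem : ∀ α : ℝ, Ψ (s + α * Complex.I) ∈ closure Ω := fun α =>
    hΨ.mapsTo _ (by simpa using hs)
  set Y : ℝ → ℂ := fun α => Ψ (s + α * Complex.I) with hY
  have hYd : ∀ α, HasDerivAt Y (Complex.I / G (Y α)) α := fun α =>
    hΨ.hasDerivAt hm h.continuousOn_G hs α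
  set g : ℝ → ℂ := fun α => 1 / G (Y α) with hg
  -- With `b = 0` one has `G₁ = -G²`, so `1 / G` along the level solves `g' = i g`. It then has the
  -- same derivative as the curve, which is a translate of it.
  have hgd : ∀ α, HasDerivAt g (Complex.I * g α) α := by
    intro α
    have hG := hΨ.G_ne_zero _ (hmem α)
    have h1 := (hasDerivAt_comp_curve (h.hasDerivWithinAt _ (hmem α)) (hYd α) hmem).inv hG
    simp only [hg, one_div]
    convert! h1 using 1
    have h2 := hcl _ (hmem α)
    have h3 : G₁ (Y α) = -G (Y α) ^ 2 := by
      simp only [hY]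
      field_simp at h2
      linear_combination h2
    rw [h3]
    simp only [hY]
    field_simp
  have hexpd : ∀ α : ℝ, HasDerivAt (fun α : ℝ => Complex.exp (-(α * Complex.I)))
      (Complex.exp (-(α * Complex.I)) * -Complex.I) α := by
    intro α
    simpa using ((hasDerivAt_id α).ofReal_comp.mul_const Complex.I).neg.cexp
  have hgc : ∀ α, g α * Complex.exp (-(α * Complex.I)) = g 0 := by
    intro α
    have h1 : ∀ α : ℝ, HasDerivAt (fun α : ℝ => g α * Complex.exp (-(α * Complex.I))) 0 α := by
      intro α
      convert! (hgd α).fun_mul (hexpd α) using 1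
      ring
    have := is_const_of_deriv_eq_zero (fun α => (h1 α).differentiableAt) (fun α => (h1 α).deriv) α 0
    simpa using this
  have hg2 : ∀ α, g α = g 0 * Complex.exp (α * Complex.I) := by
    intro α
    rw [← hgc α, mul_assoc, ← Complex.exp_add]; simp
  refine ⟨Y 0 - g 0, g 0, one_div_ne_zero (hΨ.G_ne_zero _ (hmem 0)), fun α => ⟨?_, hg2 α⟩⟩
  have h1 : ∀ α : ℝ, HasDerivAt (fun α : ℝ => Y α - g α) 0 α := by
    intro α
    convert! (hYd α).fun_sub (hgd α) using 1
    simp only [hg]; ring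
  have := is_const_of_deriv_eq_zero (fun α => (h1 α).differentiableAt) (fun α => (h1 α).deriv) α 0
  rw [← hg2]
  change Y α = _
  linear_combination this

lemma IsRound.isCircle (hround : IsRound Ω G G₁) (h : IsSmoothPotential Ω u G G₁ G₂)
    (hm : IsExteriorMap Ω u G W φ a) (hΨ : IsHalfPlaneMap Ω u G φ Ψ) : IsCircle (frontier Ω) := by
  obtain ⟨z₀, g₀, hg₀, hpar⟩ := hround.exists_param h hm hΨ le_rfl
  refine ⟨z₀, ‖g₀‖, norm_pos_iff.mpr hg₀, ?_⟩
  rw [← h.potentialLevel_zero hm]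
  ext z
  rw [mem_sphere_iff_norm]
  constructor
  · rintro ⟨hz, hz0⟩
    obtain ⟨α, hα⟩ := hΨ.surj z hz
    rw [hz0, (hpar α).1] at hα
    rw [← hα, add_sub_cancel_left, norm_mul, Complex.norm_exp_ofReal_mul_I, mul_one]
  · intro hz
    set w := (z - z₀) / g₀ with hw
    have hw1 : ‖w‖ = 1 := by rw [hw, norm_div, hz, div_self (norm_ne_zero_iff.mpr hg₀)]
    have h1 : z = Ψ ((0 : ℝ) + w.arg * Complex.I) := by
      have := Complex.norm_mul_exp_arg_mul_I w
      rw [hw1, Complex.ofReal_one, one_mul] at this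
      rw [(hpar w.arg).1, this, hw, mul_div_cancel₀ _ hg₀]; ring
    rw [h1]
    refine ⟨hΨ.mapsTo _ (by simp), ?_⟩
    rw [hΨ.u_eq _ (by simp)]; simp

/-- The standard parametrization of a circle. -/
lemma isJordanParam_sphere (c : ℂ) {R : ℝ} (hR : 0 < R) :
    IsJordanParam (circleMap c R) (Metric.sphere c R) := by
  have hd : deriv (circleMap c R) = fun t => circleMap 0 R t * Complex.I := by
    ext t; exact deriv_circleMap c R t
  refine ⟨contDiff_circleMap c R, periodic_circleMap c R, fun t => ?_, ?_, ?_, ?_⟩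
  · exact deriv_circleMap_ne_zero hR.ne'
  · exact (injOn_circleMap_of_abs_sub_le' hR.ne' (by simp)).mono Subset.rfl
  · rw [range_circleMap, abs_of_pos hR]
  · have h1 : ∀ t : ℝ, (conj (circleMap c R t) * deriv (circleMap c R) t).im =
        R ^ 2 + R * (c.re * Real.cos t + c.im * Real.sin t) := by
      intro t
      rw [hd]
      simp only [circleMap, zero_add, Complex.exp_mul_I]
      simp [Complex.cos_ofReal_re, Complex.sin_ofReal_re]
      linear_combination R ^ 2 * Real.sin_sq_add_cos_sq t
    simp only [h1]
    rw [intervalIntegral.integral_add (by simp) (Continuous.intervalIntegrable (by fun_prop) _ _),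
      intervalIntegral.integral_const_mul, intervalIntegral.integral_add
        (Continuous.intervalIntegrable (by fun_prop) _ _)
        (Continuous.intervalIntegrable (by fun_prop) _ _), intervalIntegral.integral_const_mul,
      intervalIntegral.integral_const_mul, integral_cos, integral_sin]
    simp
    positivity

lemma curvature_circleMap (c : ℂ) {R : ℝ} (hR : 0 < R) (t : ℝ) :
    curvature (circleMap c R) t = 1 / R := by
  have hd : deriv (circleMap c R) = fun t => circleMap 0 R t * Complex.I := by
    ext t; exact deriv_circleMap c R t
  have hd2 : deriv (deriv (circleMap c R)) t = -circleMap 0 R t := by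
    rw [hd, ((hasDerivAt_circleMap 0 R t).mul_const Complex.I).deriv, mul_assoc, Complex.I_mul_I]
    ring
  have hn : ‖circleMap 0 R t‖ = R := by simp [abs_of_pos hR]
  rw [curvature, hd2, hd]
  simp only [map_mul, Complex.conj_I, norm_mul, Complex.norm_I, mul_one, hn]
  rw [show conj (circleMap 0 R t) * -Complex.I * -circleMap 0 R t =
    conj (circleMap 0 R t) * circleMap 0 R t * Complex.I by ring, Complex.conj_mul', hn,
    ← Complex.ofReal_pow, Complex.im_ofReal_mul, Complex.I_im]
  field_simp

end

/-! ### From arc length to level integrals; the curvature of a level curve -/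

section

variable {Ω : Set ℂ} {u : ℂ → ℝ} {G G₁ G₂ W φ Ψ : ℂ → ℂ} {a : ℂ} {s : ℝ} {γ : ℝ → ℂ}

lemma levelIntegral_const_mul (m : ℝ) (F : ℂ → ℝ) :
    levelIntegral Ψ (fun z => m * F z) s = m * levelIntegral Ψ F s :=
  intervalIntegral.integral_const_mul _ _

namespace IsHalfPlaneMap

lemma levelIntegral_congr (hΨ : IsHalfPlaneMap Ω u G φ Ψ) (hs : 0 ≤ s) {F H : ℂ → ℝ}
    (hFH : ∀ z ∈ closure Ω, F z = H z) : levelIntegral Ψ F s = levelIntegral Ψ H s :=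
  intervalIntegral.integral_congr fun α _ => hFH _ (hΨ.mapsTo _ (by simpa using hs))

lemma intervalIntegrable (hΨ : IsHalfPlaneMap Ω u G φ Ψ) (hs : 0 ≤ s) {F : ℂ → ℝ}
    (hF : ContinuousOn F (closure Ω)) :
    IntervalIntegrable (fun α : ℝ => F (Ψ (s + α * Complex.I))) volume 0 (2 * π) :=
  (hΨ.continuous_comp_right hF hs).intervalIntegrable _ _

lemma levelIntegral_add (hΨ : IsHalfPlaneMap Ω u G φ Ψ) (hs : 0 ≤ s) {F H : ℂ → ℝ}
    (hF : ContinuousOn F (closure Ω)) (hH : ContinuousOn H (closure Ω)) :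
    levelIntegral Ψ (fun z => F z + H z) s = levelIntegral Ψ F s + levelIntegral Ψ H s :=
  intervalIntegral.integral_add (hΨ.intervalIntegrable hs hF) (hΨ.intervalIntegrable hs hH)

lemma levelIntegral_sub (hΨ : IsHalfPlaneMap Ω u G φ Ψ) (hs : 0 ≤ s) {F H : ℂ → ℝ}
    (hF : ContinuousOn F (closure Ω)) (hH : ContinuousOn H (closure Ω)) :
    levelIntegral Ψ (fun z => F z - H z) s = levelIntegral Ψ F s - levelIntegral Ψ H s :=
  intervalIntegral.integral_sub (hΨ.intervalIntegrable hs hF) (hΨ.intervalIntegrable hs hH)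

lemma levelIntegral_pos (hΨ : IsHalfPlaneMap Ω u G φ Ψ) (hs : 0 ≤ s) {F : ℂ → ℝ}
    (hF : ContinuousOn F (closure Ω)) (hpos : ∀ z ∈ closure Ω, 0 < F z) :
    0 < levelIntegral Ψ F s :=
  intervalIntegral.intervalIntegral_pos_of_pos (hΨ.intervalIntegrable hs hF)
    (fun α => hpos _ (hΨ.mapsTo _ (by simpa using hs))) two_pi_pos

/-- The Cauchy–Schwarz inequality for a positive function and its reciprocal. -/
lemma levelIntegral_mul_inv_ge (hΨ : IsHalfPlaneMap Ω u G φ Ψ) (hs : 0 ≤ s) {F : ℂ → ℝ}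
    (hF : ContinuousOn F (closure Ω)) (hpos : ∀ z ∈ closure Ω, 0 < F z) :
    (2 * π) ^ 2 ≤ levelIntegral Ψ F s * levelIntegral Ψ (fun z => (F z)⁻¹) s := by
  have hFi : ContinuousOn (fun z => (F z)⁻¹) (closure Ω) := hF.inv₀ fun z hz => (hpos z hz).ne'
  have hL := hΨ.levelIntegral_pos hs hF hpos
  set L := levelIntegral Ψ F s with hLdef
  set J := levelIntegral Ψ (fun z => (F z)⁻¹) s with hJ
  -- The mean of `F` is the optimal `λ` in `F/λ + λ/F ≥ 2`, whose integral is the claim.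
  have hlam : 0 < L / (2 * π) := div_pos hL two_pi_pos
  set lam := L / (2 * π) with hlamdef
  have h1 : 2 * (2 * π) ≤ lam⁻¹ * L + lam * J := by
    have e : lam⁻¹ * L + lam * J = levelIntegral Ψ (fun z => lam⁻¹ * F z + lam * (F z)⁻¹) s := by
      rw [hΨ.levelIntegral_add hs (by fun_prop) (by fun_prop), levelIntegral_const_mul,
        levelIntegral_const_mul]
    have e2 : 2 * (2 * π) = ∫ _ in (0 : ℝ)..(2 * π), (2 : ℝ) := by simp; ring
    rw [e, e2]
    refine intervalIntegral.integral_mono_on two_pi_pos.le (by simp)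
      (hΨ.intervalIntegrable hs ((continuousOn_const.mul hF).add (continuousOn_const.mul hFi)))
      fun α _ => ?_
    have hp := hpos _ (hΨ.mapsTo (s + α * Complex.I) (by simpa using hs))
    set x := F (Ψ (s + α * Complex.I))
    have : lam⁻¹ * x + lam * x⁻¹ - 2 = (x - lam) ^ 2 / (lam * x) := by field_simp; ring
    have h0 : 0 ≤ (x - lam) ^ 2 / (lam * x) := by positivity
    linarith
  have h2 : lam⁻¹ * L = 2 * π := by rw [hlamdef]; field_simp
  rw [h2] at h1
  have h3 : 2 * π ≤ lam * J := by linarith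
  calc (2 * π) ^ 2 = 2 * π * (2 * π) := sq _
    _ ≤ 2 * π * (lam * J) := by gcongr
    _ = L * J := by rw [hlamdef]; field_simp

end IsHalfPlaneMap

/-- `γ` is a counterclockwise parametrization of the level `s`. -/
structure IsLevelCurve (Ω : Set ℂ) (u : ℂ → ℝ) (G G₁ G₂ W φ : ℂ → ℂ) (a : ℂ) (Ψ : ℂ → ℂ) (s : ℝ)
    (γ : ℝ → ℂ) : Prop where
  pot : IsSmoothPotential Ω u G G₁ G₂
  map : IsExteriorMap Ω u G W φ a
  half : IsHalfPlaneMap Ω u G φ Ψ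
  nonneg : 0 ≤ s
  param : IsJordanParam γ (potentialLevel Ω u s)
  area_pos : 0 < levelIntegral Ψ (areaDensity G) s
  pos : ∀ t, 0 < (G (γ t) * deriv γ t).im
  integral_eq : ∀ H : ℂ → ℝ, ContinuousOn H (closure Ω) →
    ∫ t in (0 : ℝ)..(2 * π), H (γ t) * (G (γ t) * deriv γ t).im = levelIntegral Ψ H s

namespace IsLevelCurve

variable (c : IsLevelCurve Ω u G G₁ G₂ W φ a Ψ s γ)
include c

lemma mem (t : ℝ) : γ t ∈ closure Ω := (c.param.mem t).1

lemma G_ne_zero (t : ℝ) : G (γ t) ≠ 0 := c.half.G_ne_zero _ (c.mem t)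

lemma deriv_eq (t : ℝ) : deriv γ t = (G (γ t) * deriv γ t).im * Complex.I / G (γ t) := by
  have := c.G_ne_zero t
  rw [← c.pot.G_mul_deriv c.param t]; field_simp

/-- This is `ds = dα / |G|`, by which each arc length integral becomes an integral over the angle.
-/
lemma norm_deriv (t : ℝ) : ‖deriv γ t‖ = ‖G (γ t)‖⁻¹ * (G (γ t) * deriv γ t).im := by
  conv_lhs => rw [c.deriv_eq t]
  rw [norm_div, norm_mul, Complex.norm_real, Complex.norm_I, Real.norm_of_nonneg (c.pos t).le]
  ring

lemma continuousOn_invNorm : ContinuousOn (fun z => ‖G z‖⁻¹) (closure Ω) :=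
  c.pot.continuousOn_inv_norm c.half

lemma arcIntegral_eq {H : ℂ → ℝ} (hH : ContinuousOn H (closure Ω)) :
    arcIntegral γ (fun t => H (γ t)) = levelIntegral Ψ (fun z => H z * ‖G z‖⁻¹) s := by
  rw [← c.integral_eq (fun z => H z * ‖G z‖⁻¹) (hH.mul c.continuousOn_invNorm)]
  refine intervalIntegral.integral_congr fun t _ => ?_
  simp only [c.norm_deriv t]; ring

lemma length_eq : length γ = levelIntegral Ψ (fun z => ‖G z‖⁻¹) s := by
  rw [← c.integral_eq _ c.continuousOn_invNorm]
  refine intervalIntegral.integral_congr fun t _ => ?_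
  simp only [c.norm_deriv t]

lemma avg_eq {H : ℂ → ℝ} (hH : ContinuousOn H (closure Ω)) :
    avg γ (fun t => H (γ t)) = levelIntegral Ψ (fun z => H z * ‖G z‖⁻¹) s / length γ := by
  rw [avg, c.arcIntegral_eq hH]

lemma cov_eq {F H : ℂ → ℝ} (hF : ContinuousOn F (closure Ω)) (hH : ContinuousOn H (closure Ω)) :
    cov γ (fun t => F (γ t)) (fun t => H (γ t)) =
      levelIntegral Ψ (fun z => F z * H z * ‖G z‖⁻¹) s / length γ -
      levelIntegral Ψ (fun z => F z * ‖G z‖⁻¹) s / length γ *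
        (levelIntegral Ψ (fun z => H z * ‖G z‖⁻¹) s / length γ) := by
  have hL := c.param.length_pos.ne'
  have hq := c.continuousOn_invNorm
  rw [cov]
  rw [c.avg_eq hF, c.avg_eq hH]
  set mF := levelIntegral Ψ (fun z => F z * ‖G z‖⁻¹) s / length γ with hmF
  set mH := levelIntegral Ψ (fun z => H z * ‖G z‖⁻¹) s / length γ with hmH
  rw [c.avg_eq (H := fun z => (F z - mF) * (H z - mH))
    ((hF.sub continuousOn_const).mul (hH.sub continuousOn_const))]
  have e : levelIntegral Ψ (fun z => (F z - mF) * (H z - mH) * ‖G z‖⁻¹) s =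
      levelIntegral Ψ (fun z => F z * H z * ‖G z‖⁻¹) s - mF * (mH * length γ) := by
    have e1 : levelIntegral Ψ (fun z => (F z - mF) * (H z - mH) * ‖G z‖⁻¹) s =
        levelIntegral Ψ (fun z => (F z * H z * ‖G z‖⁻¹ - mF * (H z * ‖G z‖⁻¹)) -
          (mH * (F z * ‖G z‖⁻¹) - mF * mH * ‖G z‖⁻¹)) s := by
      congr 1; ext z; ring
    rw [e1, c.half.levelIntegral_sub c.nonneg (by fun_prop) (by fun_prop),
      c.half.levelIntegral_sub c.nonneg (by fun_prop) (by fun_prop),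
      c.half.levelIntegral_sub c.nonneg (by fun_prop) (by fun_prop),
      levelIntegral_const_mul, levelIntegral_const_mul, levelIntegral_const_mul, ← c.length_eq]
    have e3 : levelIntegral Ψ (fun z => F z * ‖G z‖⁻¹) s = mF * length γ := by
      rw [hmF]; field_simp
    have e4 : levelIntegral Ψ (fun z => H z * ‖G z‖⁻¹) s = mH * length γ := by
      rw [hmH]; field_simp
    rw [e3, e4]; ring
  rw [e]
  field_simp

lemma hasDerivAt_G (t : ℝ) : HasDerivAt (fun t => G (γ t)) (G₁ (γ t) * deriv γ t) t :=
  hasDerivAt_comp_curve (c.pot.hasDerivWithinAt _ (c.mem t)) (c.param.hasDerivAt t) c.mem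

lemma hasDerivAt_G₁ (t : ℝ) : HasDerivAt (fun t => G₁ (γ t)) (G₂ (γ t) * deriv γ t) t :=
  hasDerivAt_comp_curve (c.pot.hasDerivWithinAt₁ _ (c.mem t)) (c.param.hasDerivAt t) c.mem

/-- Differentiating `Re (G γ') = 0` gives `γ''/γ' = x/w - i w G₁/G²` with `x` real and `w` the
angular speed. The real term, which depends on the parametrization, drops out of the curvature `Im
(γ''/γ') / |γ'|`. -/
lemma curvature_eq (t : ℝ) : curvature γ t = ‖G (γ t)‖ * (1 - reB G G₁ (γ t)) := by
  have hG := c.G_ne_zero t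
  have hw := c.pos t
  have hD := c.deriv_eq t
  set w := (G (γ t) * deriv γ t).im with hwdef
  set D := deriv γ t with hDdef
  set D2 := deriv (deriv γ) t with hD2
  have h1 := (c.hasDerivAt_G t).fun_mul (c.param.hasDerivAt_deriv t)
  have h2 : (G₁ (γ t) * D * D + G (γ t) * D2).re = 0 := by
    have h3 := Complex.reCLM.hasFDerivAt.comp_hasDerivAt t h1
    have h4 : Complex.reCLM ∘ (fun t => G (γ t) * deriv γ t) = fun _ => 0 := by
      ext x
      rw [Function.comp_apply, c.pot.G_mul_deriv c.param x]
      simp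
    rw [h4] at h3
    exact h3.unique (hasDerivAt_const t 0)
  obtain ⟨x, hx⟩ : ∃ x : ℝ, G₁ (γ t) * D * D + G (γ t) * D2 = x * Complex.I :=
    ⟨(G₁ (γ t) * D * D + G (γ t) * D2).im, by apply Complex.ext <;> simp [h2]⟩
  have hD2eq : D2 = (x * Complex.I - G₁ (γ t) * D * D) / G (γ t) := by
    rw [← hx]; field_simp; ring
  have hDne : D ≠ 0 := c.param.regular t
  have hwne : (w : ℂ) ≠ 0 := by exact_mod_cast hw.ne'
  have e1 : D2 = D * ((x / w : ℝ) - w * Complex.I * (G₁ (γ t) / G (γ t) ^ 2)) := by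
    rw [hD2eq, hD]
    push_cast
    field_simp
  have e2 : (conj D * D2).im = ‖D‖ ^ 2 * (-(w * (G₁ (γ t) / G (γ t) ^ 2).re)) := by
    rw [e1, ← mul_assoc, Complex.conj_mul', ← Complex.ofReal_pow, Complex.im_ofReal_mul]
    congr 1
    rw [Complex.sub_im, Complex.ofReal_im, mul_assoc, Complex.im_ofReal_mul]
    simp
  have hn : ‖D‖ = ‖G (γ t)‖⁻¹ * w := c.norm_deriv t
  have hGn := norm_ne_zero_iff.mpr hG
  rw [curvature, e2, hn, reB, Complex.add_re, Complex.one_re]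
  field_simp
  ring

/-- The angle derivative is `-i ζ d/dζ` in the disc, and the real part of `-i ζ b'` is `Im (ζ b')`.
-/
lemma hasDerivAt_reB (t : ℝ) : HasDerivAt (fun t => reB G G₁ (γ t))
    ((G (γ t) * deriv γ t).im * imZDerivB G G₁ G₂ (γ t)) t := by
  have hG := c.G_ne_zero t
  have h1 := ((c.hasDerivAt_G₁ t).fun_div ((c.hasDerivAt_G t).fun_pow 2)
    (pow_ne_zero 2 hG)).const_add 1
  have h2 := Complex.reCLM.hasFDerivAt.comp_hasDerivAt t h1
  convert! h2 using 1
  have hD := c.deriv_eq t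
  set w := (G (γ t) * deriv γ t).im with hwdef
  rw [hD, Complex.reCLM_apply, imZDerivB, ← Complex.im_ofReal_mul]
  rw [show (G₂ (γ t) * (w * Complex.I / G (γ t)) * G (γ t) ^ 2 - G₁ (γ t) * ((2 : ℕ) *
    G (γ t) ^ (2 - 1) * (G₁ (γ t) * (w * Complex.I / G (γ t))))) / (G (γ t) ^ 2) ^ 2 =
    -(w * -(G₂ (γ t) / G (γ t) ^ 3 - 2 * G₁ (γ t) ^ 2 / G (γ t) ^ 4)) * Complex.I by
      push_cast; field_simp]
  simp

/-- The logarithmic derivative of `1/|G|` is the real part of `-G₁ γ'/G = -i w G₁/G²`, which is `w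
Im b`. -/
lemma hasDerivAt_invNorm (t : ℝ) : HasDerivAt (fun t => ‖G (γ t)‖⁻¹)
    (‖G (γ t)‖⁻¹ * ((G (γ t) * deriv γ t).im * (1 + G₁ (γ t) / G (γ t) ^ 2).im)) t := by
  have hG := c.G_ne_zero t
  have hGn := norm_ne_zero_iff.mpr hG
  have h1 := (c.hasDerivAt_G t).inv hG
  have h2 := h1.norm_sq.sqrt (by
    simp only [Pi.inv_apply]
    exact pow_ne_zero 2 (norm_ne_zero_iff.mpr (inv_ne_zero hG)))
  have h3 : (fun t => ‖G (γ t)‖⁻¹) = fun t => √(‖((fun t => G (γ t))⁻¹) t‖ ^ 2) := by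
    ext x
    rw [Real.sqrt_sq (norm_nonneg _), Pi.inv_apply, norm_inv]
  rw [h3]
  convert! h2 using 1
  have hD := c.deriv_eq t
  set w := (G (γ t) * deriv γ t).im with hwdef
  simp only [Pi.inv_apply]
  rw [Real.sqrt_sq (norm_nonneg _), Complex.inner, hD]
  have e : -(G₁ (γ t) * (w * Complex.I / G (γ t))) / G (γ t) ^ 2 * conj (G (γ t))⁻¹ =
      ((‖G (γ t)‖⁻¹ ^ 2 * w : ℝ) : ℂ) * (-Complex.I * (G₁ (γ t) / G (γ t) ^ 2)) := by
    have : ((‖G (γ t)‖⁻¹ ^ 2 : ℝ) : ℂ) = (G (γ t))⁻¹ * conj (G (γ t))⁻¹ := by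
      rw [Complex.mul_conj', norm_inv]; push_cast; ring
    rw [Complex.ofReal_mul, this]
    field_simp
  rw [e, Complex.re_ofReal_mul, norm_inv]
  simp
  field_simp

end IsLevelCurve

end

/-! ### Averages and covariances expressed through `Re b` -/

section

variable {Ω : Set ℂ} {u : ℂ → ℝ} {G G₁ G₂ W φ Ψ : ℂ → ℂ} {a : ℂ} {s : ℝ} {γ : ℝ → ℂ}

lemma levelIntegral_const (m : ℝ) : levelIntegral Ψ (fun _ => m) s = 2 * π * m := by
  simp [levelIntegral]

namespace IsLevelCurve

variable (c : IsLevelCurve Ω u G G₁ G₂ W φ a Ψ s γ)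
include c

lemma continuousOn_norm : ContinuousOn (fun z => ‖G z‖) (closure Ω) := c.pot.continuousOn_G.norm

lemma continuousOn_re : ContinuousOn (reB G G₁) (closure Ω) := continuousOn_reB c.pot c.half

lemma norm_pos {z : ℂ} (hz : z ∈ closure Ω) : 0 < ‖G z‖ := norm_pos_iff.mpr (c.half.G_ne_zero z hz)

lemma norm_pos' (t : ℝ) : 0 < ‖G (γ t)‖ := c.norm_pos (c.mem t)

lemma levelIntegral_one_sub {F : ℂ → ℝ} (hF : ContinuousOn F (closure Ω)) :
    levelIntegral Ψ (fun z => F z * (1 - reB G G₁ z)) s =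
      levelIntegral Ψ F s - levelIntegral Ψ (fun z => F z * reB G G₁ z) s := by
  have hβ := c.continuousOn_re
  rw [← c.half.levelIntegral_sub c.nonneg hF (by fun_prop)]
  congr 1; ext z; ring

lemma levelIntegral_one_sub_re : levelIntegral Ψ (fun z => 1 - reB G G₁ z) s = 2 * π := by
  rw [c.half.levelIntegral_sub c.nonneg continuousOn_const c.continuousOn_re,
    levelIntegral_reB c.pot c.map c.half c.nonneg, levelIntegral_const]
  ring

lemma curvature_div (e : ℝ) (t : ℝ) :
    curvature γ t / (e * ‖G (γ t)‖) = e⁻¹ * (1 - reB G G₁ (γ t)) := by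
  have := (c.norm_pos' t).ne'
  rw [c.curvature_eq t, mul_comm e, mul_div_mul_left _ _ this, div_eq_inv_mul]

lemma avg_curvature_div (e : ℝ) : avg γ (fun t => curvature γ t / (e * ‖G (γ t)‖)) =
    e⁻¹ * (length γ - levelIntegral Ψ (fun z => ‖G z‖⁻¹ * reB G G₁ z) s) / length γ := by
  have hβ := c.continuousOn_re
  simp only [c.curvature_div e]
  rw [c.avg_eq (H := fun z => e⁻¹ * (1 - reB G G₁ z)) (by fun_prop), c.length_eq,
    ← c.levelIntegral_one_sub c.continuousOn_invNorm, ← levelIntegral_const_mul]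
  congr 2; ext z; ring

/-- The arc length integrals of `κ` and `E` are the constants `2π` and `2π e`. Only the deviation of
the mean of `κ/E`, an integral of `Re b`, survives. -/
lemma cov_curvature_div {e : ℝ} (he : 0 < e) :
    cov γ (fun t => curvature γ t / (e * ‖G (γ t)‖)) (fun t => e * ‖G (γ t)‖) =
      2 * π * levelIntegral Ψ (fun z => ‖G z‖⁻¹ * reB G G₁ z) s / length γ ^ 2 := by
  have hβ := c.continuousOn_re
  have hn := c.continuousOn_norm
  have hL := c.param.length_pos.ne'
  simp only [c.curvature_div e]
  rw [c.cov_eq (F := fun z => e⁻¹ * (1 - reB G G₁ z)) (H := fun z => e * ‖G z‖) (by fun_prop)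
    (by fun_prop)]
  have e1 : levelIntegral Ψ (fun z => e⁻¹ * (1 - reB G G₁ z) * (e * ‖G z‖) * ‖G z‖⁻¹) s = 2 * π := by
    rw [← c.levelIntegral_one_sub_re]
    refine c.half.levelIntegral_congr c.nonneg fun z hz => ?_
    have := (c.norm_pos hz).ne'
    field_simp
  have e2 : levelIntegral Ψ (fun z => e⁻¹ * (1 - reB G G₁ z) * ‖G z‖⁻¹) s =
      e⁻¹ * (length γ - levelIntegral Ψ (fun z => ‖G z‖⁻¹ * reB G G₁ z) s) := by
    rw [c.length_eq, ← c.levelIntegral_one_sub c.continuousOn_invNorm, ← levelIntegral_const_mul]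
    congr 1; ext z; ring
  have e3 : levelIntegral Ψ (fun z => e * ‖G z‖ * ‖G z‖⁻¹) s = 2 * π * e := by
    rw [← levelIntegral_const (Ψ := Ψ) (s := s)]
    refine c.half.levelIntegral_congr c.nonneg fun z hz => ?_
    have := (c.norm_pos hz).ne'
    field_simp
  rw [e1, e2, e3]
  field_simp
  ring

lemma cov_curvature (e : ℝ) :
    cov γ (curvature γ) (fun t => e * ‖G (γ t)‖) =
      e * ((levelIntegral Ψ (fun z => ‖G z‖) s - levelIntegral Ψ (fun z => ‖G z‖ * reB G G₁ z) s) /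
        length γ - (2 * π) ^ 2 / length γ ^ 2) := by
  have hβ := c.continuousOn_re
  have hn := c.continuousOn_norm
  have hL := c.param.length_pos.ne'
  rw [show curvature γ = fun t => ‖G (γ t)‖ * (1 - reB G G₁ (γ t)) from funext c.curvature_eq,
    c.cov_eq (F := fun z => ‖G z‖ * (1 - reB G G₁ z)) (H := fun z => e * ‖G z‖) (by fun_prop)
    (by fun_prop)]
  have e1 : levelIntegral Ψ (fun z => ‖G z‖ * (1 - reB G G₁ z) * (e * ‖G z‖) * ‖G z‖⁻¹) s =
      e * (levelIntegral Ψ (fun z => ‖G z‖) s -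
        levelIntegral Ψ (fun z => ‖G z‖ * reB G G₁ z) s) := by
    rw [← c.levelIntegral_one_sub hn, ← levelIntegral_const_mul]
    refine c.half.levelIntegral_congr c.nonneg fun z hz => ?_
    have := (c.norm_pos hz).ne'
    field_simp
  have e2 : levelIntegral Ψ (fun z => ‖G z‖ * (1 - reB G G₁ z) * ‖G z‖⁻¹) s = 2 * π := by
    rw [← c.levelIntegral_one_sub_re]
    refine c.half.levelIntegral_congr c.nonneg fun z hz => ?_
    have := (c.norm_pos hz).ne'
    field_simp
  have e3 : levelIntegral Ψ (fun z => e * ‖G z‖ * ‖G z‖⁻¹) s = 2 * π * e := by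
    rw [← levelIntegral_const (Ψ := Ψ) (s := s)]
    refine c.half.levelIntegral_congr c.nonneg fun z hz => ?_
    have := (c.norm_pos hz).ne'
    field_simp
  rw [e1, e2, e3]
  field_simp

/-- With `2π e` in the role of `Φ`, both `κ/(2π)` and `E/Φ` have arc length integral one, so the
products of means cancel in the difference. The additive constant in the logarithm is killed by the
vanishing mean of `Re b`. -/
lemma cov_curvature_log_sub {e : ℝ} (he : 0 < e) :
    cov γ (fun t => curvature γ t / (2 * π))
        (fun t => Real.log (e * ‖G (γ t)‖ * length γ / (2 * π * e))) -
      cov γ (fun t => e * ‖G (γ t)‖ / (2 * π * e))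
        (fun t => Real.log (e * ‖G (γ t)‖ * length γ / (2 * π * e))) =
      levelIntegral Ψ (fun z => reB G G₁ z * -Real.log ‖G z‖) s / (2 * π * length γ) := by
  have hβ := c.continuousOn_re
  have hn := c.continuousOn_norm
  have hL := c.param.length_pos
  have hπ := pi_pos
  have hlog : ContinuousOn (fun z => Real.log ‖G z‖) (closure Ω) :=
    hn.log fun z hz => (c.norm_pos hz).ne'
  set m := Real.log (length γ / (2 * π)) with hm
  have h1 : ∀ t, Real.log (e * ‖G (γ t)‖ * length γ / (2 * π * e)) = Real.log ‖G (γ t)‖ + m := by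
    intro t
    rw [hm, ← Real.log_mul (c.norm_pos' t).ne' (by positivity)]
    congr 1; field_simp
  have h2 : ∀ t, curvature γ t / (2 * π) = (2 * π)⁻¹ * (‖G (γ t)‖ * (1 - reB G G₁ (γ t))) :=
    fun t => by rw [c.curvature_eq t]; ring
  have h3 : ∀ t, e * ‖G (γ t)‖ / (2 * π * e) = (2 * π)⁻¹ * ‖G (γ t)‖ := fun t => by field_simp
  simp only [h1, h2, h3]
  rw [c.cov_eq (F := fun z => (2 * π)⁻¹ * (‖G z‖ * (1 - reB G G₁ z)))
      (H := fun z => Real.log ‖G z‖ + m) (by fun_prop) (by fun_prop),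
    c.cov_eq (F := fun z => (2 * π)⁻¹ * ‖G z‖) (H := fun z => Real.log ‖G z‖ + m) (by fun_prop)
      (by fun_prop)]
  have e1 : levelIntegral Ψ (fun z => (2 * π)⁻¹ * (‖G z‖ * (1 - reB G G₁ z)) *
      (Real.log ‖G z‖ + m) * ‖G z‖⁻¹) s = (2 * π)⁻¹ * (levelIntegral Ψ (fun z => Real.log ‖G z‖ + m) s
      - levelIntegral Ψ (fun z => (Real.log ‖G z‖ + m) * reB G G₁ z) s) := by
    rw [← c.levelIntegral_one_sub (by fun_prop), ← levelIntegral_const_mul]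
    refine c.half.levelIntegral_congr c.nonneg fun z hz => ?_
    have := (c.norm_pos hz).ne'
    field_simp
  have e2 : levelIntegral Ψ (fun z => (2 * π)⁻¹ * (‖G z‖ * (1 - reB G G₁ z)) * ‖G z‖⁻¹) s = 1 := by
    have : levelIntegral Ψ (fun z => (2 * π)⁻¹ * (1 - reB G G₁ z)) s = 1 := by
      rw [levelIntegral_const_mul, c.levelIntegral_one_sub_re]; field_simp
    refine (c.half.levelIntegral_congr c.nonneg fun z hz => ?_).trans this
    have := (c.norm_pos hz).ne'
    field_simp
  have e3 : levelIntegral Ψ (fun z => (2 * π)⁻¹ * ‖G z‖ * (Real.log ‖G z‖ + m) * ‖G z‖⁻¹) s =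
      (2 * π)⁻¹ * levelIntegral Ψ (fun z => Real.log ‖G z‖ + m) s := by
    rw [← levelIntegral_const_mul]
    refine c.half.levelIntegral_congr c.nonneg fun z hz => ?_
    have := (c.norm_pos hz).ne'
    field_simp
  have e4 : levelIntegral Ψ (fun z => (2 * π)⁻¹ * ‖G z‖ * ‖G z‖⁻¹) s = 1 := by
    have : levelIntegral Ψ (fun _ => (2 * π)⁻¹) s = 1 := by
      rw [levelIntegral_const]; field_simp
    refine (c.half.levelIntegral_congr c.nonneg fun z hz => ?_).trans this
    have := (c.norm_pos hz).ne'
    field_simp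
  have e5 : levelIntegral Ψ (fun z => (Real.log ‖G z‖ + m) * reB G G₁ z) s =
      -levelIntegral Ψ (fun z => reB G G₁ z * -Real.log ‖G z‖) s := by
    have h4 : levelIntegral Ψ (fun z => (Real.log ‖G z‖ + m) * reB G G₁ z) s =
        levelIntegral Ψ (fun z => m * reB G G₁ z - reB G G₁ z * -Real.log ‖G z‖) s := by
      congr 1; ext z; ring
    rw [h4, c.half.levelIntegral_sub c.nonneg (by fun_prop) (by fun_prop), levelIntegral_const_mul,
      levelIntegral_reB c.pot c.map c.half c.nonneg]
    ring
  rw [e1, e2, e3, e4, e5]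
  field_simp
  ring

/-- Both sides times the length are twice the enclosed area. -/
lemma avg_inner_normal : avg γ (fun t => inner ℝ (normal γ t) (γ t)) =
    levelIntegral Ψ (areaDensity G) s / length γ := by
  rw [avg, arcIntegral, ← c.integral_eq _ (continuousOn_areaDensity c.pot c.half)]
  congr 1
  refine intervalIntegral.integral_congr fun t _ => ?_
  simp only [areaDensity]
  rw [← c.pot.area_lift c.half c.param t, Complex.inner, normal, ← Complex.re_mul_ofReal]
  have hne : (‖deriv γ t‖ : ℂ) ≠ 0 := by
    exact_mod_cast norm_ne_zero_iff.mpr (c.param.regular t)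
  rw [map_mul, map_div₀, Complex.conj_ofReal, map_neg, Complex.conj_I, neg_neg,
    show γ t * (Complex.I * (conj (deriv γ t) / (‖deriv γ t‖ : ℂ))) * ‖deriv γ t‖ =
      Complex.I * (γ t * conj (deriv γ t)) by field_simp]
  simp
  ring

lemma avg_inv {e : ℝ} : avg γ (fun t => 1 / (e * ‖G (γ t)‖)) =
    e⁻¹ * levelIntegral Ψ (fun z => ‖G z‖⁻¹ ^ 2) s / length γ := by
  have hq := c.continuousOn_invNorm
  have h1 : ∀ t, 1 / (e * ‖G (γ t)‖) = e⁻¹ * ‖G (γ t)‖⁻¹ := fun t => by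
    rw [one_div, mul_inv]
  simp only [h1]
  rw [c.avg_eq (H := fun z => e⁻¹ * ‖G z‖⁻¹) (by fun_prop), ← levelIntegral_const_mul]
  congr 2; ext z; ring

lemma avg_curvature_div_sq (e : ℝ) : avg γ (fun t => curvature γ t / (e * ‖G (γ t)‖) ^ 2) =
    e⁻¹ ^ 2 * (levelIntegral Ψ (fun z => ‖G z‖⁻¹ ^ 2) s -
      levelIntegral Ψ (fun z => ‖G z‖⁻¹ ^ 2 * reB G G₁ z) s) / length γ := by
  have hq := c.continuousOn_invNorm
  have hβ := c.continuousOn_re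
  have h1 : ∀ t, curvature γ t / (e * ‖G (γ t)‖) ^ 2 =
      e⁻¹ ^ 2 * (‖G (γ t)‖⁻¹ * (1 - reB G G₁ (γ t))) := fun t => by
    have := (c.norm_pos' t).ne'
    rw [sq, ← div_div, c.curvature_div e, div_eq_mul_inv, mul_inv]; ring
  simp only [h1]
  rw [c.avg_eq (H := fun z => e⁻¹ ^ 2 * (‖G z‖⁻¹ * (1 - reB G G₁ z))) (by fun_prop),
    ← c.levelIntegral_one_sub (by fun_prop), ← levelIntegral_const_mul]
  congr 2; ext z; ring

/-- The minus sign arises because `κ/E` is a constant minus a positive multiple of `Re b`. One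
factor of arc length cancels the speed and the factor `1/|G|`, leaving an unweighted angle integral.
-/
lemma avg_tangentialDeriv_mul {e : ℝ} :
    avg γ (fun t => tangentialDeriv γ (fun τ => curvature γ τ / (e * ‖G (γ τ)‖)) t *
      tangentialDeriv γ (fun τ => 1 / (e * ‖G (γ τ)‖)) t) =
    -(e⁻¹ ^ 2 * levelIntegral Ψ
      (fun z => (1 + G₁ z / G z ^ 2).im * imZDerivB G G₁ G₂ z) s / length γ) := by
  have hbi : ContinuousOn (fun z => (1 + G₁ z / G z ^ 2).im) (closure Ω) :=
    Complex.continuous_im.comp_continuousOn (continuousOn_b c.pot c.half)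
  have hz := continuousOn_imZDerivB c.pot c.half
  have hI := c.integral_eq
    (fun z : ℂ => e⁻¹ ^ 2 * ((1 + G₁ z / G z ^ 2).im * imZDerivB G G₁ G₂ z))
    (continuousOn_const.mul (hbi.mul hz))
  rw [avg, arcIntegral, ← neg_div, ← levelIntegral_const_mul, ← hI,
    ← intervalIntegral.integral_neg]
  congr 1
  refine intervalIntegral.integral_congr fun t _ => ?_
  have hw := (c.pos t).ne'
  have hGn := (c.norm_pos' t).ne'
  have h1 : deriv (fun τ => curvature γ τ / (e * ‖G (γ τ)‖)) t =
      e⁻¹ * -((G (γ t) * deriv γ t).im * imZDerivB G G₁ G₂ (γ t)) := by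
    simp only [c.curvature_div e]
    exact ((c.hasDerivAt_reB t).const_sub 1 |>.const_mul e⁻¹).deriv
  have h2 : deriv (fun τ => 1 / (e * ‖G (γ τ)‖)) t =
      e⁻¹ * (‖G (γ t)‖⁻¹ * ((G (γ t) * deriv γ t).im * (1 + G₁ (γ t) / G (γ t) ^ 2).im)) := by
    simp only [one_div, mul_inv]
    exact ((c.hasDerivAt_invNorm t).const_mul e⁻¹).deriv
  simp only [tangentialDeriv]
  rw [h1, h2, c.norm_deriv t]
  generalize (G (γ t) * deriv γ t).im = w at *
  generalize (1 + G₁ (γ t) / G (γ t) ^ 2).im = y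
  field_simp

lemma levelIntegral_sq_ge : levelIntegral Ψ (areaDensity G) s ≤
    levelIntegral Ψ (fun z => ‖G z‖⁻¹ ^ 2) s := by
  have hq := c.continuousOn_invNorm
  have h1 := c.pot.levelIntegral_sq_sub_area_nonneg c.map c.half c.nonneg
  rw [c.half.levelIntegral_sub c.nonneg (by fun_prop) (continuousOn_areaDensity c.pot c.half)] at h1
  linarith

end IsLevelCurve

end

/-! ### The six inequalities and their equality case -/

section

variable {Ω : Set ℂ} {u : ℂ → ℝ} {G G₁ G₂ W φ Ψ : ℂ → ℂ} {a : ℂ} {s : ℝ} {γ : ℝ → ℂ}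

/-- Common pattern of the six cases: the gap `d` is zero for concentric circles and positive
otherwise. -/
lemma leWithEqIff_of_sub_eq {P Q : Prop} {x y d : ℝ} (hPQ : P ↔ Q) (hd : y - x = d)
    (h0 : Q → d = 0) (hpos : ¬ Q → 0 < d) : LeWithEqIff P x y := by
  by_cases hQ : Q
  · have := h0 hQ
    exact ⟨by linarith, iff_of_true (by linarith) (hPQ.mpr hQ)⟩
  · have := hpos hQ
    exact ⟨by linarith, iff_of_false (by linarith) fun hP => hQ (hPQ.mp hP)⟩

lemma cov_const_left (m : ℝ) (f : ℝ → ℝ) (hL : length γ ≠ 0) : cov γ (fun _ => m) f = 0 := by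
  have h1 : avg γ (fun _ => m) = m := by
    rw [avg, arcIntegral, intervalIntegral.integral_const_mul, ← length, mul_div_cancel_right₀ _ hL]
  rw [cov, h1]
  simp [avg, arcIntegral]

namespace IsLevelCurve

variable (c : IsLevelCurve Ω u G G₁ G₂ W φ a Ψ s γ)
include c

lemma b_eq_zero (hround : IsRound Ω G G₁) {z : ℂ} (hz : z ∈ closure Ω) :
    1 + G₁ z / G z ^ 2 = 0 :=
  (show EqOn (fun z => 1 + G₁ z / G z ^ 2) 0 Ω from fun z hz => hround z hz).of_subset_closure
    (continuousOn_b c.pot c.half) continuousOn_const subset_closure Subset.rfl hz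

lemma levelIntegral_eq_zero {F : ℂ → ℝ} (h0 : ∀ z ∈ closure Ω, F z = 0) :
    levelIntegral Ψ F s = 0 := by
  rw [c.half.levelIntegral_congr c.nonneg h0, levelIntegral_const, mul_zero]

lemma levelIntegral_mul_reB_eq_zero (hround : IsRound Ω G G₁) (F : ℂ → ℝ) :
    levelIntegral Ψ (fun z => F z * reB G G₁ z) s = 0 :=
  c.levelIntegral_eq_zero fun z hz => by rw [reB, c.b_eq_zero hround hz]; simp

/-- On concentric circles `1/|G|` is the constant radius, and the contribution of the centre to the
area integrates to zero. -/
lemma levelIntegral_of_round (hround : IsRound Ω G G₁) :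
    length γ * levelIntegral Ψ (fun z => ‖G z‖) s = (2 * π) ^ 2 ∧
      levelIntegral Ψ (areaDensity G) s = levelIntegral Ψ (fun z => ‖G z‖⁻¹ ^ 2) s := by
  obtain ⟨z₀, g₀, hg₀, hpar⟩ := hround.exists_param c.pot c.map c.half c.nonneg
  have hR : 0 < ‖g₀‖ := norm_pos_iff.mpr hg₀
  have hq : ∀ α : ℝ, ‖G (Ψ (s + α * Complex.I))‖⁻¹ = ‖g₀‖ := by
    intro α
    rw [← norm_inv, ← one_div, (hpar α).2, norm_mul, Complex.norm_exp_ofReal_mul_I, mul_one]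
  have hn : ∀ α : ℝ, ‖G (Ψ (s + α * Complex.I))‖ = ‖g₀‖⁻¹ := fun α => by rw [← hq α, inv_inv]
  constructor
  · rw [c.length_eq]
    simp only [levelIntegral, hq]
    simp only [hn]
    simp only [intervalIntegral.integral_const, sub_zero, smul_eq_mul]
    field_simp
  · have hA : ∀ α : ℝ, areaDensity G (Ψ (s + α * Complex.I)) =
        ‖g₀‖ ^ 2 + (conj z₀ * g₀ * Complex.exp (((1 : ℤ) : ℂ) * (α * Complex.I))).re := by
      intro α
      rw [areaDensity, div_eq_mul_one_div, (hpar α).2, (hpar α).1, map_add, add_mul, Complex.add_re,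
        Complex.conj_mul', norm_mul, Complex.norm_exp_ofReal_mul_I, mul_one, ← Complex.ofReal_pow,
        Complex.ofReal_re, Int.cast_one, one_mul, mul_assoc]
      ring
    have hc : Continuous fun α : ℝ =>
        conj z₀ * g₀ * Complex.exp (((1 : ℤ) : ℂ) * (α * Complex.I)) := by fun_prop
    have h0 : ∫ α in (0 : ℝ)..(2 * π),
        (conj z₀ * g₀ * Complex.exp (((1 : ℤ) : ℂ) * (α * Complex.I))).re = 0 := by
      have h1 := Complex.reCLM.intervalIntegral_comp_comm
        (hc.intervalIntegrable (μ := volume) 0 (2 * π))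
      rw [intervalIntegral.integral_const_mul, integral_exp_int_mul, if_neg one_ne_zero,
        Complex.ofReal_zero, mul_zero,
        map_zero] at h1
      exact h1
    simp only [levelIntegral, hq, hA]
    rw [intervalIntegral.integral_add, h0, add_zero]
    · exact intervalIntegrable_const
    · exact (Complex.continuous_re.comp hc).intervalIntegrable _ _

lemma levelIntegral_invNorm_pos (hnr : ¬ IsRound Ω G G₁) :
    0 < levelIntegral Ψ (fun z => ‖G z‖⁻¹ * reB G G₁ z) s := by
  have h1 := levelIntegral_rpow_pos c.pot c.map c.half hnr one_ne_zero c.nonneg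
  simpa only [one_mul, Real.rpow_neg_one] using h1

lemma levelIntegral_norm_neg (hnr : ¬ IsRound Ω G G₁) :
    levelIntegral Ψ (fun z => ‖G z‖ * reB G G₁ z) s < 0 := by
  have h1 := levelIntegral_rpow_pos c.pot c.map c.half hnr (neg_ne_zero.mpr one_ne_zero) c.nonneg
  simp only [neg_neg, Real.rpow_one] at h1
  linarith

lemma levelIntegral_invNorm_sq_pos (hnr : ¬ IsRound Ω G G₁) :
    0 < levelIntegral Ψ (fun z => ‖G z‖⁻¹ ^ 2 * reB G G₁ z) s := by
  have h1 := levelIntegral_rpow_pos c.pot c.map c.half hnr two_ne_zero c.nonneg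
  have h2 := pos_of_mul_pos_right h1 two_pos.le
  simpa only [Real.rpow_neg (norm_nonneg _), Real.rpow_two, inv_pow] using h2

/-- Cauchy–Schwarz for `|G|` and `1/|G|` gives a nonnegative part; strictness comes from the
negative integral of `|G| Re b`. -/
lemma cov_curvature_pos {e : ℝ} (he : 0 < e) (hnr : ¬ IsRound Ω G G₁) :
    0 < cov γ (curvature γ) (fun t => e * ‖G (γ t)‖) := by
  have hL := c.param.length_pos
  rw [c.cov_curvature e]
  have h1 := c.half.levelIntegral_mul_inv_ge c.nonneg c.continuousOn_norm fun z hz => c.norm_pos hz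
  rw [← c.length_eq] at h1
  have h2 := c.levelIntegral_norm_neg hnr
  refine mul_pos he (sub_pos.mpr ?_)
  rw [div_lt_div_iff₀ (by positivity) hL]
  nlinarith [mul_pos hL hL]

end IsLevelCurve

/-- The boundary is a circle exactly if `G = 1 / (z - z₀)`. -/
lemma IsLevelCurve.isCircle_iff (c : IsLevelCurve Ω u G G₁ G₂ W φ a Ψ s γ)
    (hcurve : ∀ γ, IsJordanParam γ (frontier Ω) → IsLevelCurve Ω u G G₁ G₂ W φ a Ψ 0 γ) :
    IsCircle (frontier Ω) ↔ IsRound Ω G G₁ := by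
  refine ⟨fun ⟨z₀, R, hR, hC⟩ => ?_, fun hr => hr.isCircle c.pot c.map c.half⟩
  -- If the boundary is a circle, its curvature is constant and has zero covariance with `E`,
  -- against the strict inequality in the non-round case.
  by_contra hnr
  have hp := isJordanParam_sphere z₀ hR
  have c' := hcurve _ (hC ▸ hp)
  have h1 := c'.cov_curvature_pos one_pos hnr
  rw [show curvature (circleMap z₀ R) = fun _ => 1 / R from funext (curvature_circleMap z₀ hR),
    cov_const_left _ _ hp.length_pos.ne'] at h1
  exact lt_irrefl _ h1

/-- The six sharp inequalities on a level curve, for the field intensity `e * ‖G‖`. -/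
theorem IsLevelCurve.inequalities (c : IsLevelCurve Ω u G G₁ G₂ W φ a Ψ s γ) {e : ℝ} (he : 0 < e)
    {P : Prop} (hP : P ↔ IsRound Ω G G₁) {κ E : ℝ → ℝ} (hκ : κ = curvature γ)
    (hE : E = fun t => e * ‖G (γ t)‖) :
    LeWithEqIff P 0 (cov γ (fun t => κ t / E t) E) ∧
    LeWithEqIff P (avg γ (fun t => κ t / E t) * avg γ (fun t => inner ℝ (normal γ t) (γ t)))
      (avg γ (fun t => 1 / E t)) ∧
    LeWithEqIff P 0 (cov γ κ E) ∧
    LeWithEqIff P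
      (cov γ (fun t => E t / (2 * π * e)) (fun t => Real.log (E t * length γ / (2 * π * e))))
      (cov γ (fun t => κ t / (2 * π)) (fun t => Real.log (E t * length γ / (2 * π * e)))) ∧
    LeWithEqIff P (avg γ (fun t => tangentialDeriv γ (fun τ => κ τ / E τ) t *
      tangentialDeriv γ (fun τ => 1 / E τ) t)) 0 ∧
    LeWithEqIff P (avg γ (fun t => κ t / E t ^ 2))
      (2 * π / (2 * π * e) * avg γ (fun t => 1 / E t)) := by
  subst hκ hE
  have hL := c.param.length_pos
  have hLne := hL.ne'
  have hπ := pi_pos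
  refine ⟨?_, ?_, ?_, ?_, ?_, ?_⟩
  · refine leWithEqIff_of_sub_eq hP ((sub_zero _).trans (c.cov_curvature_div he)) (fun hr => ?_)
      fun hnr => ?_
    · rw [c.levelIntegral_mul_reB_eq_zero hr]; simp
    · have := c.levelIntegral_invNorm_pos hnr
      positivity
  · simp only
    rw [c.avg_curvature_div, c.avg_inner_normal, c.avg_inv]
    -- The gap splits into the excess of `∫ 1/|G|²` over twice the area, which is nonnegative, and
    -- the area times `∫ Re b / |G|`, which is strictly positive.
    refine leWithEqIff_of_sub_eq hP (d := e⁻¹ *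
      ((levelIntegral Ψ (fun z => ‖G z‖⁻¹ ^ 2) s - levelIntegral Ψ (areaDensity G) s) * length γ +
        levelIntegral Ψ (fun z => ‖G z‖⁻¹ * reB G G₁ z) s * levelIntegral Ψ (areaDensity G) s) /
        length γ ^ 2) ?_ (fun hr => ?_) fun hnr => ?_
    · field_simp; ring
    · rw [c.levelIntegral_mul_reB_eq_zero hr, (c.levelIntegral_of_round hr).2]; simp
    · have h1 := c.levelIntegral_invNorm_pos hnr
      have h2 := c.area_pos
      have h3 := sub_nonneg.mpr c.levelIntegral_sq_ge
      have h4 := mul_nonneg h3 hL.le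
      positivity
  · refine leWithEqIff_of_sub_eq hP (sub_zero _) (fun hr => ?_) fun hnr => c.cov_curvature_pos he hnr
    rw [c.cov_curvature, c.levelIntegral_mul_reB_eq_zero hr, ← (c.levelIntegral_of_round hr).1]
    field_simp
    ring
  · refine leWithEqIff_of_sub_eq hP (c.cov_curvature_log_sub he) (fun hr => ?_) fun hnr => ?_
    · simp only [mul_comm (reB G G₁ _)]
      rw [c.levelIntegral_mul_reB_eq_zero hr]; simp
    · have := levelIntegral_log_pos c.pot c.map c.half hnr c.nonneg
      positivity
  · simp only
    rw [c.avg_tangentialDeriv_mul]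
    refine leWithEqIff_of_sub_eq hP ((zero_sub _).trans (neg_neg _)) (fun hr => ?_) fun hnr => ?_
    · rw [c.levelIntegral_eq_zero fun z hz => by rw [c.b_eq_zero hr hz]; simp]; simp
    · have := levelIntegral_deriv_pos c.pot c.map c.half hnr c.nonneg
      positivity
  · simp only
    rw [c.avg_curvature_div_sq, c.avg_inv]
    refine leWithEqIff_of_sub_eq hP (d := e⁻¹ ^ 2 *
      levelIntegral Ψ (fun z => ‖G z‖⁻¹ ^ 2 * reB G G₁ z) s / length γ) ?_ (fun hr => ?_)
      fun hnr => ?_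
    · field_simp; ring
    · rw [c.levelIntegral_mul_reB_eq_zero hr]; simp
    · have := c.levelIntegral_invNorm_sq_pos hnr
      positivity

end

end EquipotentialCurves

end

/-! ### The theorem: translation from `U` to the normalized potential -/

open EquipotentialCurves in
theorem theorem1 (Ω : Set ℂ) (γ₀ : ℝ → ℂ) (U : ℂ → ℝ) (Φ : ℝ)
    (hU : IsExteriorDirichlet Ω γ₀ U Φ) :
    (∀ r ∈ closure Ω, intensity Ω U r ≠ 0) ∧
    ∀ φ : ℝ, (levelSet Ω U φ).Nonempty →
      (∃ γ : ℝ → ℂ, IsJordanParam γ (levelSet Ω U φ)) ∧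
      ∀ γ : ℝ → ℂ, IsJordanParam γ (levelSet Ω U φ) →
        ∀ κ E : ℝ → ℝ, κ = curvature γ → E = (fun t => intensity Ω U (γ t)) →
          LeWithEqIff (IsCircle (frontier Ω))
            0 (cov γ (fun t => κ t / E t) E) ∧
          LeWithEqIff (IsCircle (frontier Ω))
            (avg γ (fun t => κ t / E t) * avg γ (fun t => inner ℝ (normal γ t) (γ t)))
            (avg γ (fun t => 1 / E t)) ∧
          LeWithEqIff (IsCircle (frontier Ω))
            0 (cov γ κ E) ∧
          LeWithEqIff (IsCircle (frontier Ω))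
            (cov γ (fun t => E t / Φ) (fun t => Real.log (E t * length γ / Φ)))
            (cov γ (fun t => κ t / (2 * Real.pi)) (fun t => Real.log (E t * length γ / Φ))) ∧
          LeWithEqIff (IsCircle (frontier Ω))
            (avg γ (fun t => tangentialDeriv γ (fun τ => κ τ / E τ) t *
              tangentialDeriv γ (fun τ => 1 / E τ) t))
            0 ∧
          LeWithEqIff (IsCircle (frontier Ω))
            (avg γ (fun t => κ t / E t ^ 2))
            (2 * Real.pi / Φ * avg γ (fun t => 1 / E t)) := by
  obtain ⟨c, u, G, G₁, G₂, h, hUu, hint_eq, hflux⟩ := hU.exists_smoothPotential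
  obtain ⟨W, f, a, hm⟩ := h.toIsExteriorPotential.exists_exteriorMap
  obtain ⟨Ψ, hΨ⟩ := h.exists_halfPlaneMap hm hU.boundary
  obtain ⟨hinj₀, hA₀⟩ := h.boundary_angle hm hΨ hU.boundary hflux
  have hΦ := hU.flux_pos
  have hπ := Real.pi_pos
  -- This is the factor `e` with `E = e |G|` and `Φ = 2π e`; the level `U = φ` is the level `u = (c
  -- - φ) / e`.
  have he : 0 < Φ / (2 * Real.pi) := by positivity
  have hΦe : 2 * Real.pi * (Φ / (2 * Real.pi)) = Φ := by field_simp
  have hcurve : ∀ s, 0 ≤ s → ∀ γ, IsJordanParam γ (potentialLevel Ω u s) →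
      IsLevelCurve Ω u G G₁ G₂ W f a Ψ s γ := by
    intro s hs γ hγ
    have hA := h.levelIntegral_area_pos hm hΨ hA₀ hs
    have hinj : IsAngleInjective Ψ s := by
      rcases hs.lt_or_eq with hs' | rfl
      · exact hm.isAngleInjective hΨ hs'
      · exact hinj₀
    obtain ⟨h1, h2⟩ := h.exists_angle hm hΨ hs hinj hA hγ
    exact ⟨h, hm, hΨ, hs, hγ, hA, h1, h2⟩
  refine ⟨fun r hr => ?_, fun φ hne => ?_⟩
  · rw [hint_eq r hr]
    exact mul_ne_zero he.ne' (norm_ne_zero_iff.mpr (hΨ.G_ne_zero r hr))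
  have hlevel : levelSet Ω U φ = potentialLevel Ω u ((c - φ) / (Φ / (2 * Real.pi))) := by
    ext z
    refine and_congr_right fun _ => ?_
    rw [hUu z, eq_div_iff he.ne']
    constructor <;> intro h0 <;> linarith
  rw [hlevel] at hne ⊢
  generalize (c - φ) / (Φ / (2 * Real.pi)) = s at hne ⊢
  have hs : 0 ≤ s := by
    obtain ⟨z, hz, rfl⟩ := hne
    by_cases hzΩ : z ∈ Ω
    · exact (hm.u_pos z hzΩ).le
    · exact (h.boundary z (by rw [h.isOpen.frontier_eq]; exact ⟨hz, hzΩ⟩)).ge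
  refine ⟨?_, fun γ hγ κ E hκ hE => ?_⟩
  · rcases hs.lt_or_eq with hs' | rfl
    · exact ⟨_, h.isJordanParam_level hm hΨ hs' (h.levelIntegral_area_pos hm hΨ hA₀ hs)⟩
    -- On the boundary line smoothness and injectivity of `Ψ` are not part of the half-plane map, so
    -- the given parametrization serves there.
    · exact ⟨γ₀, by rw [h.potentialLevel_zero hm]; exact hU.boundary⟩
  · have hc := hcurve s hs γ hγ
    have hcirc := hc.isCircle_iff fun γ' hγ' =>
      hcurve 0 le_rfl γ' (by rwa [h.potentialLevel_zero hm])
    have := hc.inequalities he hcirc hκ (hE.trans (funext fun t => hint_eq _ (hc.mem t)))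
    rwa [hΦe] at this
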